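/- Let $N\ge 1$, let $\Omega\subset\mathbb R^N$ be a nonempty, bounded, connected open set with Lipschitz boundary, let $(\Gamma_0,\Gamma_1)$ be a partition of $\partial\Omega$ into two $\mathcal H^{N-1}$-measurable sets, let $p\in(1,+\infty)$ and $u_0\in W^{1,p}(\Omega)$. Let $f=f(t,z):\mathbb R\times\mathbb R^N\to(-\infty,+\infty]$ satisfy: - for every $t\in\mathbb R$, the function $z\mapsto f(t,z)$ is convex; - $(t,z)\mapsto f(t,z)$ is lower semicontinuous on $\mathbb R\times\mathbb R^N$; - $f(t,z)\ge\alpha|z|^p-r(t)$ for all $(t,z)\in\mathbb R\times\mathbb R^N$, where $\alpha>0$ is a constant and $r:\mathbb R\to\mathbb R$ is a Borel function with $0\le r(t)\le C$ for some constant $C>0$; - there is a Lebesgue negligible set $D\subset\mathbb R$ such that $f(t,z)\ge\limsup_{s\to t}f(s,z)$ for all $z\in\mathbb R^N$ and all $t\in\mathbb R\setminus D$. Let $\gamma:\mathbb R\to\mathbb R$ be a Lipschitz function with $\gamma(0)=0$ and $$\inf_{t\in\mathbb R}\gamma(t)>-\infty\ \text{ if }\mathcal H^{N-1}(\Gamma_0)>0,\qquad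 \liminf_{|t|\to+\infty}\frac{\gamma(t)}{|t|}>0\ \text{ if }\mathcal H^{N-1}(\Gamma_0)=0 .$$ Set $$\mathcal A:=\{u\in W^{1,p}(\Omega): u=u_0\text{ on }\Gamma_0\},\qquad E(u):=\int_\Omega f(u,\nabla u)\,dx+\int_{\Gamma_1}\gamma(u)\,d\mathcal H^{N-1},$$ where the boundary values of functions in $W^{1,p}(\Omega)$ are understood in the sense of traces and equality on $\Gamma_0$ holds $\mathcal H^{N-1}$-almost everywhere. Assume that there is $u\in\mathcal A$ with $E(u)<+\infty$. Then the infimum $\mathcal I:=\inf\{E(u):u\in\mathcal A\}$ is finite and attained: $-\infty<\mathcal I<+\infty$, and there is $u\in\mathcal A$ with $E(u)=\mathcal I$. -/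

import Mathlib

open MeasureTheory Filter Topology Set
open scoped ENNReal NNReal ContDiff

noncomputable section

namespace PrimalProblem

variable {N : ℕ}

/-- The boundary of `Ω` is Lipschitz: near each boundary point `x`, after the choice of a
direction `e` (a unit vector), `Ω` is the strict epigraph, in direction `e`, of a Lipschitz function
`ψ` defined on the hyperplane orthogonal to `e`. -/
def HasLipschitzBoundary (Ω : Set (EuclideanSpace ℝ (Fin N))) : Prop :=
  ∀ x ∈ frontier Ω, ∃ (e : EuclideanSpace ℝ (Fin N)) (ρ : ℝ) (L : ℝ≥0)
    (ψ : (ℝ ∙ e)ᗮ → ℝ),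
    ‖e‖ = 1 ∧ 0 < ρ ∧ LipschitzWith L ψ ∧
    ∀ y ∈ Metric.ball x ρ,
      (y ∈ Ω ↔ ψ ((ℝ ∙ e)ᗮ.orthogonalProjectionOnto y) < inner ℝ e y)

/-- The surface measure on the boundary: the restriction to `∂Ω` of the `(N-1)`-dimensional
Hausdorff measure (with the Euclidean normalization). Only used for `1 ≤ N`. -/
def surfaceMeasure (Ω : Set (EuclideanSpace ℝ (Fin N))) :
    Measure (EuclideanSpace ℝ (Fin N)) :=
  (Measure.euclideanHausdorffMeasure (N - 1)).restrict (frontier Ω)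

/-- `G` is a weak (distributional) gradient of `u` in `Ω`. -/
def HasWeakGradient (Ω : Set (EuclideanSpace ℝ (Fin N))) (u : EuclideanSpace ℝ (Fin N) → ℝ)
    (G : EuclideanSpace ℝ (Fin N) → EuclideanSpace ℝ (Fin N)) : Prop :=
  LocallyIntegrableOn u Ω volume ∧ LocallyIntegrableOn G Ω volume ∧
  ∀ φ : EuclideanSpace ℝ (Fin N) → ℝ, ContDiff ℝ ∞ φ → HasCompactSupport φ → tsupport φ ⊆ Ω →
    ∀ i : Fin N,
      ∫ x in Ω, u x * fderiv ℝ φ x (EuclideanSpace.single i 1) = - ∫ x in Ω, G x i * φ x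

/-- The Sobolev space `W^{1,p}(Ω)`, as a set of representatives: only the values on `Ω`
matter. -/
def MemW1p (Ω : Set (EuclideanSpace ℝ (Fin N))) (p : ℝ≥0∞)
    (u : EuclideanSpace ℝ (Fin N) → ℝ) : Prop :=
  MemLp u p (volume.restrict Ω) ∧
  ∃ G, HasWeakGradient Ω u G ∧ MemLp G p (volume.restrict Ω)

open Classical in
/-- The weak gradient of `u` in `Ω` (unique up to a null set if it exists, and `0` by convention
otherwise). -/
def weakGradient (Ω : Set (EuclideanSpace ℝ (Fin N))) (u : EuclideanSpace ℝ (Fin N) → ℝ) :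
    EuclideanSpace ℝ (Fin N) → EuclideanSpace ℝ (Fin N) :=
  if h : ∃ G, HasWeakGradient Ω u G then h.choose else 0

/-- `g` is the boundary trace of `u ∈ W^{1,p}(Ω)`: there are functions smooth up to the boundary
that converge to `u` in `W^{1,p}(Ω)` and whose restrictions to `∂Ω` converge to `g` in
`L^p(∂Ω)`. -/
def IsTrace (Ω : Set (EuclideanSpace ℝ (Fin N))) (p : ℝ≥0∞)
    (u g : EuclideanSpace ℝ (Fin N) → ℝ) : Prop :=
  MemLp g p (surfaceMeasure Ω) ∧
  ∃ φ : ℕ → EuclideanSpace ℝ (Fin N) → ℝ,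
    (∀ k, ContDiff ℝ ∞ (φ k)) ∧
    Tendsto (fun k => eLpNorm (fun x => φ k x - u x) p (volume.restrict Ω)) atTop (𝓝 0) ∧
    Tendsto (fun k => eLpNorm (fun x => gradient (φ k) x - weakGradient Ω u x) p
      (volume.restrict Ω)) atTop (𝓝 0) ∧
    Tendsto (fun k => eLpNorm (fun x => φ k x - g x) p (surfaceMeasure Ω)) atTop (𝓝 0)

open Classical in
/-- The boundary trace of `u` (for bounded Lipschitz `Ω` and `u ∈ W^{1,p}(Ω)` it exists and is
unique up to a null set of `∂Ω`; it is `0` by convention where it does not exist). -/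
def trace (Ω : Set (EuclideanSpace ℝ (Fin N))) (p : ℝ≥0∞)
    (u : EuclideanSpace ℝ (Fin N) → ℝ) : EuclideanSpace ℝ (Fin N) → ℝ :=
  if h : ∃ g, IsTrace Ω p u g then h.choose else 0

/-- The integral of an extended-real function, as the integral of the positive part minus the
integral of the negative part. -/
def eintegral {α : Type*} [MeasurableSpace α] (μ : Measure α) (g : α → EReal) : EReal :=
  ((∫⁻ x, (g x).toENNReal ∂μ : ℝ≥0∞) : EReal) - ((∫⁻ x, (-g x).toENNReal ∂μ : ℝ≥0∞) : EReal)

/-- The energy `E(u) = ∫_Ω f(u, ∇u) dx + ∫_{Γ₁} γ(u) dH^{N-1}`, where `u` is understood on the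
boundary in the sense of traces. -/
def energy (Ω Γ₁ : Set (EuclideanSpace ℝ (Fin N))) (p : ℝ≥0∞)
    (f : ℝ → EuclideanSpace ℝ (Fin N) → EReal) (γ : ℝ → ℝ)
    (u : EuclideanSpace ℝ (Fin N) → ℝ) : EReal :=
  eintegral (volume.restrict Ω) (fun x => f (u x) (weakGradient Ω u x)) +
    eintegral ((surfaceMeasure Ω).restrict Γ₁) (fun x => ((γ (trace Ω p u x) : ℝ) : EReal))

/-- The admissible class `{u ∈ W^{1,p}(Ω) : u = u₀ on Γ₀}`, the boundary condition being
understood in the sense of traces. -/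
def admissible (Ω Γ₀ : Set (EuclideanSpace ℝ (Fin N))) (p : ℝ≥0∞)
    (u₀ : EuclideanSpace ℝ (Fin N) → ℝ) : Set (EuclideanSpace ℝ (Fin N) → ℝ) :=
  {u | MemW1p Ω p u ∧ trace Ω p u =ᵐ[(surfaceMeasure Ω).restrict Γ₀] trace Ω p u₀}

/-- The infimum of the primal problem, in the extended reals. -/
def primalInf (Ω Γ₀ Γ₁ : Set (EuclideanSpace ℝ (Fin N))) (p : ℝ≥0∞)
    (f : ℝ → EuclideanSpace ℝ (Fin N) → EReal) (γ : ℝ → ℝ)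
    (u₀ : EuclideanSpace ℝ (Fin N) → ℝ) : EReal :=
  sInf (energy Ω Γ₁ p f γ '' admissible Ω Γ₀ p u₀)

/-- Convexity of a function with values in `(-∞, +∞]`. -/
def EConvex (g : EuclideanSpace ℝ (Fin N) → EReal) : Prop :=
  ∀ (z w : EuclideanSpace ℝ (Fin N)) (a b : ℝ), 0 ≤ a → 0 ≤ b → a + b = 1 →
    g (a • z + b • w) ≤ (a : EReal) * g z + (b : EReal) * g w

end PrimalProblem

end

/-!
The proof is the direct method of the calculus of variations. By the growth of `f` and the lower
bound `c |t| - c₁ ≤ γ t` (`exists_boundary_growth`), a minimizing sequence `u n` has gradients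
bounded in `L^p(Ω)` and traces bounded in `L^1(S)` on a part `S` of `∂Ω` of positive measure:
`S = Γ₀`, where the traces are prescribed, if `Γ₀` is not negligible, and `S = Γ₁`, where `γ` controls
them, otherwise. The Poincaré inequality `InwardPartition.exists_poincare_le` then bounds the
sequence in `W^{1,p}(Ω)`, and `InwardPartition.exists_weak_limit` yields, along a subsequence,
convergence of `u n` almost everywhere in `Ω`, of the traces in `L^p(∂Ω)`, and of convex
combinations of tails of the gradients almost everywhere. The boundary condition and the boundary
energy pass to the limit by the convergence of the traces, and the bulk energy is lower
semicontinuous (`lintegral_shifted_le`).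

Lower semicontinuity holds because `f` is jointly lower semicontinuous, convex in `z`, and
coercive uniformly in `t`: an affine function strictly below `f(t, ·)` stays below `f(s, ·)` for
`s` near `t`, and affine functions commute with convex combinations. Instead of weak compactness,
strong convergence of convex combinations is used; it comes from the uniform convexity of the norm
of `L^p` (`exists_tailWeights_tendsto_Lp`).

The theory of `W^{1,p}(Ω)` rests on one consequence of the Lipschitz boundary, `InwardChart`:
locally there is a cone of directions that point from `closure Ω` into `Ω`, and integrating along
its axis from `∂Ω` is controlled by integrating over `Ω`. Mollifying along the cone gives the
density of smooth functions (`exists_contDiff_approx`) and Rellich's theorem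
(`InwardPartition.exists_subseq_tendsto`); the fundamental theorem of calculus along the axis
gives the trace inequality (`InwardPartition.exists_trace_le`), and with it existence and
uniqueness of traces. All estimates are proved for smooth functions, and are transferred through
the density that the definition of the trace contains.
-/

namespace PrimalProblem

/-! ### Strong convergence of convex combinations in `L^p` -/

lemma norm_half_add_rpow_lt {V : Type*} [NormedAddCommGroup V] [InnerProductSpace ℝ V]
    {p : ℝ} (hp : 1 < p) {a b : V} (hab : a ≠ b) :
    ‖(1 / 2 : ℝ) • (a + b)‖ ^ p < (‖a‖ ^ p + ‖b‖ ^ p) / 2 := by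
  have hp0 : 0 < p := by linarith
  by_cases h : ‖a‖ = ‖b‖
  · have h1 : ‖(1 / 2 : ℝ) • a + (1 / 2 : ℝ) • b‖ < ‖a‖ :=
      norm_combo_lt_of_ne (le_refl _) h.symm.le hab (by norm_num) (by norm_num) (by norm_num)
    rw [← h, smul_add]
    have := Real.rpow_lt_rpow (norm_nonneg _) h1 hp0
    linarith
  · have h1 := (strictConvexOn_rpow hp).2 (norm_nonneg a) (norm_nonneg b) h
      (by norm_num : (0 : ℝ) < 1 / 2) (by norm_num : (0 : ℝ) < 1 / 2) (by norm_num)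
    have h2 : ‖(1 / 2 : ℝ) • (a + b)‖ ≤ (1 / 2 : ℝ) • ‖a‖ + (1 / 2 : ℝ) • ‖b‖ := by
      rw [norm_smul, ← smul_add]
      simp only [smul_eq_mul, norm_div, norm_one, Real.norm_ofNat]
      gcongr
      exact norm_add_le a b
    have h3 := Real.rpow_le_rpow (norm_nonneg _) h2 hp0.le
    simp only [smul_eq_mul] at h1 h3
    linarith

/-- Quantitative strict convexity of `‖·‖ ^ p`: by homogeneity, it suffices to bound the convexity
defect from below on a compact set. -/
lemma exists_norm_sub_rpow_le {V : Type*} [NormedAddCommGroup V] [InnerProductSpace ℝ V]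
    [FiniteDimensional ℝ V] {p : ℝ} (hp : 1 < p) {ε : ℝ} (hε : 0 < ε) :
    ∃ C : ℝ, 0 ≤ C ∧ ∀ a b : V, ‖a - b‖ ^ p ≤ ε * (‖a‖ ^ p + ‖b‖ ^ p) +
      C * ((‖a‖ ^ p + ‖b‖ ^ p) / 2 - ‖(1 / 2 : ℝ) • (a + b)‖ ^ p) := by
  have hp0 : 0 < p := by linarith
  let F : V × V → ℝ := fun q => (‖q.1‖ ^ p + ‖q.2‖ ^ p) / 2 - ‖(1 / 2 : ℝ) • (q.1 + q.2)‖ ^ p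
  have hFc : Continuous F := by
    refine (Continuous.div_const (Continuous.add ?_ ?_) _).sub ?_
    · exact (continuous_norm.comp continuous_fst).rpow_const fun _ => Or.inr hp0.le
    · exact (continuous_norm.comp continuous_snd).rpow_const fun _ => Or.inr hp0.le
    · exact (continuous_norm.comp ((continuous_fst.add continuous_snd).const_smul _)).rpow_const
        fun _ => Or.inr hp0.le
  have hF0 : ∀ a b : V, 0 ≤ F (a, b) := by
    intro a b
    by_cases h : a = b
    · subst h
      have : (1 / 2 : ℝ) • (a + a) = a := by
        rw [← two_smul ℝ a, smul_smul]; norm_num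
      simp only [F, this]
      linarith
    · exact sub_nonneg.2 (norm_half_add_rpow_lt hp h).le
  have hGc : Continuous fun q : V × V => ‖q.1‖ ^ p + ‖q.2‖ ^ p :=
    ((continuous_norm.comp continuous_fst).rpow_const fun _ => Or.inr hp0.le).add
      ((continuous_norm.comp continuous_snd).rpow_const fun _ => Or.inr hp0.le)
  have hHc : Continuous fun q : V × V => ‖q.1 - q.2‖ ^ p :=
    (continuous_norm.comp (continuous_fst.sub continuous_snd)).rpow_const fun _ => Or.inr hp0.le
  -- on this compact set of normalized pairs, the convexity defect has a positive minimum
  let S : Set (V × V) := {q | ‖q.1‖ ^ p + ‖q.2‖ ^ p = 1 ∧ ε ≤ ‖q.1 - q.2‖ ^ p}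
  have hS1 : ∀ q : V × V, ‖q.1‖ ^ p + ‖q.2‖ ^ p = 1 → ‖q.1‖ ≤ 1 ∧ ‖q.2‖ ≤ 1 := by
    intro q hq
    have h1 := Real.rpow_nonneg (norm_nonneg q.1) p
    have h2 := Real.rpow_nonneg (norm_nonneg q.2) p
    constructor
    · refine (Real.rpow_le_rpow_iff (norm_nonneg _) zero_le_one hp0).1 ?_
      rw [Real.one_rpow]; linarith
    · refine (Real.rpow_le_rpow_iff (norm_nonneg _) zero_le_one hp0).1 ?_
      rw [Real.one_rpow]; linarith
  have hScl : IsClosed S :=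
    (isClosed_eq hGc continuous_const).inter (isClosed_le continuous_const hHc)
  have hSc : IsCompact S := by
    refine Metric.isCompact_of_isClosed_isBounded hScl ?_
    refine (Metric.isBounded_closedBall (x := (0 : V × V)) (r := 1)).subset ?_
    intro q hq
    rw [mem_closedBall_zero_iff, Prod.norm_def]
    exact max_le (hS1 q hq.1).1 (hS1 q hq.1).2
  obtain ⟨δ, hδ, hδS⟩ : ∃ δ > 0, ∀ q ∈ S, δ ≤ F q := by
    rcases S.eq_empty_or_nonempty with h | h
    · exact ⟨1, one_pos, by simp [h]⟩
    · obtain ⟨q, hq, hmin⟩ := hSc.exists_isMinOn h hFc.continuousOn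
      refine ⟨F q, ?_, fun q' hq' => hmin hq'⟩
      have hne : q.1 ≠ q.2 := by
        intro h0
        have := hq.2
        rw [h0, sub_self, norm_zero, Real.zero_rpow hp0.ne'] at this
        linarith
      exact sub_pos.2 (norm_half_add_rpow_lt hp hne)
  refine ⟨2 ^ p / δ, by positivity, ?_⟩
  have key : ∀ a b : V, ‖a‖ ^ p + ‖b‖ ^ p = 1 →
      ‖a - b‖ ^ p ≤ ε + 2 ^ p / δ * F (a, b) := by
    intro a b hab
    by_cases h : ε ≤ ‖a - b‖ ^ p
    · have h1 := hδS (a, b) ⟨hab, h⟩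
      have h2 : ‖a - b‖ ^ p ≤ 2 ^ p := by
        refine Real.rpow_le_rpow (norm_nonneg _) ?_ hp0.le
        have := hS1 (a, b) hab
        have h3 := norm_sub_le a b
        simp only at this
        linarith
      have h3 : (2 : ℝ) ^ p ≤ 2 ^ p / δ * F (a, b) := by
        rw [div_mul_eq_mul_div, le_div_iff₀ hδ]
        gcongr
      linarith
    · have := mul_nonneg (by positivity : 0 ≤ (2 : ℝ) ^ p / δ) (hF0 a b)
      push Not at h
      linarith
  intro a b
  set σ := ‖a‖ ^ p + ‖b‖ ^ p with hσ
  have h1 := Real.rpow_nonneg (norm_nonneg a) p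
  have h2 := Real.rpow_nonneg (norm_nonneg b) p
  rcases (add_nonneg h1 h2).eq_or_lt' with h0 | h0
  · have ha : ‖a‖ ^ p = 0 := by linarith
    have hb : ‖b‖ ^ p = 0 := by linarith
    have ha' : a = 0 := by simpa using ((Real.rpow_eq_zero (norm_nonneg _) hp0.ne').1 ha)
    have hb' : b = 0 := by simpa using ((Real.rpow_eq_zero (norm_nonneg _) hp0.ne').1 hb)
    simp [hσ, ha', hb', Real.zero_rpow hp0.ne']
  · rw [← hσ] at h0
    let t : ℝ := σ ^ (-(1 / p))
    have ht : 0 < t := Real.rpow_pos_of_pos h0 _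
    have htp : t ^ p = σ⁻¹ := by
      rw [← Real.rpow_mul h0.le, neg_mul, one_div, inv_mul_cancel₀ hp0.ne', Real.rpow_neg_one]
    have hsc : ∀ v : V, ‖t • v‖ ^ p = σ⁻¹ * ‖v‖ ^ p := by
      intro v
      rw [norm_smul, Real.norm_of_nonneg ht.le, Real.mul_rpow ht.le (norm_nonneg _), htp]
    have h3 := key (t • a) (t • b) (by
      rw [hsc, hsc, ← mul_add, ← hσ, inv_mul_cancel₀ h0.ne'])
    have h4 : F (t • a, t • b) = σ⁻¹ * F (a, b) := by
      simp only [F]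
      rw [← smul_add, smul_comm, hsc, hsc, hsc]
      ring
    rw [← smul_sub, hsc, h4] at h3
    have h5 := mul_le_mul_of_nonneg_left h3 h0.le
    have h6 : σ * (σ⁻¹ * ‖a - b‖ ^ p) = ‖a - b‖ ^ p := by
      field_simp
    have h7 : σ * (ε + 2 ^ p / δ * (σ⁻¹ * F (a, b))) = ε * σ + 2 ^ p / δ * F (a, b) := by
      field_simp
    rw [h6, h7] at h5
    exact h5

lemma Lp_norm_rpow_eq_integral {α V : Type*} [MeasurableSpace α] {μ : Measure α}
    [NormedAddCommGroup V] {p : ℝ} (hp : 1 < p) (f : Lp V (ENNReal.ofReal p) μ) :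
    ‖f‖ ^ p = ∫ x, ‖f x‖ ^ p ∂μ := by
  have hp0 : 0 < p := by linarith
  have h := (Lp.memLp f).eLpNorm_eq_integral_rpow_norm (by simpa using hp0) ENNReal.ofReal_ne_top
  have h0 : 0 ≤ ∫ x, ‖f x‖ ^ p ∂μ :=
    integral_nonneg fun x => Real.rpow_nonneg (norm_nonneg _) _
  rw [ENNReal.toReal_ofReal hp0.le] at h
  rw [Lp.norm_def, h, ENNReal.toReal_ofReal (Real.rpow_nonneg h0 _), ← Real.rpow_mul h0,
    inv_mul_cancel₀ hp0.ne', Real.rpow_one]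

/-- The norm of `L^p` is uniformly convex: the pointwise inequality, integrated. -/
lemma Lp_exists_norm_sub_rpow_le {α V : Type*} [MeasurableSpace α] {μ : Measure α}
    [NormedAddCommGroup V] [InnerProductSpace ℝ V] [FiniteDimensional ℝ V]
    {p : ℝ} (hp : 1 < p) {ε : ℝ} (hε : 0 < ε) :
    ∃ C : ℝ, 0 ≤ C ∧ ∀ a b : Lp V (ENNReal.ofReal p) μ, ‖a - b‖ ^ p ≤ ε * (‖a‖ ^ p + ‖b‖ ^ p) +
      C * ((‖a‖ ^ p + ‖b‖ ^ p) / 2 - ‖(1 / 2 : ℝ) • (a + b)‖ ^ p) := by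
  have hp0 : 0 < p := by linarith
  obtain ⟨C, hC, h⟩ := exists_norm_sub_rpow_le (V := V) hp hε
  refine ⟨C, hC, fun a b => ?_⟩
  have hi : ∀ f : Lp V (ENNReal.ofReal p) μ, Integrable (fun x => ‖f x‖ ^ p) μ := by
    intro f
    have := (Lp.memLp f).integrable_norm_rpow (by simpa using hp0) ENNReal.ofReal_ne_top
    rwa [ENNReal.toReal_ofReal hp0.le] at this
  simp only [Lp_norm_rpow_eq_integral hp]
  have hab : Integrable (fun x => ‖a x‖ ^ p + ‖b x‖ ^ p) μ := (hi a).add (hi b)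
  have hdef : Integrable (fun x => (‖a x‖ ^ p + ‖b x‖ ^ p) / 2 -
      ‖((1 / 2 : ℝ) • (a + b) : Lp V (ENNReal.ofReal p) μ) x‖ ^ p) μ :=
    (hab.div_const 2).sub (hi _)
  rw [← integral_add (hi a) (hi b), ← integral_const_mul, ← integral_div,
    ← integral_sub (hab.div_const 2) (hi _), ← integral_const_mul,
    ← integral_add (hab.const_mul _) (hdef.const_mul _)]
  refine integral_mono_ae (hi _) ((hab.const_mul _).add (hdef.const_mul _)) ?_
  · filter_upwards [Lp.coeFn_sub a b, Lp.coeFn_add a b, Lp.coeFn_smul (1 / 2 : ℝ) (a + b)]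
      with x h1 h2 h3
    rw [h1, h3]
    simp only [Pi.sub_apply, Pi.smul_apply, h2, Pi.add_apply]
    exact h _ _

/-- In a complete space whose norm is uniformly convex, a bounded sequence has convex combinations
of its tails that converge in norm: elements of almost minimal norm in the convex hulls of the
tails form a Cauchy sequence. -/
lemma exists_convexHull_tendsto {X : Type*} [NormedAddCommGroup X] [NormedSpace ℝ X]
    [CompleteSpace X] {p : ℝ} (hp : 1 < p)
    (huc : ∀ ε > (0 : ℝ), ∃ C : ℝ, 0 ≤ C ∧ ∀ a b : X, ‖a - b‖ ^ p ≤ ε * (‖a‖ ^ p + ‖b‖ ^ p) +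
      C * ((‖a‖ ^ p + ‖b‖ ^ p) / 2 - ‖(1 / 2 : ℝ) • (a + b)‖ ^ p))
    (x : ℕ → X) {R : ℝ} (hx : ∀ n, ‖x n‖ ≤ R) :
    ∃ w : ℕ → X, (∀ k, w k ∈ convexHull ℝ (x '' Ici k)) ∧ ∃ l, Tendsto w atTop (𝓝 l) := by
  have hp0 : 0 < p := by linarith
  let K : ℕ → Set X := fun k => convexHull ℝ (x '' Ici k)
  have hKmono : ∀ {k l}, k ≤ l → K l ⊆ K k := fun h =>
    convexHull_mono (image_mono (Ici_subset_Ici.2 h))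
  have hKne : ∀ k, (K k).Nonempty := fun k =>
    ⟨x k, subset_convexHull ℝ _ ⟨k, self_mem_Ici, rfl⟩⟩
  have hKR : ∀ k, ∀ y ∈ K k, ‖y‖ ≤ R := by
    intro k y hy
    have : K k ⊆ Metric.closedBall 0 R := by
      refine convexHull_min ?_ (convex_closedBall _ _)
      rintro _ ⟨n, -, rfl⟩
      simpa using hx n
    simpa using this hy
  -- the distances of the convex hulls from the origin increase to a limit `m`
  let d : ℕ → ℝ := fun k => sInf (norm '' K k)
  have hbdd : ∀ k, BddBelow (norm '' K k) := fun k =>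
    ⟨0, by rintro _ ⟨y, -, rfl⟩; exact norm_nonneg y⟩
  have hd_le : ∀ k, ∀ y ∈ K k, d k ≤ ‖y‖ := fun k y hy => csInf_le (hbdd k) ⟨y, hy, rfl⟩
  have hd0 : ∀ k, 0 ≤ d k := fun k => le_csInf ((hKne k).image _) (by
    rintro _ ⟨y, -, rfl⟩; exact norm_nonneg y)
  have hdmono : Monotone d := fun k l h =>
    csInf_le_csInf (hbdd k) ((hKne l).image _) (image_mono (hKmono h))
  have hdR : ∀ k, d k ≤ R := fun k => by
    obtain ⟨y, hy⟩ := hKne k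
    exact (hd_le k y hy).trans (hKR k y hy)
  have hdbdd : BddAbove (range d) := ⟨R, by rintro _ ⟨k, rfl⟩; exact hdR k⟩
  have hlim := tendsto_atTop_ciSup hdmono hdbdd
  set m := ⨆ k, d k
  have hdm : ∀ k, d k ≤ m := le_ciSup hdbdd
  have hw : ∀ k : ℕ, ∃ y ∈ K k, ‖y‖ < d k + 1 / (k + 1 : ℝ) := by
    intro k
    have hk : (0 : ℝ) < 1 / (k + 1 : ℝ) := by positivity
    obtain ⟨_, ⟨y, hy, rfl⟩, h⟩ := exists_lt_of_csInf_lt ((hKne k).image norm)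
      (show sInf (norm '' K k) < d k + 1 / (k + 1 : ℝ) by simp only [d]; linarith)
    exact ⟨y, hy, h⟩
  choose w hwK hw using hw
  have hm0 : 0 ≤ m := (hd0 0).trans (hdm 0)
  have hR0 : 0 ≤ R := (norm_nonneg _).trans (hx 0)
  refine ⟨w, hwK, ?_⟩
  have hb : Tendsto (fun k : ℕ => (m + 1 / (k + 1 : ℝ)) ^ p - d k ^ p) atTop (𝓝 0) := by
    have h1 : Tendsto (fun k : ℕ => (m + 1 / (k + 1 : ℝ)) ^ p) atTop (𝓝 (m ^ p)) := by
      have := (tendsto_const_nhds (x := m)).add (tendsto_one_div_add_atTop_nhds_zero_nat (𝕜 := ℝ))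
      rw [add_zero] at this
      exact this.rpow_const (Or.inr hp0.le)
    have h2 : Tendsto (fun k : ℕ => d k ^ p) atTop (𝓝 (m ^ p)) :=
      hlim.rpow_const (Or.inr hp0.le)
    simpa using h1.sub h2
  refine cauchySeq_tendsto_of_complete ?_
  rw [Metric.cauchySeq_iff']
  intro ε hε
  have hεp : 0 < ε ^ p := Real.rpow_pos_of_pos hε p
  have hRp : 0 ≤ R ^ p := Real.rpow_nonneg hR0 p
  obtain ⟨C, hC, huc⟩ := huc (ε ^ p / (4 * (R ^ p + 1))) (by positivity)
  have hb' := hb.const_mul C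
  rw [mul_zero] at hb'
  obtain ⟨k, hk⟩ := (hb'.eventually (gt_mem_nhds (by positivity : 0 < ε ^ p / 4))).exists
  refine ⟨k, fun l hl => ?_⟩
  have hwl : ∀ j, k ≤ j → ‖w j‖ ≤ m + 1 / (k + 1 : ℝ) := by
    intro j hj
    have h1 : (1 : ℝ) / (j + 1 : ℝ) ≤ 1 / (k + 1 : ℝ) := by gcongr
    have := hw j
    have := hdm j
    linarith
  -- midpoints stay in the convex hull, so their norm is almost that of the end points
  have hmid : d k ≤ ‖(1 / 2 : ℝ) • (w l + w k)‖ := by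
    refine hd_le k _ ?_
    rw [smul_add]
    exact (convex_convexHull ℝ _) (hKmono hl (hwK l)) (hwK k) (by norm_num) (by norm_num)
      (by norm_num)
  have e1 : ‖w l‖ ^ p ≤ R ^ p := Real.rpow_le_rpow (norm_nonneg _) (hKR l _ (hwK l)) hp0.le
  have e2 : ‖w k‖ ^ p ≤ R ^ p := Real.rpow_le_rpow (norm_nonneg _) (hKR k _ (hwK k)) hp0.le
  have e3 := Real.rpow_le_rpow (norm_nonneg _) (hwl l hl) hp0.le
  have e4 := Real.rpow_le_rpow (norm_nonneg _) (hwl k le_rfl) hp0.le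
  have e5 := Real.rpow_le_rpow (hd0 k) hmid hp0.le
  have e6 := huc (w l) (w k)
  have e7 : ε ^ p / (4 * (R ^ p + 1)) * (‖w l‖ ^ p + ‖w k‖ ^ p) ≤ ε ^ p / 2 := by
    rw [div_mul_eq_mul_div, div_le_div_iff₀ (by positivity) (by norm_num)]
    nlinarith
  have e8 : C * ((‖w l‖ ^ p + ‖w k‖ ^ p) / 2 - ‖(1 / 2 : ℝ) • (w l + w k)‖ ^ p) ≤
      C * ((m + 1 / (k + 1 : ℝ)) ^ p - d k ^ p) := by
    refine mul_le_mul_of_nonneg_left ?_ hC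
    linarith
  have e9 : ‖w l - w k‖ ^ p < ε ^ p := by linarith
  rw [dist_eq_norm]
  exact (Real.rpow_lt_rpow_iff (norm_nonneg _) hε.le hp0).1 e9

/-- Weights of a sequence of convex combinations of tails: the `k`-th combination has the
coefficients `c k n` for `n ∈ s k`, and only involves indices `n ≥ k`. -/
structure IsTailWeights (s : ℕ → Finset ℕ) (c : ℕ → ℕ → ℝ) : Prop where
  le : ∀ k, ∀ n ∈ s k, k ≤ n
  nonneg : ∀ k, ∀ n ∈ s k, 0 ≤ c k n
  sum_eq_one : ∀ k, ∑ n ∈ s k, c k n = 1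

/-- Bounded sequences in `L^p`, `1 < p < ∞`, have strongly convergent convex combinations of
tails. -/
theorem exists_tailWeights_tendsto_Lp {α V : Type*} [MeasurableSpace α] {μ : Measure α}
    [NormedAddCommGroup V] [InnerProductSpace ℝ V] [FiniteDimensional ℝ V]
    {p : ℝ} [Fact (1 ≤ ENNReal.ofReal p)] (hp : 1 < p) (x : ℕ → Lp V (ENNReal.ofReal p) μ) {R : ℝ}
    (hx : ∀ n, ‖x n‖ ≤ R) :
    ∃ s c, IsTailWeights s c ∧
      ∃ l, Tendsto (fun k => ∑ n ∈ s k, c k n • x n) atTop (𝓝 l) := by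
  have : CompleteSpace V := FiniteDimensional.complete ℝ V
  obtain ⟨w, hw, l, hl⟩ := exists_convexHull_tendsto hp
    (fun ε hε => Lp_exists_norm_sub_rpow_le (μ := μ) (V := V) hp hε) x hx
  have : ∀ k, ∃ (s : Finset ℕ) (c : ℕ → ℝ), (∀ n ∈ s, k ≤ n) ∧ (∀ n ∈ s, 0 ≤ c n) ∧
      ∑ n ∈ s, c n = 1 ∧ ∑ n ∈ s, c n • x n = w k := by
    intro k
    have h := hw k
    rw [image_eq_range, convexHull_range_eq_exists_affineCombination] at h
    obtain ⟨t, a, ha, hsum, hcomb⟩ := h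
    rw [Finset.affineCombination_eq_linear_combination _ _ _ hsum] at hcomb
    refine ⟨t.map ⟨Subtype.val, Subtype.val_injective⟩,
      fun n => if h : n ∈ Ici k then a ⟨n, h⟩ else 0, ?_, ?_, ?_, ?_⟩
    · intro n hn
      obtain ⟨j, -, rfl⟩ := Finset.mem_map.1 hn
      exact j.2
    · intro n hn
      obtain ⟨j, hj, rfl⟩ := Finset.mem_map.1 hn
      have hj2 := j.2
      simp only [Function.Embedding.coeFn_mk]
      rw [dif_pos hj2]
      exact ha j hj
    · rw [Finset.sum_map, ← hsum]
      refine Finset.sum_congr rfl fun j hj => ?_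
      have hj2 := j.2
      simp only [Function.Embedding.coeFn_mk]
      rw [dif_pos hj2]
    · rw [Finset.sum_map, ← hcomb]
      refine Finset.sum_congr rfl fun j hj => ?_
      have hj2 := j.2
      simp only [Function.Embedding.coeFn_mk]
      rw [dif_pos hj2]
  choose s c h1 h2 h3 h4 using this
  refine ⟨s, c, ⟨h1, h2, h3⟩, l, ?_⟩
  simpa only [h4] using hl

/-- If a sequence converges, so do convex combinations of its tails. -/
lemma IsTailWeights.tendsto {s c} (h : IsTailWeights s c) {X : Type*} [NormedAddCommGroup X]
    [NormedSpace ℝ X] {x : ℕ → X} {l : X} (hx : Tendsto x atTop (𝓝 l)) :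
    Tendsto (fun k => ∑ n ∈ s k, c k n • x n) atTop (𝓝 l) := by
  rw [Metric.tendsto_atTop] at hx ⊢
  intro ε hε
  obtain ⟨M, hM⟩ := hx (ε / 2) (by positivity)
  refine ⟨M, fun k hk => ?_⟩
  have h1 : ∑ n ∈ s k, c k n • x n - l = ∑ n ∈ s k, c k n • (x n - l) := by
    simp only [smul_sub, Finset.sum_sub_distrib, ← Finset.sum_smul, h.sum_eq_one, one_smul]
  rw [dist_eq_norm, h1]
  calc ‖∑ n ∈ s k, c k n • (x n - l)‖ ≤ ∑ n ∈ s k, c k n * (ε / 2) := by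
        refine norm_sum_le_of_le _ fun n hn => ?_
        rw [norm_smul, Real.norm_of_nonneg (h.nonneg k n hn)]
        refine mul_le_mul_of_nonneg_left ?_ (h.nonneg k n hn)
        rw [← dist_eq_norm]
        exact (hM n (hk.le.trans (h.le k n hn))).le
    _ = ε / 2 := by rw [← Finset.sum_mul, h.sum_eq_one, one_mul]
    _ < ε := by linarith

/-! ### Lower semicontinuity of the bulk energy -/

section Lsc

variable {N : ℕ}

/-- A convex lower semicontinuous function that is bounded below lies strictly above an affine
function whose value at `z` is at least any prescribed number below the value of the function
there. -/
lemma EConvex.exists_affine_lt {g : EuclideanSpace ℝ (Fin N) → EReal} (hconv : EConvex g)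
    (hlsc : LowerSemicontinuous g) {B : ℝ} (hB : ∀ w, (B : EReal) ≤ g w)
    {z : EuclideanSpace ℝ (Fin N)} {M : ℝ} (hM : (M : EReal) < g z) :
    ∃ (a : ℝ) (b : EuclideanSpace ℝ (Fin N)), M ≤ a ∧
      ∀ w, ((a + inner ℝ b (w - z) : ℝ) : EReal) < g w := by
  let S : Set (EuclideanSpace ℝ (Fin N) × ℝ) := {q | g q.1 ≤ (q.2 : EReal)}
  have hScl : IsClosed S := by
    have h1 : IsClosed {q : EuclideanSpace ℝ (Fin N) × EReal | g q.1 ≤ q.2} :=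
      hlsc.isClosed_epigraph
    exact h1.preimage (continuous_fst.prodMk (continuous_coe_real_ereal.comp continuous_snd))
  have hSconv : Convex ℝ S := by
    rintro ⟨w₁, τ₁⟩ h₁ ⟨w₂, τ₂⟩ h₂ a b ha hb hab
    have ha' : (0 : EReal) ≤ (a : EReal) := by exact_mod_cast ha
    have hb' : (0 : EReal) ≤ (b : EReal) := by exact_mod_cast hb
    refine (hconv w₁ w₂ a b ha hb hab).trans ?_
    refine (add_le_add (mul_le_mul_of_nonneg_left h₁ ha')
      (mul_le_mul_of_nonneg_left h₂ hb')).trans (le_of_eq ?_)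
    simp
  have hzS : (z, M) ∉ S := fun h => absurd hM (not_lt.2 h)
  rcases S.eq_empty_or_nonempty with hS | ⟨⟨w₀, τ₀⟩, hw₀⟩
  · refine ⟨M, 0, le_rfl, fun w => ?_⟩
    by_contra hlt
    have : (w, M) ∈ S := show g w ≤ (M : EReal) by simpa using hlt
    simp [hS] at this
  -- separate `(z, M)` from the epigraph
  obtain ⟨φ, u, hφz, hφS⟩ := geometric_hahn_banach_point_closed hSconv hScl hzS
  let ℓ : EuclideanSpace ℝ (Fin N) →L[ℝ] ℝ :=
    φ.comp (ContinuousLinearMap.inl ℝ (EuclideanSpace ℝ (Fin N)) ℝ)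
  let β : EuclideanSpace ℝ (Fin N) := (InnerProductSpace.toDual ℝ _).symm ℓ
  let κ : ℝ := φ (0, 1)
  have hφ : ∀ w τ, φ (w, τ) = inner ℝ β w + κ * τ := by
    intro w τ
    have h1 : inner ℝ β w = φ (w, 0) := by
      simp [β, ℓ, InnerProductSpace.toDual_symm_apply]
    have h2 : ((w, τ) : EuclideanSpace ℝ (Fin N) × ℝ) = (w, 0) + τ • (0, 1) := by simp
    rw [h2, map_add, map_smul, h1, smul_eq_mul, mul_comm]
  -- the epigraph is unbounded upwards
  have hκ : 0 ≤ κ := by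
    by_contra hneg
    push Not at hneg
    have h1 : ∀ τ, τ₀ ≤ τ → u < inner ℝ β w₀ + κ * τ := by
      intro τ hτ
      rw [← hφ]
      refine hφS _ ?_
      have : g w₀ ≤ (τ₀ : EReal) := hw₀
      exact this.trans (by exact_mod_cast hτ)
    have h2 := h1 (max τ₀ ((u - inner ℝ β w₀) / κ)) (le_max_left _ _)
    have h3 : κ * max τ₀ ((u - inner ℝ β w₀) / κ) ≤ κ * ((u - inner ℝ β w₀) / κ) :=
      mul_le_mul_of_nonpos_left (le_max_right _ _) hneg.le
    rw [mul_div_cancel₀ _ hneg.ne] at h3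
    linarith
  have hfin : ∀ w, ∀ x : ℝ, ((∀ τ : ℝ, g w = τ → x < τ)) → (x : EReal) < g w := by
    intro w x h
    rcases hgw : g w with _ | τ
    · exact absurd (hB w) (by rw [show g w = ⊥ from hgw]; simp)
    · rcases τ with _ | τ
      · exact EReal.coe_lt_top x
      · exact EReal.coe_lt_coe_iff.2 (h τ hgw)
  rw [hφ] at hφz
  rcases hκ.eq_or_lt' with h0 | hpos
  · -- a vertical separating hyperplane: tilt it, using the lower bound `B`
    have h1 : ∀ w τ, g w = ((τ : ℝ) : EReal) → u < inner ℝ β w := by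
      intro w τ h
      have := hφS (w, τ) h.le
      rwa [hφ, h0, zero_mul, add_zero] at this
    rw [h0, zero_mul, add_zero] at hφz
    have hd : 0 < u - inner ℝ β z := by linarith
    let lam : ℝ := max 0 ((M - B + 1) / (u - inner ℝ β z))
    have hlam : 0 ≤ lam := le_max_left _ _
    refine ⟨B - 1 + lam * (u - inner ℝ β z), -lam • β, ?_, fun w => hfin w _ fun τ hτ => ?_⟩
    · have : (M - B + 1) / (u - inner ℝ β z) * (u - inner ℝ β z) ≤ lam * (u - inner ℝ β z) :=
        mul_le_mul_of_nonneg_right (le_max_right _ _) hd.le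
      rw [div_mul_cancel₀ _ hd.ne'] at this
      linarith
    · have h2 := hB w
      rw [hτ] at h2
      have h3 : B ≤ τ := by exact_mod_cast h2
      have h4 := h1 w τ hτ
      rw [inner_smul_left, inner_sub_right]
      simp only [conj_trivial]
      have : 0 ≤ lam * (inner ℝ β w - u) := mul_nonneg hlam (by linarith)
      nlinarith
  · refine ⟨(u - inner ℝ β z) / κ, -(κ⁻¹) • β, ?_, fun w => hfin w _ fun τ hτ => ?_⟩
    · rw [le_div_iff₀ hpos]
      linarith
    · have := hφS (w, τ) hτ.le
      rw [hφ] at this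
      rw [inner_smul_left, inner_sub_right]
      simp only [conj_trivial]
      have h5 : (u - inner ℝ β z) / κ + -κ⁻¹ * (inner ℝ β w - inner ℝ β z) =
          (u - inner ℝ β w) / κ := by
        field_simp
        ring
      rw [h5, div_lt_iff₀ hpos]
      linarith

/-- Superlinear growth beats an affine function far from the origin. -/
lemma exists_affine_le_rpow {α p : ℝ} (hα : 0 < α) (hp : 1 < p) (C a : ℝ)
    (b z : EuclideanSpace ℝ (Fin N)) :
    ∃ R : ℝ, ∀ w, R ≤ ‖w‖ → a + inner ℝ b (w - z) ≤ α * ‖w‖ ^ p - C := by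
  have h1 : Tendsto (fun x : ℝ => α * x ^ (p - 1)) atTop atTop :=
    (tendsto_rpow_atTop (by linarith)).const_mul_atTop hα
  obtain ⟨R, hR⟩ := (h1.eventually_ge_atTop (‖b‖ + 1)).exists_forall_of_atTop
  refine ⟨max (max R 1) (a + ‖b‖ * ‖z‖ + C), fun w hw => ?_⟩
  have hwR : R ≤ ‖w‖ := (le_max_left _ _).trans ((le_max_left _ _).trans hw)
  have hw1 : 1 ≤ ‖w‖ := (le_max_right _ _).trans ((le_max_left _ _).trans hw)
  have hw2 : a + ‖b‖ * ‖z‖ + C ≤ ‖w‖ := (le_max_right _ _).trans hw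
  have h2 := hR ‖w‖ hwR
  have h3 : ‖w‖ ^ p = ‖w‖ ^ (p - 1) * ‖w‖ := by
    rw [← Real.rpow_add_one (by positivity)]
    congr 1
    ring
  have h4 : inner ℝ b (w - z) ≤ ‖b‖ * ‖w‖ + ‖b‖ * ‖z‖ := by
    refine (real_inner_le_norm _ _).trans ?_
    rw [← mul_add]
    exact mul_le_mul_of_nonneg_left (norm_sub_le _ _) (norm_nonneg _)
  have h5 : (‖b‖ + 1) * ‖w‖ ≤ α * ‖w‖ ^ (p - 1) * ‖w‖ :=
    mul_le_mul_of_nonneg_right h2 (norm_nonneg _)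
  rw [h3, ← mul_assoc]
  linarith

/-- The integrand, made nonnegative by adding a constant. The truncation at zero is only immaterial
when `-C` is a lower bound of `f`. -/
noncomputable def shifted (f : ℝ → EuclideanSpace ℝ (Fin N) → EReal) (C : ℝ) (t : ℝ)
    (z : EuclideanSpace ℝ (Fin N)) : ℝ≥0∞ := (f t z + (C : EReal)).toENNReal

variable {f : ℝ → EuclideanSpace ℝ (Fin N) → EReal} {α p C : ℝ}

lemma measurable_shifted
    (hf_lsc : LowerSemicontinuous (fun q : ℝ × EuclideanSpace ℝ (Fin N) => f q.1 q.2)) :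
    Measurable (fun q : ℝ × EuclideanSpace ℝ (Fin N) => shifted f C q.1 q.2) :=
  (hf_lsc.measurable.add_const _).ereal_toENNReal

/-- An affine function that is strictly below `f t` is eventually below `f s` as `s → t`: on large
balls by compactness, and away from them by the growth of `f`. -/
lemma eventually_affine_le (hα : 0 < α) (hp : 1 < p)
    (hf_lsc : LowerSemicontinuous (fun q : ℝ × EuclideanSpace ℝ (Fin N) => f q.1 q.2))
    (hgrowth : ∀ t z, ((α * ‖z‖ ^ p - C : ℝ) : EReal) ≤ f t z)
    {t a : ℝ} {b z : EuclideanSpace ℝ (Fin N)}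
    (h : ∀ w, ((a + inner ℝ b (w - z) : ℝ) : EReal) < f t w) :
    ∀ᶠ s in 𝓝 t, ∀ w, ((a + inner ℝ b (w - z) : ℝ) : EReal) ≤ f s w := by
  obtain ⟨R, hR⟩ := exists_affine_le_rpow hα hp C a b z
  have hK : ∀ᶠ s in 𝓝 t, ∀ w ∈ Metric.closedBall (0 : EuclideanSpace ℝ (Fin N)) R,
      ((a + inner ℝ b (w - z) : ℝ) : EReal) < f s w := by
    refine (isCompact_closedBall (0 : EuclideanSpace ℝ (Fin N))
      R).eventually_forall_of_forall_eventually fun w _ => ?_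
    obtain ⟨y, hy1, hy2⟩ := EReal.lt_iff_exists_real_btwn.1 (h w)
    have hy1' : a + inner ℝ b (w - z) < y := by exact_mod_cast hy1
    have hcont : Continuous fun q : ℝ × EuclideanSpace ℝ (Fin N) => a + inner ℝ b (q.2 - z) := by
      fun_prop
    filter_upwards [hf_lsc (t, w) y hy2,
      (hcont.tendsto (t, w)).eventually (gt_mem_nhds hy1')] with q hq1 hq2
    exact lt_trans (by exact_mod_cast hq2) hq1
  filter_upwards [hK] with s hs w
  by_cases hw : ‖w‖ ≤ R
  · exact (hs w (by simpa using hw)).le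
  · refine le_trans ?_ (hgrowth s w)
    exact_mod_cast hR w (not_le.1 hw).le

/-- Pointwise lower semicontinuity along convex combinations: the first argument converges, and
convex combinations of tails of the second argument converge. -/
lemma shifted_le_liminf (hα : 0 < α) (hp : 1 < p) (hf_conv : ∀ t, EConvex (f t))
    (hf_lsc : LowerSemicontinuous (fun q : ℝ × EuclideanSpace ℝ (Fin N) => f q.1 q.2))
    (hgrowth : ∀ t z, ((α * ‖z‖ ^ p - C : ℝ) : EReal) ≤ f t z)
    {s : ℕ → Finset ℕ} {c : ℕ → ℕ → ℝ} (hsc : IsTailWeights s c)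
    {t : ℕ → ℝ} {t₀ : ℝ} (ht : Tendsto t atTop (𝓝 t₀))
    {z : ℕ → EuclideanSpace ℝ (Fin N)} {z₀ : EuclideanSpace ℝ (Fin N)}
    (hz : Tendsto (fun k => ∑ n ∈ s k, c k n • z n) atTop (𝓝 z₀)) :
    shifted f C t₀ z₀ ≤
      liminf (fun k => ∑ n ∈ s k, ENNReal.ofReal (c k n) * shifted f C (t n) (z n)) atTop := by
  refine le_of_forall_lt fun m hm => ?_
  obtain ⟨m', hm1, hm2⟩ := exists_between hm
  have hm'top : m' ≠ ⊤ := ne_top_of_lt hm2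
  have hlt : ((m'.toReal - C : ℝ) : EReal) < f t₀ z₀ := by
    have h1 : (m' : EReal) < f t₀ z₀ + (C : EReal) := by
      by_contra hcon
      push Not at hcon
      have := EReal.toENNReal_le_toENNReal hcon
      rw [EReal.toENNReal_coe] at this
      exact absurd hm2 (not_lt.2 this)
    have h2 : (m' : EReal) = ((m'.toReal : ℝ) : EReal) :=
      (EReal.coe_ennreal_toReal hm'top).symm
    rw [h2] at h1
    rw [EReal.coe_sub]
    exact EReal.sub_lt_of_lt_add h1
  have hB : ∀ w, ((-C : ℝ) : EReal) ≤ f t₀ w := fun w => by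
    refine le_trans ?_ (hgrowth t₀ w)
    have : 0 ≤ α * ‖w‖ ^ p := by positivity
    exact_mod_cast (by linarith : -C ≤ α * ‖w‖ ^ p - C)
  have hlsc₀ : LowerSemicontinuous (f t₀) := fun w y hy =>
    (Continuous.tendsto (by fun_prop : Continuous fun w => (t₀, w)) w).eventually
      (hf_lsc (t₀, w) y hy)
  obtain ⟨a, b, hMa, hab⟩ := (hf_conv t₀).exists_affine_lt hlsc₀ hB hlt
  have hev := ht.eventually (eventually_affine_le hα hp hf_lsc hgrowth hab)
  obtain ⟨n₀, hn₀⟩ := hev.exists_forall_of_atTop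
  refine hm1.trans_le ?_
  have hlim : Tendsto (fun k => ENNReal.ofReal
      (a + C + inner ℝ b ((∑ n ∈ s k, c k n • z n) - z₀))) atTop
      (𝓝 (ENNReal.ofReal (a + C))) := by
    refine (ENNReal.continuous_ofReal.tendsto _).comp ?_
    have h1 : Continuous fun w : EuclideanSpace ℝ (Fin N) => a + C + inner ℝ b (w - z₀) := by
      fun_prop
    have h2 := (h1.tendsto z₀).comp hz
    simpa [Function.comp_def] using h2
  have hm'le : m' ≤ ENNReal.ofReal (a + C) := by
    rw [← ENNReal.ofReal_toReal hm'top]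
    exact ENNReal.ofReal_le_ofReal (by linarith)
  refine hm'le.trans ?_
  rw [← hlim.liminf_eq]
  refine liminf_le_liminf ?_
  filter_upwards [eventually_ge_atTop n₀] with k hk
  have h1 : a + C + inner ℝ b ((∑ n ∈ s k, c k n • z n) - z₀) =
      ∑ n ∈ s k, c k n * (a + C + inner ℝ b (z n - z₀)) := by
    have h2 : (∑ n ∈ s k, c k n • z n) - z₀ = ∑ n ∈ s k, c k n • (z n - z₀) := by
      simp only [smul_sub, Finset.sum_sub_distrib, ← Finset.sum_smul, hsc.sum_eq_one, one_smul]
    rw [h2, inner_sum]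
    simp only [mul_add, Finset.sum_add_distrib, ← Finset.sum_mul, hsc.sum_eq_one, one_mul,
      inner_smul_right]
  rw [h1]
  calc ENNReal.ofReal (∑ n ∈ s k, c k n * (a + C + inner ℝ b (z n - z₀)))
      ≤ ∑ n ∈ s k, ENNReal.ofReal (c k n * (a + C + inner ℝ b (z n - z₀))) :=
        Finset.le_sum_of_subadditive _ ENNReal.ofReal_zero.le
          (fun _ _ => ENNReal.ofReal_add_le) _ _
    _ ≤ _ := by
        refine Finset.sum_le_sum fun n hn => ?_
        rw [ENNReal.ofReal_mul (hsc.nonneg k n hn)]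
        gcongr
        have h3 := hn₀ n (hk.trans (hsc.le k n hn)) (z n)
        have h4 := EReal.toENNReal_le_toENNReal (add_le_add_left h3 (C : EReal))
        refine le_trans (le_of_eq ?_) h4
        rw [← EReal.coe_add, EReal.toENNReal_of_ne_top (EReal.coe_ne_top _), EReal.toReal_coe]
        congr 1
        ring

/-- Lower semicontinuity of the bulk energy along sequences whose convex combinations of tails
converge: Fatou's lemma and the pointwise statement. -/
theorem lintegral_shifted_le {X : Type*} [MeasurableSpace X] {μ : Measure X}
    (hα : 0 < α) (hp : 1 < p) (hf_conv : ∀ t, EConvex (f t))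
    (hf_lsc : LowerSemicontinuous (fun q : ℝ × EuclideanSpace ℝ (Fin N) => f q.1 q.2))
    (hgrowth : ∀ t z, ((α * ‖z‖ ^ p - C : ℝ) : EReal) ≤ f t z)
    {s : ℕ → Finset ℕ} {c : ℕ → ℕ → ℝ} (hsc : IsTailWeights s c)
    {u : ℕ → X → ℝ} {u₀ : X → ℝ} {G : ℕ → X → EuclideanSpace ℝ (Fin N)}
    {G₀ : X → EuclideanSpace ℝ (Fin N)}
    (hu_meas : ∀ n, AEMeasurable (u n) μ) (hG_meas : ∀ n, AEMeasurable (G n) μ)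
    (hu : ∀ᵐ x ∂μ, Tendsto (fun n => u n x) atTop (𝓝 (u₀ x)))
    (hG : ∀ᵐ x ∂μ, Tendsto (fun k => ∑ n ∈ s k, c k n • G n x) atTop (𝓝 (G₀ x)))
    {B : ℝ≥0∞} (hB : ∀ n, ∫⁻ x, shifted f C (u n x) (G n x) ∂μ ≤ B) :
    ∫⁻ x, shifted f C (u₀ x) (G₀ x) ∂μ ≤ B := by
  have hmeas : ∀ n, AEMeasurable (fun x => shifted f C (u n x) (G n x)) μ := fun n =>
    (measurable_shifted hf_lsc).comp_aemeasurable ((hu_meas n).prodMk (hG_meas n))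
  calc ∫⁻ x, shifted f C (u₀ x) (G₀ x) ∂μ
      ≤ ∫⁻ x, liminf (fun k => ∑ n ∈ s k,
          ENNReal.ofReal (c k n) * shifted f C (u n x) (G n x)) atTop ∂μ := by
        refine lintegral_mono_ae ?_
        filter_upwards [hu, hG] with x hx1 hx2
        exact shifted_le_liminf hα hp hf_conv hf_lsc hgrowth hsc hx1 hx2
    _ ≤ liminf (fun k => ∫⁻ x, ∑ n ∈ s k,
          ENNReal.ofReal (c k n) * shifted f C (u n x) (G n x) ∂μ) atTop :=
        lintegral_liminf_le' fun k =>
          Finset.aemeasurable_fun_sum _ fun n _ => (hmeas n).const_mul _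
    _ ≤ liminf (fun _ : ℕ => B) atTop := by
        refine liminf_le_liminf (Eventually.of_forall fun k => ?_)
        rw [lintegral_finsetSum' _ fun n _ => (hmeas n).const_mul _]
        calc ∑ n ∈ s k, ∫⁻ x, ENNReal.ofReal (c k n) * shifted f C (u n x) (G n x) ∂μ
            ≤ ∑ n ∈ s k, ENNReal.ofReal (c k n) * B := by
              refine Finset.sum_le_sum fun n _ => ?_
              rw [lintegral_const_mul'' _ (hmeas n)]
              gcongr
              exact hB n
          _ = B := by
              rw [← Finset.sum_mul, ← ENNReal.ofReal_sum_of_nonneg (hsc.nonneg k),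
                hsc.sum_eq_one, ENNReal.ofReal_one, one_mul]
    _ = B := by simp

end Lsc

/-! ### The extended-real integral -/

section EIntegral

variable {X : Type*} [MeasurableSpace X] {μ : Measure X}

/-- On a finite space, a constant can be added before integrating; both sides may be `⊤`. -/
lemma eintegral_eq_sub [IsFiniteMeasure μ] {g : X → EReal} (hg : AEMeasurable g μ) {C : ℝ}
    (hC : 0 ≤ C) (hgC : ∀ x, ((-C : ℝ) : EReal) ≤ g x) :
    eintegral μ g = ((∫⁻ x, (g x + (C : EReal)).toENNReal ∂μ : ℝ≥0∞) : EReal) -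
      ((C * μ.real univ : ℝ) : EReal) := by
  have hpt : ∀ x, (g x + (C : EReal)).toENNReal + (-g x).toENNReal =
      (g x).toENNReal + ENNReal.ofReal C := by
    intro x
    have hx := hgC x
    induction hgx : g x using EReal.rec with
    | bot => rw [hgx] at hx; simp at hx
    | top => simp
    | coe y =>
      rw [hgx] at hx
      have hy : -C ≤ y := by exact_mod_cast hx
      rw [← EReal.coe_add, ← EReal.coe_neg]
      simp only [EReal.toENNReal_of_ne_top (EReal.coe_ne_top _), EReal.toReal_coe]
      rcases le_total 0 y with h | h
      · rw [ENNReal.ofReal_of_nonpos (by linarith : -y ≤ 0), add_zero, ENNReal.ofReal_add h hC]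
      · rw [ENNReal.ofReal_of_nonpos h, zero_add, ← ENNReal.ofReal_add (by linarith) (by linarith)]
        congr 1
        ring
  have hint : (∫⁻ x, (g x + (C : EReal)).toENNReal ∂μ) + ∫⁻ x, (-g x).toENNReal ∂μ =
      (∫⁻ x, (g x).toENNReal ∂μ) + ENNReal.ofReal (C * μ.real univ) := by
    rw [← lintegral_add_left' (hg.add_const _).ereal_toENNReal]
    simp only [hpt]
    rw [lintegral_add_left' hg.ereal_toENNReal, lintegral_const, ENNReal.ofReal_mul hC,
      ofReal_measureReal]
  have hneg : ∫⁻ x, (-g x).toENNReal ∂μ ≠ ⊤ := by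
    have : ∫⁻ x, (-g x).toENNReal ∂μ ≤ ∫⁻ _, ENNReal.ofReal C ∂μ := by
      refine lintegral_mono fun x => ?_
      have h1 : -g x ≤ (C : EReal) := by
        rw [EReal.neg_le]
        exact_mod_cast hgC x
      have := EReal.toENNReal_le_toENNReal h1
      rwa [EReal.toENNReal_of_ne_top (EReal.coe_ne_top _), EReal.toReal_coe] at this
    refine ne_top_of_le_ne_top ?_ this
    rw [lintegral_const]
    exact ENNReal.mul_ne_top ENNReal.ofReal_ne_top (measure_ne_top _ _)
  unfold eintegral
  generalize ∫⁻ x, (g x + (C : EReal)).toENNReal ∂μ = A at *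
  generalize ∫⁻ x, (g x).toENNReal ∂μ = P at *
  generalize ∫⁻ x, (-g x).toENNReal ∂μ = n at *
  have hK : 0 ≤ C * μ.real univ := by positivity
  generalize C * μ.real univ = K at *
  lift n to ℝ≥0 using hneg
  induction A with
  | top =>
    have : P = ⊤ := by
      by_contra h
      rw [top_add] at hint
      exact ENNReal.add_ne_top.2 ⟨h, ENNReal.ofReal_ne_top⟩ hint.symm
    subst this
    simp [sub_eq_add_neg, ← EReal.coe_neg]
  | coe A =>
    have hP : P ≠ ⊤ := by
      rintro rfl
      rw [top_add] at hint
      exact ENNReal.add_ne_top.2 ⟨ENNReal.coe_ne_top, ENNReal.coe_ne_top⟩ hint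
    lift P to ℝ≥0 using hP
    have h1 := congrArg ENNReal.toReal hint
    rw [ENNReal.toReal_add ENNReal.coe_ne_top ENNReal.coe_ne_top,
      ENNReal.toReal_add ENNReal.coe_ne_top ENNReal.ofReal_ne_top, ENNReal.toReal_ofReal hK] at h1
    simp only [ENNReal.coe_toReal] at h1
    change ((P : ℝ) : EReal) - ((n : ℝ) : EReal) = ((A : ℝ) : EReal) - (K : EReal)
    rw [← EReal.coe_sub, ← EReal.coe_sub]
    congr 1
    linarith

lemma eintegral_coe {g : X → ℝ} (hg : Integrable g μ) :
    eintegral μ (fun x => ((g x : ℝ) : EReal)) = ((∫ x, g x ∂μ : ℝ) : EReal) := by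
  unfold eintegral
  rw [integral_eq_lintegral_pos_part_sub_lintegral_neg_part hg, EReal.coe_sub]
  have h1 : ∫⁻ x, ENNReal.ofReal (g x) ∂μ ≠ ⊤ := by
    refine ne_top_of_le_ne_top hg.2.ne (lintegral_mono fun x => ?_)
    rw [← ofReal_norm]
    exact ENNReal.ofReal_le_ofReal (le_abs_self _)
  have h2 : ∫⁻ x, ENNReal.ofReal (-g x) ∂μ ≠ ⊤ := by
    refine ne_top_of_le_ne_top hg.2.ne (lintegral_mono fun x => ?_)
    rw [← ofReal_norm]
    exact ENNReal.ofReal_le_ofReal (neg_le_abs _)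
  rw [EReal.coe_ennreal_toReal h1, EReal.coe_ennreal_toReal h2]
  congr 2

end EIntegral

/-! ### Graph coordinates -/

section Graph

variable {N : ℕ}

local notation "E[" n "]" => EuclideanSpace ℝ (Fin n)

lemma LipschitzWith.euclideanHausdorffMeasure_image_le {X Y : Type*} [EMetricSpace X]
    [EMetricSpace Y] [MeasurableSpace X] [BorelSpace X] [MeasurableSpace Y] [BorelSpace Y]
    {K : ℝ≥0} {F : X → Y} (hF : LipschitzWith K F) (d : ℕ) (s : Set X) :
    (Measure.euclideanHausdorffMeasure d : Measure Y) (F '' s) ≤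
      (K : ℝ≥0∞) ^ d * (Measure.euclideanHausdorffMeasure d : Measure X) s := by
  simp only [Measure.euclideanHausdorffMeasure_def, Measure.smul_apply, ENNReal.smul_def,
    smul_eq_mul]
  have h := hF.hausdorffMeasure_image_le (d := (d : ℝ)) (by positivity) s
  rw [ENNReal.rpow_natCast] at h
  rw [mul_left_comm]
  gcongr

variable {e : E[N]}

lemma orthogonalProjectionOnto_add_inner (he : ‖e‖ = 1) (y : E[N]) :
    ((ℝ ∙ e)ᗮ.orthogonalProjectionOnto y : E[N]) + (inner ℝ e y : ℝ) • e = y := by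
  have h := (ℝ ∙ e).starProjection_add_starProjection_orthogonal y
  rw [Submodule.starProjection_unit_singleton ℝ he] at h
  rw [add_comm]
  exact h

lemma orthogonalProjectionOnto_add_smul (w : (ℝ ∙ e)ᗮ) (s : ℝ) :
    (ℝ ∙ e)ᗮ.orthogonalProjectionOnto ((w : E[N]) + s • e) = w := by
  rw [map_add, map_smul, Submodule.orthogonalProjectionOnto_orthogonalComplement_singleton_eq_zero,
    smul_zero, add_zero, Submodule.orthogonalProjectionOnto_mem_subspace_eq_self]

lemma inner_add_smul_self (he : ‖e‖ = 1) (w : (ℝ ∙ e)ᗮ) (s : ℝ) :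
    inner ℝ e ((w : E[N]) + s • e) = s := by
  rw [inner_add_right, inner_smul_right, real_inner_self_eq_norm_sq, he,
    Submodule.mem_orthogonal_singleton_iff_inner_right.1 w.2]
  simp

lemma finrank_orthogonal (he : ‖e‖ = 1) : Module.finrank ℝ (ℝ ∙ e)ᗮ = N - 1 := by
  have h := (ℝ ∙ e).finrank_add_finrank_orthogonal
  have hne : e ≠ 0 := by
    rintro rfl
    simp at he
  rw [finrank_span_singleton hne, finrank_euclideanSpace_fin] at h
  omega

lemma euclideanHausdorffMeasure_orthogonal (he : ‖e‖ = 1) :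
    (Measure.euclideanHausdorffMeasure (N - 1) : Measure (ℝ ∙ e)ᗮ) = volume := by
  rw [← finrank_orthogonal he]
  exact InnerProductSpace.euclideanHausdorffMeasure_eq_volume

/-- The splitting of the space into the hyperplane orthogonal to the unit vector `e` and the line
spanned by `e`. -/
noncomputable def hyperplaneSplitting (he : ‖e‖ = 1) : ((ℝ ∙ e)ᗮ × ℝ) ≃L[ℝ] E[N] :=
  ContinuousLinearEquiv.equivOfInverse
    (((ℝ ∙ e)ᗮ.subtypeL.comp (ContinuousLinearMap.fst ℝ _ ℝ)) +
      ((ContinuousLinearMap.snd ℝ (ℝ ∙ e)ᗮ ℝ).smulRight e))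
    (((ℝ ∙ e)ᗮ.orthogonalProjectionOnto).prod (innerSL ℝ e))
    (fun q => by
      have h1 := orthogonalProjectionOnto_add_smul q.1 q.2
      have h2 := inner_add_smul_self he q.1 q.2
      exact Prod.ext h1 h2)
    (fun y => orthogonalProjectionOnto_add_inner he y)

/-- Fubini's theorem along a hyperplane and its normal. The constant is in fact `1`; its value does
not matter below. -/
lemma exists_lintegral_hyperplaneSplitting (he : ‖e‖ = 1) : ∃ C : ℝ≥0, ∀ g : E[N] → ℝ≥0∞,
    Measurable g → ∫⁻ w : (ℝ ∙ e)ᗮ, ∫⁻ s : ℝ, g ((w : E[N]) + s • e) = C * ∫⁻ x, g x := by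
  let L := hyperplaneSplitting he
  have : (volume : Measure ((ℝ ∙ e)ᗮ × ℝ)).IsAddHaarMeasure :=
    Measure.prod.instIsAddHaarMeasure volume volume
  have : (Measure.map L (volume : Measure ((ℝ ∙ e)ᗮ × ℝ))).IsAddHaarMeasure :=
    L.isAddHaarMeasure_map _
  have h := Measure.isAddLeftInvariant_eq_smul
    (Measure.map L (volume : Measure ((ℝ ∙ e)ᗮ × ℝ))) (volume : Measure E[N])
  generalize Measure.addHaarScalarFactor (Measure.map L (volume : Measure ((ℝ ∙ e)ᗮ × ℝ)))
    (volume : Measure E[N]) = C at h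
  refine ⟨C, fun g hg => ?_⟩
  have hgL : Measurable fun q : (ℝ ∙ e)ᗮ × ℝ => g ((q.1 : E[N]) + q.2 • e) :=
    hg.comp L.continuous.measurable
  rw [← lintegral_prod _ hgL.aemeasurable, ← Measure.volume_eq_prod]
  calc ∫⁻ q : (ℝ ∙ e)ᗮ × ℝ, g ((q.1 : E[N]) + q.2 • e)
      = ∫⁻ x, g x ∂(Measure.map L (volume : Measure ((ℝ ∙ e)ᗮ × ℝ))) :=
        (lintegral_map hg L.continuous.measurable).symm
    _ = _ := by
        rw [h, lintegral_smul_measure, ENNReal.smul_def, smul_eq_mul]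

/-- The integral over a piece `S` of a Lipschitz graph of the integrals along the direction `e`
is controlled by the integral over the space. -/
lemma exists_lintegral_graph_le (he : ‖e‖ = 1) {L : ℝ≥0} {ψ : (ℝ ∙ e)ᗮ → ℝ}
    (hψ : LipschitzWith L ψ) : ∃ C : ℝ≥0, ∀ S : Set E[N], MeasurableSet S →
      (∀ y ∈ S, inner ℝ e y = ψ ((ℝ ∙ e)ᗮ.orthogonalProjectionOnto y)) →
      ∀ g : E[N] → ℝ≥0∞, Measurable g →
        ∫⁻ x in S, (∫⁻ s : ℝ, g (x + s • e)) ∂(Measure.euclideanHausdorffMeasure (N - 1)) ≤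
          C * ∫⁻ x, g x := by
  obtain ⟨C, hC⟩ := exists_lintegral_hyperplaneSplitting he
  let Φ : (ℝ ∙ e)ᗮ → E[N] := fun w => (w : E[N]) + ψ w • e
  have hΦ : LipschitzWith (1 + L) Φ := by
    refine (LipschitzWith.subtype_val _).add (LipschitzWith.of_dist_le_mul fun x y => ?_)
    rw [dist_eq_norm, ← sub_smul, norm_smul, he, mul_one, ← dist_eq_norm]
    exact hψ.dist_le_mul x y
  have hΦm : Measurable Φ := hΦ.continuous.measurable
  refine ⟨(1 + L) ^ (N - 1) * C, fun S hS hgraph g hg => ?_⟩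
  -- on the graph, the surface measure is controlled by the image of the measure of the hyperplane
  have hmeas_le : (Measure.euclideanHausdorffMeasure (N - 1)).restrict S ≤
      ((1 + L : ℝ≥0) ^ (N - 1) : ℝ≥0) • Measure.map Φ volume := by
    refine Measure.le_iff.2 fun A hA => ?_
    rw [Measure.restrict_apply hA, Measure.smul_apply, Measure.map_apply hΦm hA,
      ← euclideanHausdorffMeasure_orthogonal he, ENNReal.smul_def, smul_eq_mul, ENNReal.coe_pow]
    refine le_trans (measure_mono ?_) (LipschitzWith.euclideanHausdorffMeasure_image_le hΦ _ _)
    rintro y ⟨hyA, hyS⟩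
    have hy : Φ ((ℝ ∙ e)ᗮ.orthogonalProjectionOnto y) = y := by
      simp only [Φ]
      rw [← hgraph y hyS]
      exact orthogonalProjectionOnto_add_inner he y
    exact ⟨_, by rwa [mem_preimage, hy], hy⟩
  have hg2 : Measurable fun x : E[N] => ∫⁻ s : ℝ, g (x + s • e) := by
    refine Measurable.lintegral_prod_right' (f := fun q : E[N] × ℝ => g (q.1 + q.2 • e)) ?_
    exact hg.comp (by fun_prop)
  calc ∫⁻ x in S, (∫⁻ s : ℝ, g (x + s • e)) ∂(Measure.euclideanHausdorffMeasure (N - 1))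
      ≤ ∫⁻ x, (∫⁻ s : ℝ, g (x + s • e)) ∂(((1 + L : ℝ≥0) ^ (N - 1) : ℝ≥0) •
          Measure.map Φ volume) := lintegral_mono' hmeas_le le_rfl
    _ = ((1 + L : ℝ≥0) ^ (N - 1) : ℝ≥0) *
          ∫⁻ w : (ℝ ∙ e)ᗮ, ∫⁻ s : ℝ, g ((w : E[N]) + (ψ w + s) • e) := by
        rw [lintegral_smul_measure, lintegral_map hg2 hΦm, ENNReal.smul_def, smul_eq_mul]
        simp only [Φ, add_smul, add_assoc]
    _ = ((1 + L : ℝ≥0) ^ (N - 1) : ℝ≥0) * ∫⁻ w : (ℝ ∙ e)ᗮ, ∫⁻ s : ℝ, g ((w : E[N]) + s • e) := by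
        congr 1
        refine lintegral_congr fun w => ?_
        exact lintegral_add_left_eq_self (fun s : ℝ => g ((w : E[N]) + s • e)) (ψ w)
    _ = _ := by rw [hC g hg, ENNReal.coe_mul, mul_assoc]

end Graph

/-! ### Inward cones of Lipschitz domains -/

section Cone

variable {N : ℕ} {Ω : Set (EuclideanSpace ℝ (Fin N))}

local notation "E[" n "]" => EuclideanSpace ℝ (Fin n)

/-- Near `x₀`, the directions close to the unit vector `e` point from `closure Ω` into `Ω` (up to
the length `s₀`), and integrals along `e` starting from `∂Ω` are controlled by integrals
over `Ω`. -/
structure InwardChart (Ω : Set E[N]) (x₀ e : E[N]) (ρ s₀ η : ℝ) (C : ℝ≥0) : Prop where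
  norm_e : ‖e‖ = 1
  rho_pos : 0 < ρ
  s_pos : 0 < s₀
  eta_pos : 0 < η
  small : s₀ * (1 + η) ≤ ρ
  add_mem : ∀ x ∈ closure Ω, x ∈ Metric.ball x₀ (2 * ρ) → ∀ s, 0 < s → s ≤ s₀ →
    ∀ w, ‖w - e‖ ≤ η → x + s • w ∈ Ω
  lintegral_le : ∀ g : E[N] → ℝ≥0∞, Measurable g →
    ∫⁻ x in Metric.ball x₀ (2 * ρ), (∫⁻ s in Ioo 0 s₀, g (x + s • e)) ∂(surfaceMeasure Ω) ≤
      C * ∫⁻ x in Ω, g x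

section LocalGraph

variable {x₀ e : E[N]} {R : ℝ} {L : ℝ≥0} {ψ : (ℝ ∙ e)ᗮ → ℝ}

lemma graph_le_of_mem_closure (hψ : LipschitzWith L ψ)
    (hΩ : ∀ y ∈ Metric.ball x₀ R,
      (y ∈ Ω ↔ ψ ((ℝ ∙ e)ᗮ.orthogonalProjectionOnto y) < inner ℝ e y))
    {x : E[N]} (hx : x ∈ closure Ω) (hxR : x ∈ Metric.ball x₀ R) :
    ψ ((ℝ ∙ e)ᗮ.orthogonalProjectionOnto x) ≤ inner ℝ e x := by
  by_contra hlt
  push Not at hlt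
  have hc1 : Continuous fun y : E[N] => ψ ((ℝ ∙ e)ᗮ.orthogonalProjectionOnto y) :=
    hψ.continuous.comp (ContinuousLinearMap.continuous _)
  have hc2 : Continuous fun y : E[N] => inner ℝ e y := by fun_prop
  have hev := (hc2.tendsto x).eventually_lt (hc1.tendsto x) hlt
  obtain ⟨y, ⟨hy1, hy2⟩, hyΩ⟩ :=
    mem_closure_iff_nhds.1 hx _ (hev.and (Metric.isOpen_ball.mem_nhds hxR))
  exact absurd ((hΩ y hy2).1 hyΩ) (not_lt.2 (le_of_lt hy1))

lemma inner_eq_of_mem_frontier (hΩo : IsOpen Ω) (hψ : LipschitzWith L ψ)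
    (hΩ : ∀ y ∈ Metric.ball x₀ R,
      (y ∈ Ω ↔ ψ ((ℝ ∙ e)ᗮ.orthogonalProjectionOnto y) < inner ℝ e y))
    {x : E[N]} (hx : x ∈ frontier Ω) (hxR : x ∈ Metric.ball x₀ R) :
    inner ℝ e x = ψ ((ℝ ∙ e)ᗮ.orthogonalProjectionOnto x) := by
  rw [hΩo.frontier_eq] at hx
  refine le_antisymm (not_lt.1 fun h => hx.2 ((hΩ x hxR).2 h))
    (graph_le_of_mem_closure hψ hΩ hx.1 hxR)

end LocalGraph

lemma measurableSet_frontier_inter_ball (x₀ : E[N]) (r : ℝ) :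
    MeasurableSet (frontier Ω ∩ Metric.ball x₀ r) :=
  isClosed_frontier.measurableSet.inter Metric.isOpen_ball.measurableSet

/-- Lipschitz domains have inward charts at all points of their closure. At interior points, any
direction will do, and there is no boundary nearby. -/
theorem exists_inwardChart (hN : 1 ≤ N) (hΩo : IsOpen Ω) (hlip : HasLipschitzBoundary Ω)
    {x₀ : E[N]} (hx₀ : x₀ ∈ closure Ω) : ∃ e ρ s₀ η C, InwardChart Ω x₀ e ρ s₀ η C := by
  by_cases hmem : x₀ ∈ Ω
  · obtain ⟨R, hR, hball⟩ := Metric.isOpen_iff.1 hΩo x₀ hmem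
    have hfr : ∀ x ∈ Metric.ball x₀ R, x ∉ frontier Ω := fun x hx hxf => by
      rw [hΩo.frontier_eq] at hxf
      exact hxf.2 (hball hx)
    refine ⟨EuclideanSpace.single ⟨0, hN⟩ 1, R / 4, R / 8, 1, 0, ?_, by positivity, by positivity,
      one_pos, by linarith, ?_, ?_⟩
    · simp
    · intro x _ hx s hs hs0 w hw
      refine hball ?_
      rw [mem_ball_iff_norm] at hx ⊢
      have h1 : ‖w‖ ≤ 2 := by
        have h2 : ‖(EuclideanSpace.single ⟨0, hN⟩ 1 : E[N])‖ = 1 := by simp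
        calc ‖w‖ = ‖(w - EuclideanSpace.single ⟨0, hN⟩ 1) + EuclideanSpace.single ⟨0, hN⟩ 1‖ := by
              rw [sub_add_cancel]
          _ ≤ _ := norm_add_le _ _
          _ ≤ 2 := by linarith
      calc ‖x + s • w - x₀‖ = ‖(x - x₀) + s • w‖ := by congr 1; abel
        _ ≤ ‖x - x₀‖ + s * ‖w‖ := by
            refine (norm_add_le _ _).trans ?_
            rw [norm_smul, Real.norm_of_nonneg hs.le]
        _ < 2 * (R / 4) + R / 8 * 2 := by
            refine add_lt_add_of_lt_of_le hx ?_
            gcongr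
        _ ≤ R := by linarith
    · intro g _
      have h0 : (surfaceMeasure Ω).restrict (Metric.ball x₀ (2 * (R / 4))) = 0 := by
        rw [Measure.restrict_eq_zero, surfaceMeasure,
          Measure.restrict_apply Metric.isOpen_ball.measurableSet]
        convert measure_empty (μ := Measure.euclideanHausdorffMeasure (X := E[N]) (N - 1))
        refine eq_empty_of_forall_notMem fun x hx => hfr x ?_ hx.2
        exact Metric.ball_subset_ball (by linarith) hx.1
      rw [h0]
      simp
  · have hfr : x₀ ∈ frontier Ω := by
      rw [hΩo.frontier_eq]
      exact ⟨hx₀, hmem⟩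
    obtain ⟨e, R, L, ψ, he, hR, hψ, hΩ⟩ := hlip x₀ hfr
    obtain ⟨C, hC⟩ := exists_lintegral_graph_le he hψ
    -- the aperture `η` is chosen such that `(L + 1) * η < 1`
    let η : ℝ := 1 / (L + 2)
    have hL : (0 : ℝ) ≤ L := L.2
    have hη : 0 < η := by positivity
    have hη1 : η ≤ 1 := by
      rw [div_le_one (by positivity)]
      linarith
    have hLη : (L + 1) * η < 1 := by
      simp only [η]
      rw [mul_one_div, div_lt_one (by positivity)]
      linarith
    have hadd : ∀ x ∈ closure Ω, x ∈ Metric.ball x₀ (2 * (R / 4)) → ∀ s, 0 < s → s ≤ R / 8 →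
        ∀ w, ‖w - e‖ ≤ η → x + s • w ∈ Ω := by
      intro x hx hxb s hs hs0 w hw
      rw [mem_ball_iff_norm] at hxb
      have hwn : ‖w‖ ≤ 2 := by
        calc ‖w‖ = ‖(w - e) + e‖ := by rw [sub_add_cancel]
          _ ≤ ‖w - e‖ + ‖e‖ := norm_add_le _ _
          _ ≤ 2 := by linarith
      have hb : x + s • w ∈ Metric.ball x₀ R := by
        rw [mem_ball_iff_norm]
        calc ‖x + s • w - x₀‖ = ‖(x - x₀) + s • w‖ := by congr 1; abel
          _ ≤ ‖x - x₀‖ + s * ‖w‖ := by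
              refine (norm_add_le _ _).trans ?_
              rw [norm_smul, Real.norm_of_nonneg hs.le]
          _ < 2 * (R / 4) + R / 8 * 2 := by
              refine add_lt_add_of_lt_of_le hxb ?_
              gcongr
          _ ≤ R := by linarith
      have hxR : x ∈ Metric.ball x₀ R := by
        rw [mem_ball_iff_norm]
        linarith
      have h1 := graph_le_of_mem_closure hψ hΩ hx hxR
      rw [hΩ _ hb]
      set Q := (ℝ ∙ e)ᗮ.orthogonalProjectionOnto
      have hQw : ‖Q w‖ ≤ η := by
        have h2 : Q w = Q (w - e) := by
          rw [map_sub, Submodule.orthogonalProjectionOnto_orthogonalComplement_singleton_eq_zero,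
            sub_zero]
        rw [h2]
        exact (Submodule.norm_orthogonalProjectionOnto_apply_le _ _).trans hw
      have h3 : ψ (Q (x + s • w)) ≤ ψ (Q x) + L * (s * η) := by
        have h4 := hψ.dist_le_mul (Q (x + s • w)) (Q x)
        rw [map_add, dist_eq_norm (Q x + _), add_sub_cancel_left, map_smul, norm_smul,
          Real.norm_of_nonneg hs.le, Real.dist_eq] at h4
        rw [map_add, map_smul]
        have h5 := (abs_le.1 h4).2
        have h6 : L * (s * ‖Q w‖) ≤ L * (s * η) := by gcongr
        linarith
      have h7 : 1 - η ≤ inner ℝ e w := by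
        have h8 : inner ℝ e w = 1 + inner ℝ e (w - e) := by
          rw [inner_sub_right, real_inner_self_eq_norm_sq, he]
          ring
        have h9 := abs_real_inner_le_norm e (w - e)
        rw [he, one_mul] at h9
        have := (abs_le.1 h9).1
        linarith
      rw [inner_add_right, inner_smul_right]
      have h10 : s * (1 - η) ≤ s * inner ℝ e w := by gcongr
      nlinarith
    refine ⟨e, R / 4, R / 8, η, C, he, by positivity, by positivity, hη, by nlinarith, hadd, ?_⟩
    intro g hg
    let S := frontier Ω ∩ Metric.ball x₀ (2 * (R / 4))
    have hS : MeasurableSet S := measurableSet_frontier_inter_ball _ _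
    have hSr : (surfaceMeasure Ω).restrict (Metric.ball x₀ (2 * (R / 4))) =
        (Measure.euclideanHausdorffMeasure (N - 1)).restrict S := by
      rw [surfaceMeasure, Measure.restrict_restrict Metric.isOpen_ball.measurableSet, inter_comm]
    have hΩm := hΩo.measurableSet
    rw [hSr, ← lintegral_indicator hΩm]
    refine le_trans ?_ (hC S hS (fun y hy => inner_eq_of_mem_frontier hΩo hψ hΩ hy.1
      (Metric.ball_subset_ball (by linarith) hy.2)) _ (hg.indicator hΩm))
    refine setLIntegral_mono' hS fun x hx => ?_
    refine le_trans (setLIntegral_mono' measurableSet_Ioo fun s hs => ?_)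
      (setLIntegral_le_lintegral (Ioo 0 (R / 8)) _)
    rw [indicator_of_mem]
    exact hadd x (frontier_subset_closure hx.1) hx.2 s hs.1 hs.2.le e (by simpa using hη.le)

/-- The boundary of a nonempty bounded Lipschitz domain has positive surface measure: near a
boundary point, it projects onto an open subset of a hyperplane. -/
theorem surfaceMeasure_ne_zero (hN : 1 ≤ N) (hΩo : IsOpen Ω) (hne : Ω.Nonempty)
    (hb : Bornology.IsBounded Ω) (hlip : HasLipschitzBoundary Ω) : surfaceMeasure Ω ≠ 0 := by
  have : Nonempty (Fin N) := ⟨⟨0, hN⟩⟩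
  obtain ⟨x₀, hx₀⟩ : (frontier Ω).Nonempty := by
    rw [nonempty_frontier_iff]
    refine ⟨hne, fun h => ?_⟩
    rw [h] at hb
    exact NormedSpace.unbounded_univ ℝ E[N] hb
  obtain ⟨e, R, L, ψ, he, hR, hψ, hΩ⟩ := hlip x₀ hx₀
  set Q := (ℝ ∙ e)ᗮ.orthogonalProjectionOnto
  have hx₀e := inner_eq_of_mem_frontier hΩo hψ hΩ hx₀ (Metric.mem_ball_self hR)
  let Φ : (ℝ ∙ e)ᗮ → E[N] := fun w => (w : E[N]) + ψ w • e
  have hΦ : Continuous Φ :=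
    continuous_subtype_val.add (hψ.continuous.smul continuous_const)
  have hΦ0 : Φ (Q x₀) = x₀ := by
    simp only [Φ]
    rw [← hx₀e]
    exact orthogonalProjectionOnto_add_inner he x₀
  let U : Set (ℝ ∙ e)ᗮ := Φ ⁻¹' Metric.ball x₀ R
  have hU : IsOpen U := Metric.isOpen_ball.preimage hΦ
  have hUne : U.Nonempty := ⟨Q x₀, by simpa [U, hΦ0] using hR⟩
  have hfr : ∀ w ∈ U, Φ w ∈ frontier Ω := by
    intro w hw
    have hQ : ∀ s : ℝ, Q ((w : E[N]) + s • e) = w := orthogonalProjectionOnto_add_smul w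
    have hI : ∀ s : ℝ, inner ℝ e ((w : E[N]) + s • e) = s := inner_add_smul_self he w
    rw [hΩo.frontier_eq]
    constructor
    · have hcont : Continuous fun s : ℝ => (w : E[N]) + (ψ w + s) • e := by fun_prop
      have h0 : (w : E[N]) + (ψ w + 0) • e = Φ w := by rw [add_zero]
      have hlim := (hcont.tendsto 0).mono_left (nhdsWithin_le_nhds (s := Ioi 0))
      rw [h0] at hlim
      refine mem_closure_of_tendsto hlim ?_
      filter_upwards [hlim.eventually (Metric.isOpen_ball.mem_nhds hw), self_mem_nhdsWithin]
        with s hs1 hs2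
      rw [hΩ _ hs1, hQ, hI]
      simpa using hs2
    · intro hmem
      have := (hΩ _ hw).1 hmem
      change ψ (Q _) < _ at this
      rw [hQ, hI] at this
      exact lt_irrefl _ this
  intro h0
  have h1 : Measure.euclideanHausdorffMeasure (N - 1) (frontier Ω) = 0 := by
    rw [surfaceMeasure, Measure.restrict_eq_zero] at h0
    exact h0
  have hQlip : LipschitzWith 1 Q := Submodule.lipschitzWith_orthogonalProjectionOnto _
  have h2 := LipschitzWith.euclideanHausdorffMeasure_image_le hQlip (N - 1) (frontier Ω)
  rw [h1, mul_zero, euclideanHausdorffMeasure_orthogonal he] at h2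
  have h3 : U ⊆ Q '' frontier Ω := fun w hw =>
    ⟨Φ w, hfr w hw, orthogonalProjectionOnto_add_smul w _⟩
  have h4 := (hU.measure_pos volume hUne).trans_le ((measure_mono h3).trans h2)
  exact lt_irrefl _ h4

end Cone

/-! ### Mollification in `L^p` -/

lemma eLpNorm_rpow {X F : Type*} [MeasurableSpace X] {μ : Measure X} [NormedAddCommGroup F]
    {p : ℝ} (hp : 1 < p) (f : X → F) :
    eLpNorm f (ENNReal.ofReal p) μ ^ p = ∫⁻ x, ‖f x‖ₑ ^ p ∂μ := by
  have hp0 : 0 < p := by linarith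
  rw [eLpNorm_eq_lintegral_rpow_enorm_toReal (by simpa using hp0) ENNReal.ofReal_ne_top,
    ENNReal.toReal_ofReal hp0.le, ← ENNReal.rpow_mul, one_div, inv_mul_cancel₀ hp0.ne',
    ENNReal.rpow_one]

/-- Jensen's inequality for powers. -/
lemma lintegral_rpow_le {X : Type*} [MeasurableSpace X] {ν : Measure X} [IsProbabilityMeasure ν]
    {p : ℝ} (hp : 1 ≤ p) {g : X → ℝ≥0∞} (hg : AEMeasurable g ν) :
    (∫⁻ x, g x ∂ν) ^ p ≤ ∫⁻ x, g x ^ p ∂ν := by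
  have hp0 : 0 < p := by linarith
  have h := eLpNorm'_le_eLpNorm'_of_exponent_le (f := g) one_pos hp ν hg.aestronglyMeasurable
  simp only [eLpNorm', enorm_eq_self, ENNReal.rpow_one, div_one] at h
  have h2 := ENNReal.rpow_le_rpow h hp0.le
  rwa [← ENNReal.rpow_mul, one_div, inv_mul_cancel₀ hp0.ne', ENNReal.rpow_one] at h2

section Mollifier

variable {V F : Type*} [NormedAddCommGroup V] [InnerProductSpace ℝ V] [FiniteDimensional ℝ V]
  [MeasurableSpace V] [BorelSpace V] [NormedAddCommGroup F] [NormedSpace ℝ F] [CompleteSpace F]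

/-- A mollifying kernel concentrated in the ball of radius `r` around `c` (which need not be the
origin). -/
structure IsMollifier (k : V → ℝ) (c : V) (r : ℝ) : Prop where
  contDiff : ContDiff ℝ ∞ k
  nonneg : ∀ z, 0 ≤ k z
  integral_eq_one : ∫ z, k z = 1
  tsupport_subset : tsupport k ⊆ Metric.closedBall c r

lemma exists_isMollifier (c : V) {r : ℝ} (hr : 0 < r) : ∃ k : V → ℝ, IsMollifier k c r := by
  let b : ContDiffBump c := ⟨r / 2, r, by positivity, by linarith⟩
  exact ⟨b.normed volume, b.contDiff_normed, b.nonneg_normed, b.integral_normed,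
    b.tsupport_normed_eq.subset⟩

variable {k : V → ℝ} {c : V} {r : ℝ}

lemma IsMollifier.hasCompactSupport (hk : IsMollifier k c r) : HasCompactSupport k :=
  HasCompactSupport.of_support_subset_isCompact (isCompact_closedBall c r)
    ((subset_tsupport k).trans hk.tsupport_subset)

lemma IsMollifier.integrable (hk : IsMollifier k c r) : Integrable k :=
  hk.contDiff.continuous.integrable_of_hasCompactSupport hk.hasCompactSupport

/-- The convolution with a mollifying kernel. -/
noncomputable def mollify (k : V → ℝ) (h : V → F) (x : V) : F := ∫ z, k z • h (x - z)

lemma mollify_eq_convolution (k : V → ℝ) (h : V → F) :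
    mollify k h = convolution k h (ContinuousLinearMap.lsmul ℝ ℝ) volume := rfl

lemma IsMollifier.contDiff_mollify (hk : IsMollifier k c r) {h : V → F}
    (hh : LocallyIntegrable h) : ContDiff ℝ ∞ (mollify k h) := by
  rw [mollify_eq_convolution]
  exact hk.hasCompactSupport.contDiff_convolution_left _ hk.contDiff hh

lemma IsMollifier.integrable_smul (hk : IsMollifier k c r) {h : V → F}
    (hh : LocallyIntegrable h) (x : V) : Integrable (fun z => k z • h (x - z)) :=
  hk.hasCompactSupport.convolutionExists_left (ContinuousLinearMap.lsmul ℝ ℝ)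
    hk.contDiff.continuous hh x

/-- If `h` varies little in `L^p(S)` under the translations from the support of the kernel, then it
is close to its mollification in `L^p(S)`. -/
lemma IsMollifier.lintegral_mollify_sub_le (hk : IsMollifier k c r) {p : ℝ} (hp : 1 ≤ p)
    {h : V → F} (hh : LocallyIntegrable h) {S : Set V} {B : ℝ≥0∞}
    (hB : ∀ z ∈ Metric.closedBall c r, ∫⁻ x in S, ‖h (x - z) - h x‖ₑ ^ p ≤ B) :
    ∫⁻ x in S, ‖mollify k h x - h x‖ₑ ^ p ≤ B := by
  have hp0 : 0 < p := by linarith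
  let d : V → ℝ≥0∞ := fun z => ENNReal.ofReal (k z)
  have hd : Measurable d := hk.contDiff.continuous.measurable.ennreal_ofReal
  let ν : Measure V := volume.withDensity d
  have hν : IsProbabilityMeasure ν := by
    refine ⟨?_⟩
    rw [withDensity_apply _ MeasurableSet.univ, Measure.restrict_univ,
      ← ofReal_integral_eq_lintegral_ofReal hk.integrable (Eventually.of_forall hk.nonneg),
      hk.integral_eq_one, ENNReal.ofReal_one]
  have hνac : ν ≪ volume := withDensity_absolutelyContinuous _ _
  have hνsupp : ∀ᵐ z ∂ν, z ∈ Metric.closedBall c r := by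
    rw [ae_withDensity_iff hd]
    refine Eventually.of_forall fun z hz => hk.tsupport_subset (subset_tsupport k ?_)
    intro h0
    exact hz (by simp [d, h0])
  have hpt : ∀ x, ‖mollify k h x - h x‖ₑ ≤ ∫⁻ z, ‖h (x - z) - h x‖ₑ ∂ν := by
    intro x
    have h1 : mollify k h x - h x = ∫ z, k z • (h (x - z) - h x) := by
      simp only [smul_sub]
      rw [integral_sub (hk.integrable_smul hh x) (hk.integrable.smul_const _),
        integral_smul_const, hk.integral_eq_one, one_smul]
      rfl
    have hm : AEMeasurable (fun z => ‖h (x - z) - h x‖ₑ) volume := by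
      have : AEStronglyMeasurable (fun z => h (x - z)) volume :=
        hh.aestronglyMeasurable.comp_quasiMeasurePreserving
          (Measure.measurePreserving_sub_left volume x).quasiMeasurePreserving
      exact (this.sub aestronglyMeasurable_const).enorm
    rw [h1, lintegral_withDensity_eq_lintegral_mul₀ hd.aemeasurable hm]
    refine (enorm_integral_le_lintegral_enorm _).trans (lintegral_mono fun z => ?_)
    rw [enorm_smul, Real.enorm_of_nonneg (hk.nonneg z)]
    rfl
  have hmeas : AEStronglyMeasurable (fun q : V × V => h (q.1 - q.2) - h q.1)
      ((volume.restrict S).prod ν) := by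
    have h1 : AEStronglyMeasurable (fun q : V × V => h (q.1 - q.2)) (volume.prod ν) :=
      hh.aestronglyMeasurable.comp_quasiMeasurePreserving
        (quasiMeasurePreserving_sub_of_right_invariant volume ν)
    have h2 : AEStronglyMeasurable (fun q : V × V => h q.1) (volume.prod ν) :=
      hh.aestronglyMeasurable.comp_quasiMeasurePreserving Measure.quasiMeasurePreserving_fst
    refine (h1.sub h2).mono_ac ?_
    exact Measure.AbsolutelyContinuous.prod Measure.absolutelyContinuous_restrict
      Measure.AbsolutelyContinuous.rfl
  calc ∫⁻ x in S, ‖mollify k h x - h x‖ₑ ^ p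
      ≤ ∫⁻ x in S, (∫⁻ z, ‖h (x - z) - h x‖ₑ ∂ν) ^ p :=
        lintegral_mono fun x => ENNReal.rpow_le_rpow (hpt x) hp0.le
    _ ≤ ∫⁻ x in S, ∫⁻ z, ‖h (x - z) - h x‖ₑ ^ p ∂ν := by
        refine lintegral_mono_ae ?_
        filter_upwards [hmeas.prodMk_left] with x hx
        exact lintegral_rpow_le hp hx.enorm
    _ = ∫⁻ z, (∫⁻ x in S, ‖h (x - z) - h x‖ₑ ^ p) ∂ν :=
        lintegral_lintegral_swap (hmeas.enorm.pow_const p)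
    _ ≤ ∫⁻ _, B ∂ν := lintegral_mono_ae (hνsupp.mono fun z hz => hB z hz)
    _ = B := by simp

/-- Translations are continuous in `L^p`. -/
lemma exists_lintegral_translate_sub_le {p : ℝ} (hp : 1 < p) {h : V → F}
    (hh : MemLp h (ENNReal.ofReal p) volume) {ε : ℝ≥0∞} (hε : 0 < ε) :
    ∃ δ > (0 : ℝ), ∀ z : V, ‖z‖ < δ → ∫⁻ x, ‖h (x - z) - h x‖ₑ ^ p ≤ ε := by
  have hp0 : 0 < p := by linarith
  have : Fact (1 ≤ ENNReal.ofReal p) := ⟨by simpa using hp.le⟩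
  have : Fact (ENNReal.ofReal p ≠ ⊤) := ⟨ENNReal.ofReal_ne_top⟩
  have hcont : Continuous fun a : Vᵈᵃᵃ => a +ᵥ hh.toLp h := continuous_id.vadd continuous_const
  have hcont2 : Continuous fun z : V => (DomAddAct.mk (-z)) +ᵥ hh.toLp h :=
    hcont.comp (DomAddAct.mkHomeomorph.continuous.comp continuous_neg)
  have hlim := (hcont2.tendsto 0)
  rw [neg_zero, DomAddAct.mk_zero, zero_vadd, tendsto_iff_dist_tendsto_zero] at hlim
  obtain ⟨ε', hε', hεε'⟩ : ∃ ε' : ℝ, 0 < ε' ∧ ENNReal.ofReal ε' ^ p ≤ ε := by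
    rcases eq_or_ne ε ⊤ with rfl | hne
    · exact ⟨1, one_pos, le_top⟩
    · have hpos : 0 < ε.toReal := ENNReal.toReal_pos hε.ne' hne
      refine ⟨ε.toReal ^ (p⁻¹), by positivity, ?_⟩
      rw [ENNReal.ofReal_rpow_of_nonneg (by positivity) hp0.le, ← Real.rpow_mul hpos.le,
        inv_mul_cancel₀ hp0.ne', Real.rpow_one, ENNReal.ofReal_toReal hne]
  have hev := hlim.eventually (gt_mem_nhds hε')
  obtain ⟨δ, hδ, hball⟩ := Metric.eventually_nhds_iff.1 hev
  refine ⟨δ, hδ, fun z hz => ?_⟩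
  have h1 := hball (y := z) (by simpa using hz)
  rw [DomAddAct.mk_vadd_toLp, dist_eq_norm, ← MemLp.toLp_sub, Lp.norm_toLp] at h1
  have h2 : (fun x => h (x - z) - h x) = (fun x => h (-z +ᵥ x)) - h := by
    ext x
    simp [sub_eq_neg_add]
  rw [← eLpNorm_rpow hp]
  refine le_trans (ENNReal.rpow_le_rpow ?_ hp0.le) hεε'
  rw [h2]
  have hmem : MemLp (fun x => h (-z +ᵥ x)) (ENNReal.ofReal p) volume :=
    hh.comp_measurePreserving (measurePreserving_vadd (-z) volume)
  have hfin : eLpNorm ((fun x => h (-z +ᵥ x)) - h) (ENNReal.ofReal p) volume ≠ ⊤ :=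
    (hmem.sub hh).eLpNorm_ne_top
  rw [← ENNReal.ofReal_toReal hfin]
  exact ENNReal.ofReal_le_ofReal h1.le

end Mollifier

/-! ### Density of smooth functions -/

section Density

variable {N : ℕ} {Ω : Set (EuclideanSpace ℝ (Fin N))}

local notation "E[" n "]" => EuclideanSpace ℝ (Fin n)

/-- A finite smooth partition of unity on `closure Ω`, subordinate to inward charts. -/
structure InwardPartition (Ω : Set E[N]) (ι : Type) [Fintype ι] where
  /-- The functions of the partition of unity. -/
  χ : ι → E[N] → ℝ
  /-- The centres of the charts. -/
  x₀ : ι → E[N]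
  /-- The inward directions. -/
  e : ι → E[N]
  /-- The radii of the charts. -/
  ρ : ι → ℝ
  /-- The lengths of the inward cones. -/
  s₀ : ι → ℝ
  /-- The apertures of the inward cones. -/
  η : ι → ℝ
  /-- The constants in the integral inequalities of the charts. -/
  C : ι → ℝ≥0
  chart : ∀ i, InwardChart Ω (x₀ i) (e i) (ρ i) (s₀ i) (η i) (C i)
  contDiff : ∀ i, ContDiff ℝ ∞ (χ i)
  tsupport_subset : ∀ i, tsupport (χ i) ⊆ Metric.ball (x₀ i) (ρ i)
  sum_eq_one : ∀ y ∈ closure Ω, ∑ i, χ i y = 1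

theorem exists_inwardPartition (hN : 1 ≤ N) (hΩo : IsOpen Ω) (hb : Bornology.IsBounded Ω)
    (hlip : HasLipschitzBoundary Ω) :
    ∃ (ι : Type) (_ : Fintype ι), Nonempty (InwardPartition Ω ι) := by
  have hK : IsCompact (closure Ω) := hb.isCompact_closure
  have hch : ∀ x : closure Ω, ∃ e ρ s₀ η C, InwardChart Ω (x : E[N]) e ρ s₀ η C := fun x =>
    exists_inwardChart hN hΩo hlip x.2
  choose e ρ s₀ η C hch using hch
  obtain ⟨t, ht⟩ := hK.elim_finite_subcover (fun x : closure Ω => Metric.ball (x : E[N]) (ρ x))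
    (fun _ => Metric.isOpen_ball)
    (fun x hx => mem_iUnion.2 ⟨⟨x, hx⟩, Metric.mem_ball_self (hch ⟨x, hx⟩).rho_pos⟩)
  obtain ⟨φ, hφ⟩ := SmoothPartitionOfUnity.exists_isSubordinate (modelWithCornersSelf ℝ E[N])
    isClosed_closure (fun x : t => Metric.ball (x.1 : E[N]) (ρ x.1))
    (fun _ => Metric.isOpen_ball) (by
      intro x hx
      obtain ⟨i, hi⟩ := mem_iUnion.1 (ht hx)
      obtain ⟨hit, hxi⟩ := mem_iUnion.1 hi
      exact mem_iUnion.2 ⟨⟨i, hit⟩, hxi⟩)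
  refine ⟨t, inferInstance, ⟨⟨fun i => φ i, fun i => i.1, fun i => e i.1, fun i => ρ i.1,
    fun i => s₀ i.1, fun i => η i.1, fun i => C i.1, fun i => hch i.1, fun i => ?_, hφ, ?_⟩⟩⟩
  · exact contMDiff_iff_contDiff.1 (φ i).contMDiff
  · intro y hy
    rw [← finsum_eq_sum_of_fintype]
    exact φ.sum_eq_one hy

lemma gradient_apply (f : E[N] → ℝ) (x : E[N]) (j : Fin N) :
    gradient f x j = fderiv ℝ f x (EuclideanSpace.single j 1) := by
  have h1 : fderiv ℝ f x (EuclideanSpace.single j 1) =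
      inner ℝ (gradient f x) (EuclideanSpace.single j 1) := by
    rw [gradient, InnerProductSpace.toDual_symm_apply]
  rw [h1, EuclideanSpace.inner_single_right]
  simp

lemma continuous_gradient {f : E[N] → ℝ} (hf : ContDiff ℝ ∞ f) : Continuous (gradient f) :=
  (InnerProductSpace.toDual ℝ E[N]).symm.continuous.comp (hf.continuous_fderiv (by simp))

section Chart

variable {x₀ e : E[N]} {ρ s₀ η : ℝ} {C : ℝ≥0}

lemma hasCompactSupport_of_tsupport_subset_ball {χ : E[N] → ℝ}
    (hχs : tsupport χ ⊆ Metric.ball x₀ ρ) : HasCompactSupport χ :=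
  (isCompact_closedBall x₀ ρ).of_isClosed_subset (isClosed_tsupport χ)
    (hχs.trans Metric.ball_subset_closedBall)

/-- Translating a point of `closure Ω` into the support of a function that is supported in the
chart leads to a point of `Ω`, if the translation is along the inward cone. -/
lemma InwardChart.sub_mem (hch : InwardChart Ω x₀ e ρ s₀ η C) {χ : E[N] → ℝ}
    (hχs : tsupport χ ⊆ Metric.ball x₀ ρ) {t : ℝ} (ht : 0 < t) (hts : t ≤ s₀) {x z : E[N]}
    (hx : x ∈ closure Ω) (hz : z ∈ Metric.closedBall (-t • e) (t * η))
    (hxz : x - z ∈ tsupport χ) : x - z ∈ Ω := by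
  have h1 := hχs hxz
  rw [mem_ball_iff_norm] at h1
  rw [mem_closedBall_iff_norm] at hz
  have hzn : ‖z‖ ≤ ρ := by
    calc ‖z‖ = ‖(z - -t • e) + -t • e‖ := by rw [sub_add_cancel]
      _ ≤ t * η + t * 1 := by
          refine (norm_add_le _ _).trans (add_le_add hz ?_)
          rw [norm_smul, norm_neg, Real.norm_of_nonneg ht.le, hch.norm_e]
      _ ≤ s₀ * (1 + η) := by
          have := hch.eta_pos
          nlinarith
      _ ≤ ρ := hch.small
  have h2 : x ∈ Metric.ball x₀ (2 * ρ) := by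
    rw [mem_ball_iff_norm]
    calc ‖x - x₀‖ = ‖(x - z - x₀) + z‖ := by congr 1; abel
      _ ≤ ‖x - z - x₀‖ + ‖z‖ := norm_add_le _ _
      _ < 2 * ρ := by linarith
  have h3 := hch.add_mem x hx h2 t ht hts (-t⁻¹ • z) (by
    have h4 : -t⁻¹ • z - e = -t⁻¹ • (z - -t • e) := by
      rw [smul_sub, smul_smul]
      field_simp
      simp
    rw [h4, norm_smul, norm_neg, norm_inv, Real.norm_of_nonneg ht.le, inv_mul_le_iff₀ ht]
    exact hz)
  have h5 : x + t • (-t⁻¹ • z) = x - z := by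
    rw [smul_smul]
    field_simp
    simp [sub_eq_add_neg]
  rwa [h5] at h3

lemma integrableOn_mul_of_continuous {c u : E[N] → ℝ} (hc : Continuous c)
    (hcs : HasCompactSupport c) (hu : IntegrableOn u Ω) :
    IntegrableOn (fun y => c y * u y) Ω := by
  obtain ⟨M, hM⟩ := hc.bounded_above_of_compact_support hcs
  exact Integrable.bdd_mul hu hc.aestronglyMeasurable (Eventually.of_forall hM)

lemma memLp_smul_of_continuous {F : Type*} [NormedAddCommGroup F] [NormedSpace ℝ F]
    {q : ℝ≥0∞} {μ : Measure E[N]} {c : E[N] → ℝ} (hc : Continuous c) (hcs : HasCompactSupport c)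
    {u : E[N] → F} (hu : MemLp u q μ) : MemLp (fun y => c y • u y) q μ := by
  obtain ⟨M, hM⟩ := hc.bounded_above_of_compact_support hcs
  refine hu.of_le_mul (c := M) (hc.aestronglyMeasurable.smul hu.1)
    (Eventually.of_forall fun y => ?_)
  rw [norm_smul]
  exact mul_le_mul_of_nonneg_right (hM y) (norm_nonneg _)

lemma memLp_indicator_mul (hΩ : MeasurableSet Ω) {q : ℝ≥0∞} {χ : E[N] → ℝ} (hχ : Continuous χ)
    (hχc : HasCompactSupport χ) {u : E[N] → ℝ} (hu : MemLp u q (volume.restrict Ω)) :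
    MemLp (Ω.indicator fun y => χ y * u y) q volume :=
  (memLp_indicator_iff_restrict hΩ).2 (memLp_smul_of_continuous hχ hχc hu)

/-- The gradient of the cut-off function `χ * u`, as given by the product rule, is in `L^q`. -/
lemma memLp_indicator_gradient (hΩ : MeasurableSet Ω) {q : ℝ≥0∞} {χ : E[N] → ℝ}
    (hχ : ContDiff ℝ ∞ χ) (hχc : HasCompactSupport χ) {u : E[N] → ℝ} {G : E[N] → E[N]}
    (hu : MemLp u q (volume.restrict Ω)) (hG : MemLp G q (volume.restrict Ω)) :
    MemLp (Ω.indicator fun y => χ y • G y + u y • gradient χ y) q volume := by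
  refine (memLp_indicator_iff_restrict hΩ).2
    ((memLp_smul_of_continuous hχ.continuous hχc hG).add ?_)
  have hgs : HasCompactSupport (gradient χ) :=
    (hχc.fderiv (𝕜 := ℝ)).comp_left (g := (InnerProductSpace.toDual ℝ E[N]).symm) (map_zero _)
  have hgc := continuous_gradient hχ
  obtain ⟨M, hM⟩ := hgc.bounded_above_of_compact_support hgs
  refine hu.of_le_mul (c := M) (hu.1.smul hgc.aestronglyMeasurable)
    (Eventually.of_forall fun y => ?_)
  rw [norm_smul, mul_comm]
  exact mul_le_mul_of_nonneg_right (hM y) (norm_nonneg _)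

/-- Mollification along the inward cone commutes with the gradient: for `x ∈ Ω`, the function
`y ↦ k (x - y) * χ y` is supported in `Ω`, and hence is a test function for the weak gradient. -/
lemma InwardChart.gradient_mollify (hΩo : IsOpen Ω) (hch : InwardChart Ω x₀ e ρ s₀ η C)
    {χ : E[N] → ℝ} (hχ : ContDiff ℝ ∞ χ) (hχs : tsupport χ ⊆ Metric.ball x₀ ρ)
    {u : E[N] → ℝ} {G : E[N] → E[N]} (hu : IntegrableOn u Ω) (hG : IntegrableOn G Ω)
    (hw : HasWeakGradient Ω u G) {t : ℝ} (ht : 0 < t) (hts : t ≤ s₀) {k : E[N] → ℝ}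
    (hk : IsMollifier k (-t • e) (t * η)) {x : E[N]} (hx : x ∈ Ω) :
    gradient (mollify k (Ω.indicator fun y => χ y * u y)) x =
      mollify k (Ω.indicator fun y => χ y • G y + u y • gradient χ y) x := by
  have hΩm := hΩo.measurableSet
  have hχc : HasCompactSupport χ := hasCompactSupport_of_tsupport_subset_ball hχs
  have hχd : Continuous (fderiv ℝ χ) := hχ.continuous_fderiv (by simp)
  have hkd : Continuous (fderiv ℝ k) := hk.contDiff.continuous_fderiv (by simp)
  have hgc := continuous_gradient hχ
  set h : E[N] → ℝ := Ω.indicator fun y => χ y * u y with hh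
  set H : E[N] → E[N] := Ω.indicator fun y => χ y • G y + u y • gradient χ y with hH
  have hhi : Integrable h := by
    rw [← memLp_one_iff_integrable]
    exact memLp_indicator_mul hΩm hχ.continuous hχc (memLp_one_iff_integrable.2 hu)
  have hGj : ∀ j, IntegrableOn (fun y => G y j) Ω := fun j =>
    (EuclideanSpace.proj (𝕜 := ℝ) j).integrable_comp hG
  have hHi : Integrable H := by
    rw [← memLp_one_iff_integrable]
    exact memLp_indicator_gradient hΩm hχ hχc (memLp_one_iff_integrable.2 hu)
      (memLp_one_iff_integrable.2 hG)
  ext j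
  set v : E[N] := EuclideanSpace.single j 1 with hv
  have hc1 : Continuous fun y => fderiv ℝ k (x - y) v * χ y := by fun_prop
  have hc2 : Continuous fun y => k (x - y) * fderiv ℝ χ y v :=
    (hk.contDiff.continuous.comp (by fun_prop)).mul (by fun_prop)
  have hc3 : Continuous fun y => k (x - y) * χ y :=
    (hk.contDiff.continuous.comp (by fun_prop)).mul hχ.continuous
  have hs1 : HasCompactSupport fun y => fderiv ℝ k (x - y) v * χ y := hχc.mul_left
  have hs2 : HasCompactSupport fun y => k (x - y) * fderiv ℝ χ y v :=
    (hχc.fderiv_apply ℝ v).mul_left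
  have hs3 : HasCompactSupport fun y => k (x - y) * χ y := hχc.mul_left
  have hL : gradient (mollify k h) x j =
      ∫ y in Ω, (fderiv ℝ k (x - y) v * χ y) * u y := by
    have h1 := hk.hasCompactSupport.hasFDerivAt_convolution_left
      (ContinuousLinearMap.lsmul ℝ ℝ) (hk.contDiff.of_le (by simp)) hhi.locallyIntegrable x
    have h2 : ConvolutionExistsAt (fderiv ℝ k) h x
        (ContinuousLinearMap.precompL E[N] (ContinuousLinearMap.lsmul ℝ ℝ)) volume :=
      (hk.hasCompactSupport.fderiv (𝕜 := ℝ)).convolutionExists_left _ hkd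
        hhi.locallyIntegrable x
    rw [gradient_apply, mollify_eq_convolution, h1.fderiv, convolution_def,
      ContinuousLinearMap.integral_apply h2]
    rw [← integral_sub_left_eq_self _ volume x, ← integral_indicator hΩm]
    refine integral_congr_ae (Eventually.of_forall fun y => ?_)
    simp only [ContinuousLinearMap.precompL_apply, ContinuousLinearMap.lsmul_apply,
      sub_sub_cancel, hh, indicator, smul_eq_mul]
    split_ifs <;> ring
  have hR : mollify k H x j = ∫ y in Ω, k (x - y) * (χ y * G y j + u y * fderiv ℝ χ y v) := by
    have h1 := ContinuousLinearMap.integral_comp_comm (EuclideanSpace.proj (𝕜 := ℝ) j)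
      (hk.integrable_smul hHi.locallyIntegrable x)
    have h2 : mollify k H x j = ∫ z, k z * H (x - z) j := h1.symm
    rw [h2, ← integral_sub_left_eq_self _ volume x, ← integral_indicator hΩm]
    refine integral_congr_ae (Eventually.of_forall fun y => ?_)
    simp only [sub_sub_cancel, hH, indicator]
    split_ifs
    · simp [gradient_apply, hv]
    · simp
  have hζs : tsupport (fun y => k (x - y) * χ y) ⊆ Ω := by
    have hsub : tsupport (fun y => k (x - y) * χ y) ⊆
        {y | x - y ∈ Metric.closedBall (-t • e) (t * η)} ∩ tsupport χ := by
      refine subset_inter (closure_minimal ?_ ?_) (tsupport_mul_subset_right)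
      · intro y hy
        refine hk.tsupport_subset (subset_tsupport k fun h0 => hy ?_)
        simp only [h0, zero_mul]
      · exact Metric.isClosed_closedBall.preimage (by fun_prop)
    intro y hy
    obtain ⟨hy1, hy2⟩ := hsub hy
    have := hch.sub_mem hχs ht hts (subset_closure hx) hy1 (by rwa [sub_sub_cancel])
    rwa [sub_sub_cancel] at this
  have hζ : ContDiff ℝ ∞ fun y => k (x - y) * χ y :=
    (hk.contDiff.comp (contDiff_const.sub contDiff_id)).mul hχ
  have hζd : ∀ y, fderiv ℝ (fun y => k (x - y) * χ y) y v =
      k (x - y) * fderiv ℝ χ y v - fderiv ℝ k (x - y) v * χ y := by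
    intro y
    have d1 : HasFDerivAt (fun y => k (x - y))
        ((fderiv ℝ k (x - y)).comp (-(ContinuousLinearMap.id ℝ E[N]))) y := by
      refine HasFDerivAt.comp y
        ((hk.contDiff.differentiable (by simp)) (x - y)).hasFDerivAt ?_
      exact (hasFDerivAt_id y).const_sub x
    have d2 := ((hχ.differentiable (by simp)) y).hasFDerivAt
    rw [(d1.fun_mul d2).fderiv]
    simp
    ring
  have hweak := hw.2.2 _ hζ hs3 hζs j
  rw [← hv] at hweak
  simp only [hζd] at hweak
  have i1 := integrableOn_mul_of_continuous hc1 hs1 hu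
  have i2 := integrableOn_mul_of_continuous hc2 hs2 hu
  have i3 := integrableOn_mul_of_continuous hc3 hs3 (hGj j)
  have e1 : ∫ y in Ω, u y * (k (x - y) * fderiv ℝ χ y v - fderiv ℝ k (x - y) v * χ y) =
      (∫ y in Ω, k (x - y) * fderiv ℝ χ y v * u y) -
        ∫ y in Ω, fderiv ℝ k (x - y) v * χ y * u y := by
    rw [← integral_sub i2 i1]
    exact integral_congr_ae (Eventually.of_forall fun y => by simp only; ring)
  have e2 : ∫ y in Ω, k (x - y) * (χ y * G y j + u y * fderiv ℝ χ y v) =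
      (∫ y in Ω, k (x - y) * χ y * G y j) + ∫ y in Ω, k (x - y) * fderiv ℝ χ y v * u y := by
    rw [← integral_add i3 i2]
    exact integral_congr_ae (Eventually.of_forall fun y => by simp only; ring)
  have e3 : ∫ y in Ω, G y j * (k (x - y) * χ y) = ∫ y in Ω, k (x - y) * χ y * G y j :=
    integral_congr_ae (Eventually.of_forall fun y => by simp only; ring)
  rw [hL, hR, e2]
  rw [e1, e3] at hweak
  linarith

end Chart

/-- Functions that are smooth up to the boundary are dense in the Sobolev space of a bounded
Lipschitz domain: in each chart, the cut-off function is mollified along the inward cone. -/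
theorem exists_contDiff_approx {ι : Type} [Fintype ι] (P : InwardPartition Ω ι) (hΩo : IsOpen Ω)
    (hb : Bornology.IsBounded Ω) {p : ℝ} (hp : 1 < p) {u : E[N] → ℝ} {G : E[N] → E[N]}
    (hu : MemLp u (ENNReal.ofReal p) (volume.restrict Ω))
    (hG : MemLp G (ENNReal.ofReal p) (volume.restrict Ω)) (hw : HasWeakGradient Ω u G)
    {ε : ℝ≥0∞} (hε : 0 < ε) : ∃ φ : E[N] → ℝ, ContDiff ℝ ∞ φ ∧
      eLpNorm (fun x => φ x - u x) (ENNReal.ofReal p) (volume.restrict Ω) ≤ ε ∧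
      eLpNorm (fun x => gradient φ x - G x) (ENNReal.ofReal p) (volume.restrict Ω) ≤ ε := by
  have hp0 : 0 < p := by linarith
  have hp1 : 1 ≤ ENNReal.ofReal p := by simpa using hp.le
  have hΩm := hΩo.measurableSet
  have : IsFiniteMeasure (volume.restrict Ω) :=
    isFiniteMeasure_restrict.2 hb.measure_lt_top.ne
  have hu1 : IntegrableOn u Ω := hu.integrable hp1
  have hG1 : IntegrableOn G Ω := hG.integrable hp1
  have hχc : ∀ i, HasCompactSupport (P.χ i) := fun i =>
    hasCompactSupport_of_tsupport_subset_ball (P.tsupport_subset i)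
  let h : ι → E[N] → ℝ := fun i => Ω.indicator fun y => P.χ i y * u y
  let H : ι → E[N] → E[N] := fun i => Ω.indicator fun y => P.χ i y • G y + u y • gradient (P.χ i) y
  have hh : ∀ i {q}, MemLp u q (volume.restrict Ω) → MemLp (h i) q volume := fun i q hq =>
    memLp_indicator_mul hΩm (P.contDiff i).continuous (hχc i) hq
  have hH : ∀ i {q}, MemLp u q (volume.restrict Ω) → MemLp G q (volume.restrict Ω) →
      MemLp (H i) q volume := fun i q hq hq' =>
    memLp_indicator_gradient hΩm (P.contDiff i) (hχc i) hq hq'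
  have hhl : ∀ i, LocallyIntegrable (h i) := fun i =>
    ((hh i hu).locallyIntegrable hp1)
  have hHl : ∀ i, LocallyIntegrable (H i) := fun i =>
    ((hH i hu hG).locallyIntegrable hp1)
  let n : ℝ≥0∞ := (Fintype.card ι : ℝ≥0∞) + 1
  have hn0 : n ≠ 0 := by simp [n]
  have hn1 : n ≠ ⊤ := by simp [n]
  have hεn : 0 < ε / n := ENNReal.div_pos hε.ne' hn1
  have key : ∀ i, ∃ k : E[N] → ℝ, ContDiff ℝ ∞ (mollify k (h i)) ∧
      eLpNorm (fun x => mollify k (h i) x - h i x) (ENNReal.ofReal p) (volume.restrict Ω) ≤ ε / n ∧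
      eLpNorm (fun x => mollify k (H i) x - H i x) (ENNReal.ofReal p) (volume.restrict Ω) ≤ ε / n ∧
      ∀ x ∈ Ω, gradient (mollify k (h i)) x = mollify k (H i) x := by
    intro i
    have hch := P.chart i
    have hεp : 0 < (ε / n) ^ p := ENNReal.rpow_pos_of_nonneg hεn hp0.le
    obtain ⟨δ₁, hδ₁, h1⟩ := exists_lintegral_translate_sub_le hp (hh i hu) hεp
    obtain ⟨δ₂, hδ₂, h2⟩ := exists_lintegral_translate_sub_le hp (hH i hu hG) hεp
    have hη1 : 0 < 1 + P.η i := by linarith [hch.eta_pos]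
    let t : ℝ := min (P.s₀ i) (min δ₁ δ₂ / (2 * (1 + P.η i)))
    have ht : 0 < t := lt_min hch.s_pos (div_pos (lt_min hδ₁ hδ₂) (by positivity))
    obtain ⟨k, hk⟩ := exists_isMollifier (-t • P.e i) (mul_pos ht hch.eta_pos)
    have hzn : ∀ z ∈ Metric.closedBall (-t • P.e i) (t * P.η i), ‖z‖ < min δ₁ δ₂ := by
      intro z hz
      rw [mem_closedBall_iff_norm] at hz
      have h3 : t ≤ min δ₁ δ₂ / (2 * (1 + P.η i)) := min_le_right _ _
      rw [le_div_iff₀ (by positivity)] at h3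
      calc ‖z‖ = ‖(z - -t • P.e i) + -t • P.e i‖ := by rw [sub_add_cancel]
        _ ≤ t * P.η i + t * 1 := by
            refine (norm_add_le _ _).trans (add_le_add hz ?_)
            rw [norm_smul, norm_neg, Real.norm_of_nonneg ht.le, hch.norm_e]
        _ = t * (1 + P.η i) := by ring
        _ < t * (2 * (1 + P.η i)) := by nlinarith [mul_pos ht hη1]
        _ ≤ _ := h3
    refine ⟨k, hk.contDiff_mollify (hhl i), ?_, ?_, fun x hx =>
      hch.gradient_mollify hΩo (P.contDiff i) (P.tsupport_subset i) hu1 hG1 hw ht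
        (min_le_left _ _) hk hx⟩
    · refine (ENNReal.rpow_le_rpow_iff hp0).1 ?_
      rw [eLpNorm_rpow hp]
      exact hk.lintegral_mollify_sub_le hp.le (hhl i) fun z hz =>
        (setLIntegral_le_lintegral _ _).trans (h1 z ((hzn z hz).trans_le (min_le_left _ _)))
    · refine (ENNReal.rpow_le_rpow_iff hp0).1 ?_
      rw [eLpNorm_rpow hp]
      exact hk.lintegral_mollify_sub_le hp.le (hHl i) fun z hz =>
        (setLIntegral_le_lintegral _ _).trans (h2 z ((hzn z hz).trans_le (min_le_right _ _)))
  choose k hk1 hk2 hk3 hk4 using key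
  have hsumχ : ∀ x ∈ Ω, ∑ i, P.χ i x = 1 := fun x hx => P.sum_eq_one x (subset_closure hx)
  -- the derivatives of the cut-off functions cancel in the sum
  have hsumgrad : ∀ x ∈ Ω, ∑ i, gradient (P.χ i) x = 0 := by
    intro x hx
    ext j
    have h1 : HasFDerivAt (fun y => ∑ i, P.χ i y) (∑ i, fderiv ℝ (P.χ i) x) x :=
      HasFDerivAt.fun_sum fun i _ => ((P.contDiff i).differentiable (by simp) x).hasFDerivAt
    have h2 : HasFDerivAt (fun y => ∑ i, P.χ i y) (0 : E[N] →L[ℝ] ℝ) x := by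
      refine (hasFDerivAt_const (1 : ℝ) x).congr_of_eventuallyEq ?_
      filter_upwards [hΩo.mem_nhds hx] with y hy using hsumχ y hy
    have h3 := DFunLike.congr_fun (h1.unique h2) (EuclideanSpace.single j 1)
    simpa [gradient_apply] using h3
  have hsum : (Fintype.card ι : ℝ≥0∞) * (ε / n) ≤ ε := by
    calc (Fintype.card ι : ℝ≥0∞) * (ε / n) ≤ n * (ε / n) := by
          gcongr
          exact le_self_add
      _ = ε := ENNReal.mul_div_cancel hn0 hn1
  refine ⟨fun x => ∑ i, mollify (k i) (h i) x, ContDiff.sum fun i _ => hk1 i, ?_, ?_⟩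
  · have h1 : eLpNorm (fun x => (∑ i, mollify (k i) (h i) x) - u x) (ENNReal.ofReal p)
        (volume.restrict Ω) = eLpNorm (∑ i, fun x => mollify (k i) (h i) x - h i x)
        (ENNReal.ofReal p) (volume.restrict Ω) := by
      refine eLpNorm_congr_ae ?_
      filter_upwards [ae_restrict_mem hΩm] with x hx
      rw [Finset.sum_apply, Finset.sum_sub_distrib]
      congr 1
      simp only [h, indicator_of_mem hx]
      rw [← Finset.sum_mul, hsumχ x hx, one_mul]
    rw [h1]
    refine (eLpNorm_sum_le (fun i _ => ?_) hp1).trans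
      ((Finset.sum_le_card_nsmul _ _ _ fun i _ => hk2 i).trans (by simpa using hsum))
    exact ((hk1 i).continuous.aestronglyMeasurable).sub (hh i hu).1.restrict
  · have h1 : eLpNorm (fun x => gradient (fun y => ∑ i, mollify (k i) (h i) y) x - G x)
        (ENNReal.ofReal p) (volume.restrict Ω) =
        eLpNorm (∑ i, fun x => mollify (k i) (H i) x - H i x)
        (ENNReal.ofReal p) (volume.restrict Ω) := by
      refine eLpNorm_congr_ae ?_
      filter_upwards [ae_restrict_mem hΩm] with x hx
      rw [Finset.sum_apply, Finset.sum_sub_distrib]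
      congr 1
      · have h2 : gradient (fun y => ∑ i, mollify (k i) (h i) y) x =
            ∑ i, gradient (mollify (k i) (h i)) x := by
          rw [gradient, fderiv_fun_sum fun i _ => (hk1 i).differentiable (by simp) x, map_sum]
          rfl
        rw [h2]
        exact Finset.sum_congr rfl fun i _ => hk4 i x hx
      · simp only [H, indicator_of_mem hx]
        rw [Finset.sum_add_distrib, ← Finset.sum_smul, hsumχ x hx, one_smul, ← Finset.smul_sum,
          hsumgrad x hx, smul_zero, add_zero]
    rw [h1]
    refine (eLpNorm_sum_le (fun i _ => ?_) hp1).trans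
      ((Finset.sum_le_card_nsmul _ _ _ fun i _ => hk3 i).trans (by simpa using hsum))
    have h2 : (fun x => mollify (k i) (H i) x) =ᵐ[volume.restrict Ω]
        gradient (mollify (k i) (h i)) := by
      filter_upwards [ae_restrict_mem hΩm] with x hx using (hk4 i x hx).symm
    exact ((continuous_gradient (hk1 i)).aestronglyMeasurable.congr h2.symm).sub
      (hH i hu hG).1.restrict

end Density

/-! ### Translation estimates and the trace inequality -/

section Translation

variable {N : ℕ} {Ω : Set (EuclideanSpace ℝ (Fin N))}

local notation "E[" n "]" => EuclideanSpace ℝ (Fin n)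

/-- Hölder's inequality against the constant function. -/
lemma lintegral_rpow_le_measure_univ {X : Type*} [MeasurableSpace X] {μ : Measure X} {p : ℝ}
    (hp : 1 ≤ p) {g : X → ℝ≥0∞} (hg : AEMeasurable g μ) :
    (∫⁻ x, g x ∂μ) ^ p ≤ μ univ ^ (p - 1) * ∫⁻ x, g x ^ p ∂μ := by
  have hp0 : 0 < p := by linarith
  have h := eLpNorm'_le_eLpNorm'_mul_rpow_measure_univ (f := g) one_pos hp hg.aestronglyMeasurable
  simp only [eLpNorm', enorm_eq_self, ENNReal.rpow_one, div_one] at h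
  have h2 := ENNReal.rpow_le_rpow h hp0.le
  rw [ENNReal.mul_rpow_of_nonneg _ _ hp0.le, ← ENNReal.rpow_mul, ← ENNReal.rpow_mul, one_div,
    inv_mul_cancel₀ hp0.ne', ENNReal.rpow_one, sub_mul, inv_mul_cancel₀ hp0.ne', one_mul,
    mul_comm] at h2
  exact h2

lemma enorm_fderiv_le (f : E[N] → ℝ) (x v : E[N]) :
    ‖fderiv ℝ f x v‖ₑ ≤ ‖v‖ₑ * ‖gradient f x‖ₑ := by
  have h1 : fderiv ℝ f x v = inner ℝ (gradient f x) v := by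
    rw [gradient, InnerProductSpace.toDual_symm_apply]
  rw [h1, mul_comm, ← ofReal_norm, ← ofReal_norm, ← ofReal_norm,
    ← ENNReal.ofReal_mul (norm_nonneg _)]
  exact ENNReal.ofReal_le_ofReal (norm_inner_le_norm _ _)

/-- The fundamental theorem of calculus along a segment. -/
lemma enorm_sub_le_lintegral_gradient {f : E[N] → ℝ} (hf : ContDiff ℝ ∞ f) (x v : E[N]) {s : ℝ}
    (hs : 0 ≤ s) :
    ‖f (x + s • v) - f x‖ₑ ≤ ‖v‖ₑ * ∫⁻ τ in Ioo 0 s, ‖gradient f (x + τ • v)‖ₑ := by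
  have hd : ∀ τ : ℝ, HasDerivAt (fun τ : ℝ => f (x + τ • v)) (fderiv ℝ f (x + τ • v) v) τ := by
    intro τ
    have h1 := (hf.differentiable (by simp) (x + τ • v)).hasFDerivAt
    have h2 : HasDerivAt (fun τ : ℝ => x + τ • v) v τ := by
      simpa using ((hasDerivAt_id τ).smul_const v).const_add x
    exact h1.comp_hasDerivAt τ h2
  have hc : Continuous fun τ : ℝ => fderiv ℝ f (x + τ • v) v := by
    have := hf.continuous_fderiv (by simp : (∞ : WithTop ℕ∞) ≠ 0)
    fun_prop
  have h1 := intervalIntegral.integral_eq_sub_of_hasDerivAt (fun τ _ => hd τ)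
    (hc.intervalIntegrable 0 s)
  rw [zero_smul, add_zero] at h1
  rw [← h1, intervalIntegral.integral_of_le hs, ← restrict_Ioo_eq_restrict_Ioc]
  refine (enorm_integral_le_lintegral_enorm _).trans ?_
  rw [← lintegral_const_mul']
  · exact lintegral_mono fun τ => enorm_fderiv_le f _ v
  · exact enorm_ne_top

lemma gradient_eq_zero_of_notMem_tsupport {f : E[N] → ℝ} {x : E[N]} (hx : x ∉ tsupport f) :
    gradient f x = 0 := by
  have h : fderiv ℝ f x = 0 := by
    by_contra h
    exact hx (support_fderiv_subset ℝ h)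
  rw [gradient, h, map_zero]

section Chart

variable {x₀ e : E[N]} {ρ s₀ η : ℝ} {C : ℝ≥0} {ψ : E[N] → ℝ}

/-- Functions supported in a chart vary little under translations along the inward cone. -/
lemma InwardChart.lintegral_translate_sub_le (hΩo : IsOpen Ω)
    (hch : InwardChart Ω x₀ e ρ s₀ η C) (hψ : ContDiff ℝ ∞ ψ)
    (hψs : tsupport ψ ⊆ Metric.ball x₀ ρ) {p : ℝ} (hp : 1 ≤ p) {t : ℝ} (ht : 0 < t)
    (hts : t ≤ s₀) {z : E[N]} (hz : z ∈ Metric.closedBall (-t • e) (t * η)) :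
    ∫⁻ x in Ω, ‖Ω.indicator ψ (x - z) - Ω.indicator ψ x‖ₑ ^ p ≤
      ‖z‖ₑ ^ p * ∫⁻ x in Ω, ‖gradient ψ x‖ₑ ^ p := by
  have hp0 : 0 < p := by linarith
  have hΩm := hΩo.measurableSet
  let g : E[N] → ℝ≥0∞ := Ω.indicator fun x => ‖gradient ψ x‖ₑ ^ p
  have hgc := continuous_gradient hψ
  have hgm : Measurable g := (hgc.enorm.measurable.pow_const p).indicator hΩm
  have hpt : ∀ x ∈ Ω, ‖Ω.indicator ψ (x - z) - Ω.indicator ψ x‖ₑ ^ p ≤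
      ‖z‖ₑ ^ p * ∫⁻ τ in Ioo (0 : ℝ) 1, g (x + τ • -z) := by
    intro x hx
    -- wherever `ψ` does not vanish, the translated point is in `Ω`
    have h1 : Ω.indicator ψ (x - z) = ψ (x + (1 : ℝ) • -z) := by
      rw [one_smul, ← sub_eq_add_neg]
      by_cases hmem : x - z ∈ Ω
      · rw [indicator_of_mem hmem]
      · rw [indicator_of_notMem hmem]
        by_contra h0
        exact hmem (hch.sub_mem hψs ht hts (subset_closure hx) hz
          (subset_tsupport ψ (Ne.symm h0)))
    rw [h1, indicator_of_mem hx]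
    have h2 := ENNReal.rpow_le_rpow (enorm_sub_le_lintegral_gradient hψ x (-z) zero_le_one) hp0.le
    rw [ENNReal.mul_rpow_of_nonneg _ _ hp0.le, enorm_neg] at h2
    refine h2.trans ?_
    gcongr
    have hm : Measurable fun τ : ℝ => ‖gradient ψ (x + τ • -z)‖ₑ :=
      (hgc.comp (by fun_prop : Continuous fun τ : ℝ => x + τ • -z)).enorm.measurable
    have h3 := lintegral_rpow_le_measure_univ (μ := volume.restrict (Ioo (0 : ℝ) 1)) hp
      hm.aemeasurable
    rw [Measure.restrict_apply_univ, Real.volume_Ioo, sub_zero, ENNReal.ofReal_one,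
      ENNReal.one_rpow, one_mul] at h3
    refine h3.trans (setLIntegral_mono' measurableSet_Ioo fun τ hτ => ?_)
    by_cases hmem : x + τ • -z ∈ Ω
    · simp only [g, indicator_of_mem hmem, le_refl]
    · rw [gradient_eq_zero_of_notMem_tsupport, enorm_zero, ENNReal.zero_rpow_of_pos hp0]
      · exact zero_le
      · intro hsupp
        rw [smul_neg, ← sub_eq_add_neg] at hmem hsupp
        refine hmem (hch.sub_mem (t := τ * t) hψs (mul_pos hτ.1 ht) ?_ (subset_closure hx) ?_ hsupp)
        · nlinarith [hτ.2]
        · rw [mem_closedBall_iff_norm] at hz ⊢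
          have h4 : τ • z - -(τ * t) • e = τ • (z - -t • e) := by
            rw [smul_sub, smul_smul]
            simp
          rw [h4, norm_smul, Real.norm_of_nonneg hτ.1.le, mul_assoc]
          exact mul_le_mul_of_nonneg_left hz hτ.1.le
  calc ∫⁻ x in Ω, ‖Ω.indicator ψ (x - z) - Ω.indicator ψ x‖ₑ ^ p
      ≤ ∫⁻ x in Ω, ‖z‖ₑ ^ p * ∫⁻ τ in Ioo (0 : ℝ) 1, g (x + τ • -z) :=
        setLIntegral_mono' hΩm hpt
    _ ≤ ∫⁻ x, ‖z‖ₑ ^ p * ∫⁻ τ in Ioo (0 : ℝ) 1, g (x + τ • -z) := setLIntegral_le_lintegral _ _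
    _ = ‖z‖ₑ ^ p * ∫⁻ x, ∫⁻ τ in Ioo (0 : ℝ) 1, g (x + τ • -z) :=
        lintegral_const_mul' _ _ (ENNReal.rpow_ne_top_of_nonneg hp0.le enorm_ne_top)
    _ = ‖z‖ₑ ^ p * ∫⁻ τ in Ioo (0 : ℝ) 1, ∫⁻ x, g (x + τ • -z) := by
        congr 1
        refine lintegral_lintegral_swap (Measurable.aemeasurable ?_)
        exact hgm.comp (by fun_prop : Measurable fun q : E[N] × ℝ => q.1 + q.2 • -z)
    _ = ‖z‖ₑ ^ p * ∫⁻ x in Ω, ‖gradient ψ x‖ₑ ^ p := by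
        simp only [lintegral_add_right_eq_self g]
        rw [lintegral_const, Measure.restrict_apply_univ, Real.volume_Ioo, sub_zero,
          ENNReal.ofReal_one, mul_one, lintegral_indicator hΩm]

/-- The trace inequality in a chart: integrate the fundamental theorem of calculus along the inward
direction. -/
lemma InwardChart.lintegral_surfaceMeasure_le
    (hch : InwardChart Ω x₀ e ρ s₀ η C) (hψ : ContDiff ℝ ∞ ψ)
    (hψs : tsupport ψ ⊆ Metric.ball x₀ ρ) {p : ℝ} (hp : 1 ≤ p) {δ : ℝ} (hδ : 0 < δ)
    (hδs : δ ≤ s₀) :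
    ∫⁻ x, ‖ψ x‖ₑ ^ p ∂(surfaceMeasure Ω) ≤ 2 ^ (p - 1) * C *
      ((ENNReal.ofReal δ)⁻¹ * ∫⁻ x in Ω, ‖ψ x‖ₑ ^ p) + 2 ^ (p - 1) * C *
      (ENNReal.ofReal δ ^ (p - 1) * ∫⁻ x in Ω, ‖gradient ψ x‖ₑ ^ p) := by
  have hp0 : 0 < p := by linarith
  have hgc := continuous_gradient hψ
  set D := ENNReal.ofReal δ with hD
  have hD0 : D ≠ 0 := by simpa [hD] using hδ
  have hDt : D ≠ ⊤ := ENNReal.ofReal_ne_top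
  have h2t : (2 : ℝ≥0∞) ^ (p - 1) ≠ ⊤ := ENNReal.rpow_ne_top_of_nonneg (by linarith) (by simp)
  let I : E[N] → ℝ≥0∞ := fun x => ∫⁻ s in Ioo 0 s₀, ‖ψ (x + s • e)‖ₑ ^ p
  let J : E[N] → ℝ≥0∞ := fun x => ∫⁻ s in Ioo 0 s₀, ‖gradient ψ (x + s • e)‖ₑ ^ p
  have hpt : ∀ x, ‖ψ x‖ₑ ^ p ≤ 2 ^ (p - 1) * (D⁻¹ * I x) + 2 ^ (p - 1) * (D ^ (p - 1) * J x) := by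
    intro x
    have hm : Measurable fun τ : ℝ => ‖gradient ψ (x + τ • e)‖ₑ :=
      (hgc.comp (by fun_prop : Continuous fun τ : ℝ => x + τ • e)).enorm.measurable
    have h1 : ∀ s ∈ Ioo 0 δ, ‖ψ x‖ₑ ^ p ≤
        2 ^ (p - 1) * ‖ψ (x + s • e)‖ₑ ^ p + 2 ^ (p - 1) * (D ^ (p - 1) * J x) := by
      intro s hs
      have h2 : ‖ψ x‖ₑ ≤ ‖ψ (x + s • e)‖ₑ + ‖ψ (x + s • e) - ψ x‖ₑ := by
        calc ‖ψ x‖ₑ = ‖ψ (x + s • e) - (ψ (x + s • e) - ψ x)‖ₑ := by rw [sub_sub_cancel]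
          _ ≤ _ := enorm_sub_le
      have h3 := enorm_sub_le_lintegral_gradient hψ x e hs.1.le
      have he1 : ‖e‖ₑ = 1 := by rw [← ofReal_norm, hch.norm_e, ENNReal.ofReal_one]
      rw [he1, one_mul] at h3
      have h4 : ‖ψ (x + s • e) - ψ x‖ₑ ^ p ≤ D ^ (p - 1) * J x := by
        calc ‖ψ (x + s • e) - ψ x‖ₑ ^ p
            ≤ (∫⁻ τ in Ioo 0 δ, ‖gradient ψ (x + τ • e)‖ₑ) ^ p :=
              ENNReal.rpow_le_rpow (h3.trans
                (lintegral_mono_set (Ioo_subset_Ioo_right hs.2.le))) hp0.le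
          _ ≤ D ^ (p - 1) * ∫⁻ τ in Ioo 0 δ, ‖gradient ψ (x + τ • e)‖ₑ ^ p := by
              refine (lintegral_rpow_le_measure_univ hp hm.aemeasurable).trans (le_of_eq ?_)
              rw [Measure.restrict_apply_univ, Real.volume_Ioo, sub_zero]
          _ ≤ D ^ (p - 1) * J x := by
              gcongr
              exact lintegral_mono_set (Ioo_subset_Ioo_right hδs)
      calc ‖ψ x‖ₑ ^ p ≤ (‖ψ (x + s • e)‖ₑ + ‖ψ (x + s • e) - ψ x‖ₑ) ^ p :=
            ENNReal.rpow_le_rpow h2 hp0.le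
        _ ≤ 2 ^ (p - 1) * (‖ψ (x + s • e)‖ₑ ^ p + ‖ψ (x + s • e) - ψ x‖ₑ ^ p) :=
            ENNReal.rpow_add_le_mul_rpow_add_rpow _ _ hp
        _ ≤ _ := by
            rw [mul_add]
            gcongr
    -- average over `s`
    have h5 : D * ‖ψ x‖ₑ ^ p ≤ 2 ^ (p - 1) * I x + D * (2 ^ (p - 1) * (D ^ (p - 1) * J x)) := by
      calc D * ‖ψ x‖ₑ ^ p = ∫⁻ _ in Ioo 0 δ, ‖ψ x‖ₑ ^ p := by
            rw [setLIntegral_const, Real.volume_Ioo, sub_zero, mul_comm]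
        _ ≤ ∫⁻ s in Ioo 0 δ, (2 ^ (p - 1) * ‖ψ (x + s • e)‖ₑ ^ p +
              2 ^ (p - 1) * (D ^ (p - 1) * J x)) := setLIntegral_mono' measurableSet_Ioo h1
        _ = 2 ^ (p - 1) * (∫⁻ s in Ioo 0 δ, ‖ψ (x + s • e)‖ₑ ^ p) +
              D * (2 ^ (p - 1) * (D ^ (p - 1) * J x)) := by
            rw [lintegral_add_right _ measurable_const, lintegral_const_mul' _ _ h2t,
              setLIntegral_const, Real.volume_Ioo, sub_zero, mul_comm D]
        _ ≤ _ := by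
            gcongr
            exact lintegral_mono_set (Ioo_subset_Ioo_right hδs)
    calc ‖ψ x‖ₑ ^ p = D⁻¹ * (D * ‖ψ x‖ₑ ^ p) := by
          rw [← mul_assoc, ENNReal.inv_mul_cancel hD0 hDt, one_mul]
      _ ≤ D⁻¹ * (2 ^ (p - 1) * I x + D * (2 ^ (p - 1) * (D ^ (p - 1) * J x))) := by gcongr
      _ = _ := by
          rw [mul_add, ← mul_assoc D⁻¹ D, ENNReal.inv_mul_cancel hD0 hDt, one_mul,
            mul_left_comm]
  have hI := hch.lintegral_le (fun x => ‖ψ x‖ₑ ^ p)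
    (hψ.continuous.enorm.measurable.pow_const p)
  have hJ := hch.lintegral_le (fun x => ‖gradient ψ x‖ₑ ^ p) (hgc.enorm.measurable.pow_const p)
  have hIm : Measurable I := by
    refine Measurable.lintegral_prod_right' (f := fun q : E[N] × ℝ => ‖ψ (q.1 + q.2 • e)‖ₑ ^ p) ?_
    exact (hψ.continuous.enorm.measurable.pow_const p).comp
      (by fun_prop : Measurable fun q : E[N] × ℝ => q.1 + q.2 • e)
  have hball : ∫⁻ x, ‖ψ x‖ₑ ^ p ∂(surfaceMeasure Ω) =
      ∫⁻ x in Metric.ball x₀ (2 * ρ), ‖ψ x‖ₑ ^ p ∂(surfaceMeasure Ω) := by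
    rw [← lintegral_indicator Metric.isOpen_ball.measurableSet]
    refine lintegral_congr fun x => ?_
    by_cases hx : x ∈ Metric.ball x₀ (2 * ρ)
    · rw [indicator_of_mem hx]
    · have h0 : ψ x = 0 := by
        by_contra h0
        refine hx (Metric.ball_subset_ball ?_ (hψs (subset_tsupport ψ h0)))
        linarith [hch.rho_pos]
      rw [indicator_of_notMem hx, h0, enorm_zero, ENNReal.zero_rpow_of_pos hp0]
  rw [hball]
  have hDp : D ^ (p - 1) ≠ ⊤ := ENNReal.rpow_ne_top_of_nonneg (by linarith) hDt
  calc ∫⁻ x in Metric.ball x₀ (2 * ρ), ‖ψ x‖ₑ ^ p ∂(surfaceMeasure Ω)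
      ≤ ∫⁻ x in Metric.ball x₀ (2 * ρ), (2 ^ (p - 1) * (D⁻¹ * I x) +
          2 ^ (p - 1) * (D ^ (p - 1) * J x)) ∂(surfaceMeasure Ω) := lintegral_mono fun x => hpt x
    _ = 2 ^ (p - 1) * (D⁻¹ * ∫⁻ x in Metric.ball x₀ (2 * ρ), I x ∂(surfaceMeasure Ω)) +
        2 ^ (p - 1) * (D ^ (p - 1) *
          ∫⁻ x in Metric.ball x₀ (2 * ρ), J x ∂(surfaceMeasure Ω)) := by
        rw [lintegral_add_left ((hIm.const_mul _).const_mul _), lintegral_const_mul' _ _ h2t,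
          lintegral_const_mul' _ _ (ENNReal.inv_ne_top.2 hD0), lintegral_const_mul' _ _ h2t,
          lintegral_const_mul' _ _ hDp]
    _ ≤ 2 ^ (p - 1) * (D⁻¹ * (C * ∫⁻ x in Ω, ‖ψ x‖ₑ ^ p)) +
        2 ^ (p - 1) * (D ^ (p - 1) * (C * ∫⁻ x in Ω, ‖gradient ψ x‖ₑ ^ p)) := by
        gcongr
    _ = _ := by ring

end Chart

lemma gradient_mul {f g : E[N] → ℝ} (hf : ContDiff ℝ ∞ f) (hg : ContDiff ℝ ∞ g) (x : E[N]) :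
    gradient (fun y => f y * g y) x = f x • gradient g x + g x • gradient f x := by
  have d1 := (hf.differentiable (by simp) x).hasFDerivAt
  have d2 := (hg.differentiable (by simp) x).hasFDerivAt
  rw [gradient, (d1.fun_mul d2).fderiv, map_add]
  simp [gradient]

/-- The `p`-th power of the Sobolev norm of a smooth function on `Ω`. -/
noncomputable def sobolevEnergy (Ω : Set E[N]) (p : ℝ) (φ : E[N] → ℝ) : ℝ≥0∞ :=
  (∫⁻ x in Ω, ‖φ x‖ₑ ^ p) + ∫⁻ x in Ω, ‖gradient φ x‖ₑ ^ p

variable {ι : Type} [Fintype ι]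

lemma InwardPartition.hasCompactSupport (P : InwardPartition Ω ι) (i : ι) :
    HasCompactSupport (P.χ i) :=
  hasCompactSupport_of_tsupport_subset_ball (P.tsupport_subset i)

/-- Cutting off is bounded for the Sobolev norm. -/
lemma InwardPartition.exists_sobolevEnergy_mul_le (P : InwardPartition Ω ι) {p : ℝ} (hp : 1 ≤ p) :
    ∃ K : ℝ≥0, ∀ i, ∀ φ : E[N] → ℝ, ContDiff ℝ ∞ φ →
      ∫⁻ x in Ω, ‖P.χ i x * φ x‖ₑ ^ p ≤ K * ∫⁻ x in Ω, ‖φ x‖ₑ ^ p ∧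
      ∫⁻ x in Ω, ‖gradient (fun y => P.χ i y * φ y) x‖ₑ ^ p ≤ K * sobolevEnergy Ω p φ := by
  have hp0 : 0 < p := by linarith
  have hbd : ∀ i, ∃ M : ℝ≥0, ∀ x, ‖P.χ i x‖ₑ ≤ M ∧ ‖gradient (P.χ i) x‖ₑ ≤ M := by
    intro i
    obtain ⟨M₁, h1⟩ := (P.contDiff i).continuous.bounded_above_of_compact_support
      (P.hasCompactSupport i)
    have hgs : HasCompactSupport (gradient (P.χ i)) :=
      ((P.hasCompactSupport i).fderiv (𝕜 := ℝ)).comp_left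
        (g := (InnerProductSpace.toDual ℝ E[N]).symm) (map_zero _)
    obtain ⟨M₂, h2⟩ := (continuous_gradient (P.contDiff i)).bounded_above_of_compact_support hgs
    refine ⟨Real.toNNReal (max M₁ M₂), fun x => ⟨?_, ?_⟩⟩
    · rw [← ofReal_norm]
      exact ENNReal.ofReal_le_ofReal ((h1 x).trans (le_max_left _ _))
    · rw [← ofReal_norm]
      exact ENNReal.ofReal_le_ofReal ((h2 x).trans (le_max_right _ _))
  choose M hM using hbd
  let Mt : ℝ≥0 := ∑ i, M i
  have hMt : ∀ i, M i ≤ Mt := fun i => Finset.single_le_sum (fun j _ => zero_le) (Finset.mem_univ i)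
  let K₁ : ℝ≥0 := Mt ^ p
  let K₂ : ℝ≥0 := 2 ^ (p - 1) * Mt ^ p
  have hK₁ : (K₁ : ℝ≥0∞) = (Mt : ℝ≥0∞) ^ p := ENNReal.coe_rpow_of_nonneg _ hp0.le
  have hK₂ : (K₂ : ℝ≥0∞) = 2 ^ (p - 1) * (Mt : ℝ≥0∞) ^ p := by
    simp only [K₂, ENNReal.coe_mul]
    rw [ENNReal.coe_rpow_of_nonneg _ hp0.le, ENNReal.coe_rpow_of_nonneg _ (by linarith)]
    rfl
  refine ⟨max K₁ K₂, fun i φ hφ => ⟨?_, ?_⟩⟩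
  · calc ∫⁻ x in Ω, ‖P.χ i x * φ x‖ₑ ^ p ≤ ∫⁻ x in Ω, (K₁ : ℝ≥0∞) * ‖φ x‖ₑ ^ p := by
          refine lintegral_mono fun x => ?_
          rw [enorm_mul, ENNReal.mul_rpow_of_nonneg _ _ hp0.le, hK₁]
          gcongr
          exact (hM i x).1.trans (by exact_mod_cast hMt i)
      _ = K₁ * ∫⁻ x in Ω, ‖φ x‖ₑ ^ p := lintegral_const_mul' _ _ ENNReal.coe_ne_top
      _ ≤ _ := by
          gcongr
          exact le_max_left _ _
  · have hφm : Measurable fun x => ‖φ x‖ₑ ^ p := hφ.continuous.enorm.measurable.pow_const p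
    calc ∫⁻ x in Ω, ‖gradient (fun y => P.χ i y * φ y) x‖ₑ ^ p
        ≤ ∫⁻ x in Ω, (K₂ : ℝ≥0∞) * (‖φ x‖ₑ ^ p + ‖gradient φ x‖ₑ ^ p) := by
          refine lintegral_mono fun x => ?_
          simp only
          have h1 : ‖gradient (fun y => P.χ i y * φ y) x‖ₑ ≤
              Mt * ‖φ x‖ₑ + Mt * ‖gradient φ x‖ₑ := by
            rw [gradient_mul (P.contDiff i) hφ]
            refine (enorm_add_le _ _).trans ?_
            rw [enorm_smul, enorm_smul, add_comm, mul_comm ‖φ x‖ₑ]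
            gcongr
            · exact (hM i x).2.trans (by exact_mod_cast hMt i)
            · exact (hM i x).1.trans (by exact_mod_cast hMt i)
          refine (ENNReal.rpow_le_rpow h1 hp0.le).trans
            ((ENNReal.rpow_add_le_mul_rpow_add_rpow _ _ hp).trans (le_of_eq ?_))
          rw [ENNReal.mul_rpow_of_nonneg _ _ hp0.le, ENNReal.mul_rpow_of_nonneg _ _ hp0.le, hK₂]
          ring
      _ = K₂ * sobolevEnergy Ω p φ := by
          rw [lintegral_const_mul' _ _ ENNReal.coe_ne_top, lintegral_add_left hφm]
          rfl
      _ ≤ _ := by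
          gcongr
          exact le_max_right _ _

/-- The trace inequality, with a small constant in front of the gradient term. -/
theorem InwardPartition.exists_trace_le (P : InwardPartition Ω ι) {p : ℝ} (hp : 1 < p)
    {ε : ℝ≥0} (hε : 0 < ε) : ∃ K : ℝ≥0, ∀ φ : E[N] → ℝ, ContDiff ℝ ∞ φ →
      ∫⁻ x, ‖φ x‖ₑ ^ p ∂(surfaceMeasure Ω) ≤
        ε * (∫⁻ x in Ω, ‖gradient φ x‖ₑ ^ p) + K * ∫⁻ x in Ω, ‖φ x‖ₑ ^ p := by
  have hp0 : 0 < p := by linarith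
  obtain ⟨K, hK⟩ := P.exists_sobolevEnergy_mul_le hp.le
  let n : ℝ≥0 := Fintype.card ι
  let c : ι → ℝ≥0 := fun i => n ^ (p - 1) * (2 ^ (p - 1) * P.C i * K)
  -- the width `δ` of the strip is such that the constant in front of the gradient is at most `ε`
  have hδ : ∃ δ : ℝ≥0, 0 < δ ∧ (∀ i, (δ : ℝ) ≤ P.s₀ i) ∧ (∑ i, c i) * δ ^ (p - 1) ≤ ε := by
    have hcont : Tendsto (fun δ : ℝ≥0 => (∑ i, c i) * δ ^ (p - 1)) (𝓝 0) (𝓝 0) := by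
      have h1 : Continuous fun δ : ℝ≥0 => (∑ i, c i) * δ ^ (p - 1) :=
        continuous_const.mul (NNReal.continuous_rpow_const (by linarith))
      have h2 := h1.tendsto 0
      rwa [NNReal.zero_rpow (by linarith), mul_zero] at h2
    have hs : ∀ᶠ δ : ℝ≥0 in 𝓝 0, ∀ i, (δ : ℝ) ≤ P.s₀ i := by
      refine eventually_all.2 fun i => ?_
      have h1 : Tendsto (fun δ : ℝ≥0 => (δ : ℝ)) (𝓝 0) (𝓝 ((0 : ℝ≥0) : ℝ)) :=
        NNReal.continuous_coe.tendsto 0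
      have h2 : ((0 : ℝ≥0) : ℝ) < P.s₀ i := (P.chart i).s_pos
      exact (h1.eventually (gt_mem_nhds h2)).mono fun δ h => h.le
    have hev := hs.and (hcont.eventually (gt_mem_nhds hε))
    have h0 : ∀ᶠ δ : ℝ≥0 in 𝓝[>] 0, 0 < δ := self_mem_nhdsWithin
    obtain ⟨δ, hδ0, hδ1, hδ2⟩ := (h0.and (hev.filter_mono nhdsWithin_le_nhds)).exists
    exact ⟨δ, hδ0, hδ1, hδ2.le⟩
  obtain ⟨δ, hδ0, hδs, hδε⟩ := hδ
  let K' : ℝ≥0 := (∑ i, c i) * δ⁻¹ + ε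
  refine ⟨K', fun φ hφ => ?_⟩
  have hsupp : ∀ i, tsupport (fun y => P.χ i y * φ y) ⊆ Metric.ball (P.x₀ i) (P.ρ i) := fun i =>
    (tsupport_mul_subset_left).trans (P.tsupport_subset i)
  have hsm : ∀ i, ContDiff ℝ ∞ fun y => P.χ i y * φ y := fun i => (P.contDiff i).mul hφ
  have hsum : ∀ᵐ x ∂(surfaceMeasure Ω), ‖φ x‖ₑ ^ p ≤
      (n : ℝ≥0∞) ^ (p - 1) * ∑ i, ‖P.χ i x * φ x‖ₑ ^ p := by
    have hmem : ∀ᵐ x ∂(surfaceMeasure Ω), x ∈ frontier Ω :=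
      ae_restrict_mem isClosed_frontier.measurableSet
    filter_upwards [hmem] with x hx
    have h1 : φ x = ∑ i, P.χ i x * φ x := by
      rw [← Finset.sum_mul, P.sum_eq_one x (frontier_subset_closure hx), one_mul]
    calc ‖φ x‖ₑ ^ p = ‖∑ i, P.χ i x * φ x‖ₑ ^ p := by rw [← h1]
      _ ≤ (∑ i, ‖P.χ i x * φ x‖ₑ) ^ p := by
          gcongr
          exact enorm_sum_le _ _
      _ ≤ _ := by
          have := ENNReal.rpow_sum_le_const_mul_sum_rpow Finset.univ
            (fun i => ‖P.χ i x * φ x‖ₑ) hp.le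
          simpa [n] using this
  set A := ∫⁻ x in Ω, ‖φ x‖ₑ ^ p with hA
  set B := ∫⁻ x in Ω, ‖gradient φ x‖ₑ ^ p with hB
  have hδe : ENNReal.ofReal δ = (δ : ℝ≥0∞) := ENNReal.ofReal_coe_nnreal
  have h2e : (2 : ℝ≥0∞) ^ (p - 1) = ((2 ^ (p - 1) : ℝ≥0) : ℝ≥0∞) := by
    rw [ENNReal.coe_rpow_of_nonneg _ (by linarith)]
    rfl
  have hne : (n : ℝ≥0∞) ^ (p - 1) = ((n ^ (p - 1) : ℝ≥0) : ℝ≥0∞) :=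
    (ENNReal.coe_rpow_of_nonneg _ (by linarith)).symm
  have hde : (δ : ℝ≥0∞) ^ (p - 1) = ((δ ^ (p - 1) : ℝ≥0) : ℝ≥0∞) :=
    (ENNReal.coe_rpow_of_nonneg _ (by linarith)).symm
  have hdi : (δ : ℝ≥0∞)⁻¹ = ((δ⁻¹ : ℝ≥0) : ℝ≥0∞) := (ENNReal.coe_inv hδ0.ne').symm
  have hloc : ∀ i, (n : ℝ≥0∞) ^ (p - 1) * ∫⁻ x, ‖P.χ i x * φ x‖ₑ ^ p ∂(surfaceMeasure Ω) ≤
      ((c i * δ⁻¹ : ℝ≥0) : ℝ≥0∞) * A + ((c i * δ ^ (p - 1) : ℝ≥0) : ℝ≥0∞) * (A + B) := by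
    intro i
    have h1 := (P.chart i).lintegral_surfaceMeasure_le (hsm i) (hsupp i) hp.le
      (NNReal.coe_pos.2 hδ0) (hδs i)
    rw [hδe, h2e, hdi, hde] at h1
    obtain ⟨h2, h3⟩ := hK i φ hφ
    rw [hne]
    calc _ ≤ ((n ^ (p - 1) : ℝ≥0) : ℝ≥0∞) *
          (((2 ^ (p - 1) : ℝ≥0) : ℝ≥0∞) * P.C i * (((δ⁻¹ : ℝ≥0) : ℝ≥0∞) * (K * A)) +
          ((2 ^ (p - 1) : ℝ≥0) : ℝ≥0∞) * P.C i *
            (((δ ^ (p - 1) : ℝ≥0) : ℝ≥0∞) * (K * (A + B)))) := by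
          refine mul_le_mul' le_rfl (h1.trans (add_le_add ?_ ?_))
          · gcongr
          · gcongr
            exact h3
      _ = _ := by
          simp only [c, ENNReal.coe_mul]
          ring
  calc ∫⁻ x, ‖φ x‖ₑ ^ p ∂(surfaceMeasure Ω)
      ≤ ∫⁻ x, (n : ℝ≥0∞) ^ (p - 1) * ∑ i, ‖P.χ i x * φ x‖ₑ ^ p ∂(surfaceMeasure Ω) :=
        lintegral_mono_ae hsum
    _ = ∑ i, (n : ℝ≥0∞) ^ (p - 1) * ∫⁻ x, ‖P.χ i x * φ x‖ₑ ^ p ∂(surfaceMeasure Ω) := by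
        rw [lintegral_const_mul' _ _ (by rw [hne]; exact ENNReal.coe_ne_top),
          lintegral_finsetSum _ fun i _ => (hsm i).continuous.enorm.measurable.pow_const p,
          Finset.mul_sum]
    _ ≤ ∑ i, (((c i * δ⁻¹ : ℝ≥0) : ℝ≥0∞) * A +
          ((c i * δ ^ (p - 1) : ℝ≥0) : ℝ≥0∞) * (A + B)) := Finset.sum_le_sum fun i _ => hloc i
    _ = (((∑ i, c i) * δ⁻¹ : ℝ≥0) : ℝ≥0∞) * A +
          (((∑ i, c i) * δ ^ (p - 1) : ℝ≥0) : ℝ≥0∞) * (A + B) := by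
        rw [Finset.sum_add_distrib, ← Finset.sum_mul, ← Finset.sum_mul]
        push_cast [Finset.sum_mul]
        rfl
    _ ≤ (((∑ i, c i) * δ⁻¹ : ℝ≥0) : ℝ≥0∞) * A + (ε : ℝ≥0∞) * (A + B) := by
        gcongr
    _ = (ε : ℝ≥0∞) * B + (K' : ℝ≥0∞) * A := by
        simp only [K', ENNReal.coe_add]
        ring

end Translation

/-! ### Compactness in `L^p` -/

section Rellich

variable {N : ℕ} {Ω : Set (EuclideanSpace ℝ (Fin N))} {ι : Type} [Fintype ι]

local notation "E[" n "]" => EuclideanSpace ℝ (Fin n)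

lemma memLp_of_continuous {F : Type*} [NormedAddCommGroup F] [SecondCountableTopology F]
    (hb : Bornology.IsBounded Ω) {μ : Measure E[N]} [IsFiniteMeasure μ]
    (hμ : ∀ᵐ x ∂μ, x ∈ closure Ω)
    {f : E[N] → F} (hf : Continuous f) (q : ℝ≥0∞) : MemLp f q μ := by
  obtain ⟨M, hM⟩ := (hb.isCompact_closure.image hf).isBounded.exists_norm_le
  refine MemLp.of_bound hf.aestronglyMeasurable M ?_
  filter_upwards [hμ] with x hx
  exact hM _ ⟨x, hx, rfl⟩

lemma ae_mem_closure_volume (hΩo : IsOpen Ω) : ∀ᵐ x ∂(volume.restrict Ω), x ∈ closure Ω :=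
  (ae_restrict_mem hΩo.measurableSet).mono fun _ hx => subset_closure hx

lemma ae_mem_closure_surfaceMeasure : ∀ᵐ x ∂(surfaceMeasure Ω), x ∈ closure Ω :=
  (ae_restrict_mem isClosed_frontier.measurableSet).mono fun _ hx => frontier_subset_closure hx

/-- The smoothing operator given by a partition of unity and mollifying kernels. -/
noncomputable def InwardPartition.smooth (P : InwardPartition Ω ι) (k : ι → E[N] → ℝ)
    (φ : E[N] → ℝ) (x : E[N]) : ℝ :=
  ∑ i, mollify (k i) (Ω.indicator fun y => P.χ i y * φ y) x

lemma InwardPartition.integrable_indicator_mul (P : InwardPartition Ω ι) (hΩo : IsOpen Ω)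
    (hb : Bornology.IsBounded Ω) (i : ι) {φ : E[N] → ℝ} (hφ : Continuous φ) :
    Integrable (Ω.indicator fun y => P.χ i y * φ y) := by
  have : IsFiniteMeasure (volume.restrict Ω) := isFiniteMeasure_restrict.2 hb.measure_lt_top.ne
  rw [← memLp_one_iff_integrable]
  exact memLp_indicator_mul hΩo.measurableSet (P.contDiff i).continuous (P.hasCompactSupport i)
    (memLp_of_continuous hb (ae_mem_closure_volume hΩo) hφ _)

/-- Smoothing is close to the identity, uniformly on bounded sets of the Sobolev space. -/
lemma InwardPartition.exists_smooth_sub_le (P : InwardPartition Ω ι) (hΩo : IsOpen Ω)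
    (hb : Bornology.IsBounded Ω) {p : ℝ} (hp : 1 < p) (M : ℝ≥0) {ε : ℝ≥0} (hε : 0 < ε) :
    ∃ k : ι → E[N] → ℝ, (∀ i, ∃ c r, IsMollifier (k i) c r) ∧ ∀ φ : E[N] → ℝ, ContDiff ℝ ∞ φ →
      sobolevEnergy Ω p φ ≤ M →
      eLpNorm (fun x => P.smooth k φ x - φ x) (ENNReal.ofReal p) (volume.restrict Ω) ≤ ε := by
  have hp0 : 0 < p := by linarith
  have hp1 : 1 ≤ ENNReal.ofReal p := by simpa using hp.le
  have hΩm := hΩo.measurableSet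
  obtain ⟨K, hK⟩ := P.exists_sobolevEnergy_mul_le hp.le
  let n : ℝ≥0 := Fintype.card ι + 1
  have hn : 0 < n := by positivity
  obtain ⟨θ, hθ0, hθ⟩ : ∃ θ : ℝ≥0, 0 < θ ∧ θ ^ p * (K * M) ≤ (ε / n) ^ p := by
    have h1 : Continuous fun θ : ℝ≥0 => θ ^ p * (K * M) :=
      (NNReal.continuous_rpow_const hp0.le).mul continuous_const
    have h2 := h1.tendsto 0
    rw [NNReal.zero_rpow hp0.ne', zero_mul] at h2
    have h3 : 0 < (ε / n) ^ p := NNReal.rpow_pos (div_pos hε hn)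
    have h0 : ∀ᶠ θ : ℝ≥0 in 𝓝[>] 0, 0 < θ := self_mem_nhdsWithin
    obtain ⟨θ, hθ0, hθ⟩ :=
      (h0.and ((h2.eventually (gt_mem_nhds h3)).filter_mono nhdsWithin_le_nhds)).exists
    exact ⟨θ, hθ0, hθ.le⟩
  have key : ∀ i, ∃ k : E[N] → ℝ, (∃ c r, IsMollifier k c r) ∧
      ∀ φ : E[N] → ℝ, ContDiff ℝ ∞ φ → sobolevEnergy Ω p φ ≤ M →
      eLpNorm (fun x => mollify k (Ω.indicator fun y => P.χ i y * φ y) x -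
        Ω.indicator (fun y => P.χ i y * φ y) x) (ENNReal.ofReal p) (volume.restrict Ω) ≤
        (ε / n : ℝ≥0) := by
    intro i
    have hch := P.chart i
    have hη1 : 0 < 1 + P.η i := by linarith [hch.eta_pos]
    let t : ℝ := min (P.s₀ i) (θ / (1 + P.η i))
    have ht : 0 < t := lt_min hch.s_pos (div_pos (NNReal.coe_pos.2 hθ0) hη1)
    obtain ⟨k, hk⟩ := exists_isMollifier (-t • P.e i) (mul_pos ht hch.eta_pos)
    have hzn : ∀ z ∈ Metric.closedBall (-t • P.e i) (t * P.η i), ‖z‖ₑ ≤ θ := by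
      intro z hz
      rw [mem_closedBall_iff_norm] at hz
      have h3 : t ≤ θ / (1 + P.η i) := min_le_right _ _
      rw [le_div_iff₀ hη1] at h3
      have h4 : ‖z‖ ≤ θ := by
        calc ‖z‖ = ‖(z - -t • P.e i) + -t • P.e i‖ := by rw [sub_add_cancel]
          _ ≤ t * P.η i + t * 1 := by
              refine (norm_add_le _ _).trans (add_le_add hz ?_)
              rw [norm_smul, norm_neg, Real.norm_of_nonneg ht.le, hch.norm_e]
          _ = t * (1 + P.η i) := by ring
          _ ≤ _ := h3
      rw [← ofReal_norm]
      simpa using ENNReal.ofReal_le_ofReal h4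
    refine ⟨k, ⟨_, _, hk⟩, fun φ hφ hφM => ?_⟩
    refine (ENNReal.rpow_le_rpow_iff hp0).1 ?_
    rw [eLpNorm_rpow hp]
    refine hk.lintegral_mollify_sub_le hp.le
      (P.integrable_indicator_mul hΩo hb i hφ.continuous).locallyIntegrable fun z hz => ?_
    refine (hch.lintegral_translate_sub_le hΩo ((P.contDiff i).mul hφ)
      ((tsupport_mul_subset_left).trans (P.tsupport_subset i)) hp.le ht (min_le_left _ _)
      hz).trans ?_
    calc _ ≤ (θ : ℝ≥0∞) ^ p * (K * M) := by
          refine mul_le_mul' (ENNReal.rpow_le_rpow (hzn z hz) hp0.le) ?_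
          exact ((hK i φ hφ).2).trans (by gcongr)
      _ = ((θ ^ p * (K * M) : ℝ≥0) : ℝ≥0∞) := by
          rw [ENNReal.coe_mul, ENNReal.coe_mul, ENNReal.coe_rpow_of_nonneg _ hp0.le]
      _ ≤ _ := by
          rw [← ENNReal.coe_rpow_of_nonneg _ hp0.le]
          exact_mod_cast hθ
  choose k hk1 hk2 using key
  refine ⟨k, hk1, fun φ hφ hφM => ?_⟩
  have h1 : eLpNorm (fun x => P.smooth k φ x - φ x) (ENNReal.ofReal p) (volume.restrict Ω) =
      eLpNorm (∑ i, fun x => mollify (k i) (Ω.indicator fun y => P.χ i y * φ y) x -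
        Ω.indicator (fun y => P.χ i y * φ y) x) (ENNReal.ofReal p) (volume.restrict Ω) := by
    refine eLpNorm_congr_ae ?_
    filter_upwards [ae_restrict_mem hΩm] with x hx
    rw [Finset.sum_apply, Finset.sum_sub_distrib]
    unfold InwardPartition.smooth
    congr 1
    simp only [indicator_of_mem hx]
    rw [← Finset.sum_mul, P.sum_eq_one x (subset_closure hx), one_mul]
  rw [h1]
  refine (eLpNorm_sum_le (fun i _ => ?_) hp1).trans
    ((Finset.sum_le_card_nsmul _ _ _ fun i _ => hk2 i φ hφ hφM).trans ?_)
  · obtain ⟨c, r, hk⟩ := hk1 i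
    have h2 := P.integrable_indicator_mul hΩo hb i hφ.continuous
    exact ((hk.contDiff_mollify h2.locallyIntegrable).continuous.aestronglyMeasurable).sub
      h2.aestronglyMeasurable.restrict
  · rw [nsmul_eq_mul, Finset.card_univ]
    have h3 : (Fintype.card ι : ℝ≥0) * (ε / n) ≤ ε := by
      calc (Fintype.card ι : ℝ≥0) * (ε / n) ≤ n * (ε / n) := by
            gcongr
            exact le_self_add
        _ = ε := mul_div_cancel₀ _ hn.ne'
    exact_mod_cast h3

lemma IsMollifier.mollify_eq {k : E[N] → ℝ} (h : E[N] → ℝ) (x : E[N]) :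
    mollify k h x = ∫ y, k (x - y) * h y := by
  rw [← integral_sub_left_eq_self _ volume x]
  simp [mollify]

/-- Mollifications of functions that are bounded in `L^1` are bounded and equi-Lipschitz. -/
lemma IsMollifier.exists_mollify_bounds {k : E[N] → ℝ} {c : E[N]} {r : ℝ}
    (hk : IsMollifier k c r) (Q : ℝ) : ∃ L : ℝ, 0 ≤ L ∧ ∀ h : E[N] → ℝ, Integrable h →
      ∫ y, ‖h y‖ ≤ Q → (∀ x, |mollify k h x| ≤ L) ∧
        ∀ x x', |mollify k h x - mollify k h x'| ≤ L * ‖x - x'‖ := by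
  obtain ⟨B, hB⟩ := hk.contDiff.continuous.bounded_above_of_compact_support hk.hasCompactSupport
  obtain ⟨D, hD⟩ := ContDiff.lipschitzWith_of_hasCompactSupport (𝕂 := ℝ) hk.hasCompactSupport
    hk.contDiff (by simp)
  have hB0 : 0 ≤ B := (norm_nonneg _).trans (hB 0)
  refine ⟨max B D * max Q 0, by positivity, fun h hh hhQ => ⟨fun x => ?_, fun x x' => ?_⟩⟩
  · rw [IsMollifier.mollify_eq, ← Real.norm_eq_abs]
    calc ‖∫ y, k (x - y) * h y‖ ≤ ∫ y, B * ‖h y‖ := by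
          refine norm_integral_le_of_norm_le (hh.norm.const_mul _)
            (Eventually.of_forall fun y => ?_)
          rw [norm_mul]
          exact mul_le_mul_of_nonneg_right (hB _) (norm_nonneg _)
      _ = B * ∫ y, ‖h y‖ := integral_const_mul _ _
      _ ≤ _ := by
          have h0 : 0 ≤ ∫ y, ‖h y‖ := integral_nonneg fun y => norm_nonneg _
          exact mul_le_mul (le_max_left _ _) (hhQ.trans (le_max_left _ _)) h0 (by positivity)
  · have hi : ∀ x, Integrable fun y => k (x - y) * h y := fun x => by
      have hc : Continuous fun y => k (x - y) := hk.contDiff.continuous.comp (by fun_prop)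
      exact Integrable.bdd_mul hh hc.aestronglyMeasurable (Eventually.of_forall fun y => hB _)
    rw [IsMollifier.mollify_eq, IsMollifier.mollify_eq, ← integral_sub (hi x) (hi x'),
      ← Real.norm_eq_abs]
    calc ‖∫ y, (k (x - y) * h y - k (x' - y) * h y)‖ ≤ ∫ y, (D * ‖x - x'‖) * ‖h y‖ := by
          refine norm_integral_le_of_norm_le (hh.norm.const_mul _)
            (Eventually.of_forall fun y => ?_)
          rw [← sub_mul, norm_mul]
          refine mul_le_mul_of_nonneg_right ?_ (norm_nonneg _)
          have := hD.dist_le_mul (x - y) (x' - y)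
          rwa [dist_eq_norm, dist_eq_norm, sub_sub_sub_cancel_right] at this
      _ = (D * ‖x - x'‖) * ∫ y, ‖h y‖ := integral_const_mul _ _
      _ ≤ (max B D * ‖x - x'‖) * max Q 0 := by
          have h0 : 0 ≤ ∫ y, ‖h y‖ := integral_nonneg fun y => norm_nonneg _
          refine mul_le_mul ?_ (hhQ.trans (le_max_left _ _)) h0 (by positivity)
          exact mul_le_mul_of_nonneg_right (le_max_right _ _) (norm_nonneg _)
      _ = _ := by ring

/-- For fixed kernels, smoothing turns bounded sets of the Sobolev space into bounded and
equi-Lipschitz families. -/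
lemma InwardPartition.exists_smooth_bounds (P : InwardPartition Ω ι) (hΩo : IsOpen Ω)
    (hb : Bornology.IsBounded Ω) {p : ℝ} (hp : 1 < p) (M : ℝ≥0) {k : ι → E[N] → ℝ}
    (hk : ∀ i, ∃ c r, IsMollifier (k i) c r) : ∃ L : ℝ, 0 ≤ L ∧ ∀ φ : E[N] → ℝ, ContDiff ℝ ∞ φ →
      sobolevEnergy Ω p φ ≤ M → (∀ x, |P.smooth k φ x| ≤ L) ∧
        ∀ x x', |P.smooth k φ x - P.smooth k φ x'| ≤ L * ‖x - x'‖ := by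
  have hp0 : 0 < p := by linarith
  have hΩm := hΩo.measurableSet
  obtain ⟨K, hK⟩ := P.exists_sobolevEnergy_mul_le hp.le
  let Q : ℝ≥0∞ := (volume Ω ^ (p - 1) * (K * M)) ^ p⁻¹
  have hQ : Q ≠ ⊤ := by
    refine ENNReal.rpow_ne_top_of_nonneg (by positivity) (ENNReal.mul_ne_top ?_ ?_)
    · exact ENNReal.rpow_ne_top_of_nonneg (by linarith) hb.measure_lt_top.ne
    · exact ENNReal.mul_ne_top ENNReal.coe_ne_top ENNReal.coe_ne_top
  have hL1 : ∀ i, ∀ φ : E[N] → ℝ, ContDiff ℝ ∞ φ → sobolevEnergy Ω p φ ≤ M →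
      ∫ y, ‖Ω.indicator (fun y => P.χ i y * φ y) y‖ ≤ Q.toReal := by
    intro i φ hφ hφM
    rw [integral_norm_eq_lintegral_enorm
      (P.integrable_indicator_mul hΩo hb i hφ.continuous).aestronglyMeasurable]
    refine ENNReal.toReal_mono hQ ?_
    have h1 : ∫⁻ y, ‖Ω.indicator (fun y => P.χ i y * φ y) y‖ₑ = ∫⁻ y in Ω, ‖P.χ i y * φ y‖ₑ := by
      rw [← lintegral_indicator hΩm]
      refine lintegral_congr fun y => ?_
      rw [enorm_indicator_eq_indicator_enorm]
    rw [h1, ENNReal.le_rpow_inv_iff hp0]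
    have hm : Measurable fun y => ‖P.χ i y * φ y‖ₑ :=
      ((P.contDiff i).continuous.mul hφ.continuous).enorm.measurable
    refine (lintegral_rpow_le_measure_univ hp.le hm.aemeasurable).trans ?_
    rw [Measure.restrict_apply_univ]
    gcongr
    refine ((hK i φ hφ).1).trans ?_
    gcongr
    exact le_self_add.trans hφM
  have hex : ∀ i, ∃ L : ℝ, 0 ≤ L ∧ ∀ h : E[N] → ℝ, Integrable h →
      ∫ y, ‖h y‖ ≤ Q.toReal → (∀ x, |mollify (k i) h x| ≤ L) ∧
        ∀ x x', |mollify (k i) h x - mollify (k i) h x'| ≤ L * ‖x - x'‖ := by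
    intro i
    obtain ⟨c, r, h⟩ := hk i
    exact h.exists_mollify_bounds _
  choose L hL0 hL using hex
  refine ⟨∑ i, L i, Finset.sum_nonneg fun i _ => hL0 i, fun φ hφ hφM => ⟨fun x => ?_,
    fun x x' => ?_⟩⟩
  · refine (Finset.abs_sum_le_sum_abs _ _).trans (Finset.sum_le_sum fun i _ => ?_)
    exact (hL i _ (P.integrable_indicator_mul hΩo hb i hφ.continuous) (hL1 i φ hφ hφM)).1 x
  · unfold InwardPartition.smooth
    rw [← Finset.sum_sub_distrib, Finset.sum_mul]
    refine (Finset.abs_sum_le_sum_abs _ _).trans (Finset.sum_le_sum fun i _ => ?_)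
    exact (hL i _ (P.integrable_indicator_mul hΩo hb i hφ.continuous) (hL1 i φ hφ hφM)).2 x x'

/-- The Rellich compactness theorem, for smooth functions: smoothing reduces the total boundedness
in `L^p` to that of the values at finitely many points. -/
theorem InwardPartition.exists_subseq_tendsto (P : InwardPartition Ω ι) (hΩo : IsOpen Ω)
    (hb : Bornology.IsBounded Ω) {p : ℝ} (hp : 1 < p) {M : ℝ≥0} {φ : ℕ → E[N] → ℝ}
    (hφ : ∀ n, ContDiff ℝ ∞ (φ n)) (hM : ∀ n, sobolevEnergy Ω p (φ n) ≤ M) :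
    ∃ (v : E[N] → ℝ) (σ : ℕ → ℕ), MemLp v (ENNReal.ofReal p) (volume.restrict Ω) ∧
      StrictMono σ ∧ Tendsto (fun n => eLpNorm (fun x => φ (σ n) x - v x) (ENNReal.ofReal p)
        (volume.restrict Ω)) atTop (𝓝 0) := by
  have hp0 : 0 < p := by linarith
  have hp1 : 1 ≤ ENNReal.ofReal p := by simpa using hp.le
  have : Fact (1 ≤ ENNReal.ofReal p) := ⟨hp1⟩
  have : IsFiniteMeasure (volume.restrict Ω) := isFiniteMeasure_restrict.2 hb.measure_lt_top.ne
  have hmem : ∀ n, MemLp (φ n) (ENNReal.ofReal p) (volume.restrict Ω) := fun n =>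
    memLp_of_continuous hb (ae_mem_closure_volume hΩo) (hφ n).continuous _
  let f : ℕ → Lp ℝ (ENNReal.ofReal p) (volume.restrict Ω) := fun n => (hmem n).toLp (φ n)
  have htb : TotallyBounded (range f) := by
    refine Metric.totallyBounded_iff.2 fun ε hε => ?_
    let V : ℝ := (volume Ω ^ p⁻¹).toReal
    have hV : 0 ≤ V := ENNReal.toReal_nonneg
    have hVt : volume Ω ^ p⁻¹ ≠ ⊤ :=
      ENNReal.rpow_ne_top_of_nonneg (by positivity) hb.measure_lt_top.ne
    obtain ⟨k, hk, hkε⟩ := P.exists_smooth_sub_le hΩo hb hp M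
      (ε := Real.toNNReal (ε / 4)) (Real.toNNReal_pos.2 (by positivity))
    obtain ⟨L, hL0, hL⟩ := P.exists_smooth_bounds hΩo hb hp M hk
    let β : ℝ := ε / (12 * (V + 1))
    have hβ : 0 < β := by positivity
    obtain ⟨t, htfin, ht⟩ := Metric.totallyBounded_iff.1
      (hb.isCompact_closure.totallyBounded) (β / (L + 1)) (by positivity)
    have : Finite t := htfin
    have : Fintype t := Fintype.ofFinite t
    -- the values of the smoothed functions at the points of a finite net of `closure Ω`
    let w : ℕ → t → ℝ := fun n y => P.smooth k (φ n) y
    have hwb : Bornology.IsBounded (range w) := by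
      refine (Metric.isBounded_closedBall (x := (0 : t → ℝ)) (r := L)).subset ?_
      rintro _ ⟨n, rfl⟩
      rw [mem_closedBall_zero_iff, pi_norm_le_iff_of_nonneg hL0]
      exact fun y => (hL (φ n) (hφ n) (hM n)).1 y
    have hwtb : TotallyBounded (range w) :=
      hwb.isCompact_closure.totallyBounded.subset subset_closure
    obtain ⟨T, hTsub, hTfin, hT⟩ :=
      totallyBounded_iff_subset.1 hwtb _ (Metric.dist_mem_uniformity hβ)
    have hidx : ∀ y ∈ T, ∃ n, w n = y := fun y hy => hTsub hy
    choose! idx hidx using hidx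
    refine ⟨(fun y => f (idx y)) '' T, hTfin.image _, ?_⟩
    rintro _ ⟨n, rfl⟩
    obtain ⟨y, hyT, hy⟩ := mem_iUnion₂.1 (hT ⟨n, rfl⟩)
    refine mem_iUnion₂.2 ⟨_, ⟨y, hyT, rfl⟩, ?_⟩
    set m := idx y with hm
    have hwm : w m = y := hidx y hyT
    have hdist : ∀ z ∈ t, |P.smooth k (φ n) z - P.smooth k (φ m) z| < β := by
      intro z hz
      have h1 : dist (w n) (w m) < β := by
        rw [hwm]
        exact hy
      exact (dist_le_pi_dist (w n) (w m) ⟨z, hz⟩).trans_lt h1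
    have hsup : ∀ x ∈ Ω, |P.smooth k (φ n) x - P.smooth k (φ m) x| ≤ 3 * β := by
      intro x hx
      obtain ⟨z, hz, hxz⟩ := mem_iUnion₂.1 (ht (subset_closure hx))
      rw [mem_ball_iff_norm, lt_div_iff₀ (by positivity)] at hxz
      have h1 := (hL (φ n) (hφ n) (hM n)).2 x z
      have h2 := (hL (φ m) (hφ m) (hM m)).2 x z
      have h3 := hdist z hz
      have h4 : L * ‖x - z‖ ≤ β := by nlinarith [norm_nonneg (x - z)]
      rw [abs_le] at h1 h2 ⊢
      rw [abs_lt] at h3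
      constructor <;> linarith
    have hcont : ∀ j, Continuous (P.smooth k (φ j)) := by
      intro j
      refine continuous_finsetSum _ fun i _ => ?_
      obtain ⟨c, r, hk⟩ := hk i
      exact (hk.contDiff_mollify (P.integrable_indicator_mul hΩo hb i
        (hφ j).continuous).locallyIntegrable).continuous
    have hmid : eLpNorm (fun x => P.smooth k (φ n) x - P.smooth k (φ m) x) (ENNReal.ofReal p)
        (volume.restrict Ω) ≤ ENNReal.ofReal (ε / 4) := by
      refine (eLpNorm_le_of_ae_bound (C := 3 * β) ?_).trans ?_
      · filter_upwards [ae_restrict_mem hΩo.measurableSet] with x hx using hsup x hx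
      · rw [Measure.restrict_apply_univ, ENNReal.toReal_ofReal hp0.le,
          ← ENNReal.ofReal_toReal hVt, ← ENNReal.ofReal_mul ENNReal.toReal_nonneg]
        refine ENNReal.ofReal_le_ofReal ?_
        change V * (3 * β) ≤ ε / 4
        simp only [β]
        rw [← mul_assoc, mul_div_assoc', div_le_div_iff₀ (by positivity) (by norm_num)]
        nlinarith
    have hA : ∀ j, eLpNorm (fun x => P.smooth k (φ j) x - φ j x) (ENNReal.ofReal p)
        (volume.restrict Ω) ≤ ENNReal.ofReal (ε / 4) := by
      intro j
      exact hkε (φ j) (hφ j) (hM j)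
    have hms : ∀ j, AEStronglyMeasurable (fun x => P.smooth k (φ j) x - φ j x)
        (volume.restrict Ω) := fun j =>
      ((hcont j).sub (hφ j).continuous).aestronglyMeasurable
    have htri : eLpNorm (φ n - φ m) (ENNReal.ofReal p) (volume.restrict Ω) ≤
        ENNReal.ofReal (ε / 4) + ENNReal.ofReal (ε / 4) + ENNReal.ofReal (ε / 4) := by
      have h1 : φ n - φ m = ((fun x => P.smooth k (φ n) x - P.smooth k (φ m) x) -
          (fun x => P.smooth k (φ n) x - φ n x)) + (fun x => P.smooth k (φ m) x - φ m x) := by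
        ext x
        simp
      rw [h1]
      have hc : AEStronglyMeasurable (fun x => P.smooth k (φ n) x - P.smooth k (φ m) x)
          (volume.restrict Ω) := ((hcont n).sub (hcont m)).aestronglyMeasurable
      refine (eLpNorm_add_le (hc.sub (hms n)) (hms m) hp1).trans (add_le_add ?_ (hA m))
      exact (eLpNorm_sub_le hc (hms n) hp1).trans (add_le_add hmid (hA n))
    change dist (f n) (f m) < ε
    rw [dist_eq_norm, ← MemLp.toLp_sub, Lp.norm_toLp]
    rw [← ENNReal.ofReal_add (by positivity) (by positivity),
      ← ENNReal.ofReal_add (by positivity) (by positivity)] at htri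
    exact (ENNReal.toReal_le_of_le_ofReal (by positivity) htri).trans_lt (by linarith)
  have hcomp : IsCompact (closure (range f)) :=
    htb.closure.isCompact_of_isClosed isClosed_closure
  obtain ⟨g, -, σ, hσ, hlim⟩ := hcomp.tendsto_subseq fun n => subset_closure (mem_range_self n)
  refine ⟨g, σ, Lp.memLp g, hσ, ?_⟩
  have h1 := (Lp.tendsto_Lp_iff_tendsto_eLpNorm' _ _).1 hlim
  refine h1.congr fun n => eLpNorm_congr_ae ?_
  filter_upwards [(hmem (σ n)).coeFn_toLp] with x hx
  simp only [Function.comp_apply, Pi.sub_apply, f, hx]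

end Rellich

/-! ### A Poincaré inequality with boundary term -/

section Poincare

variable {N : ℕ} {Ω : Set (EuclideanSpace ℝ (Fin N))}

local notation "E[" n "]" => EuclideanSpace ℝ (Fin n)

/-- The double integral over a ball of the differences of `φ` is controlled by its gradient. -/
lemma lintegral_lintegral_sub_le (hΩo : IsOpen Ω) {φ : E[N] → ℝ} (hφ : ContDiff ℝ ∞ φ) {p : ℝ}
    (hp : 1 ≤ p) {x₀ : E[N]} {r : ℝ} (hball : Metric.ball x₀ (3 * r) ⊆ Ω) :
    ∫⁻ x in Metric.ball x₀ r, ∫⁻ y in Metric.ball x₀ r, ‖φ y - φ x‖ₑ ^ p ≤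
      volume (Metric.ball (0 : E[N]) (2 * r)) * ENNReal.ofReal (2 * r) ^ p *
        ∫⁻ x in Ω, ‖gradient φ x‖ₑ ^ p := by
  have hp0 : 0 < p := by linarith
  have hΩm := hΩo.measurableSet
  have hgc := continuous_gradient hφ
  let g : E[N] → ℝ≥0∞ := Ω.indicator fun x => ‖gradient φ x‖ₑ ^ p
  have hgm : Measurable g := (hgc.enorm.measurable.pow_const p).indicator hΩm
  let B := Metric.ball x₀ r
  have hBm : MeasurableSet B := Metric.isOpen_ball.measurableSet
  let D := Metric.ball (0 : E[N]) (2 * r)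
  have hDm : MeasurableSet D := Metric.isOpen_ball.measurableSet
  have hpt : ∀ x ∈ B, ∀ z ∈ D, ‖φ (x + z) - φ x‖ₑ ^ p ≤
      ENNReal.ofReal (2 * r) ^ p * ∫⁻ τ in Ioo (0 : ℝ) 1, g (x + τ • z) := by
    intro x hx z hz
    have h2 := ENNReal.rpow_le_rpow (enorm_sub_le_lintegral_gradient hφ x z zero_le_one) hp0.le
    rw [ENNReal.mul_rpow_of_nonneg _ _ hp0.le, one_smul] at h2
    have hm : Measurable fun τ : ℝ => ‖gradient φ (x + τ • z)‖ₑ :=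
      (hgc.comp (by fun_prop : Continuous fun τ : ℝ => x + τ • z)).enorm.measurable
    have h3 := lintegral_rpow_le_measure_univ (μ := volume.restrict (Ioo (0 : ℝ) 1)) hp
      hm.aemeasurable
    rw [Measure.restrict_apply_univ, Real.volume_Ioo, sub_zero, ENNReal.ofReal_one,
      ENNReal.one_rpow, one_mul] at h3
    refine h2.trans (mul_le_mul' (ENNReal.rpow_le_rpow ?_ hp0.le) (h3.trans ?_))
    · rw [← ofReal_norm]
      exact ENNReal.ofReal_le_ofReal (mem_ball_zero_iff.1 hz).le
    · refine setLIntegral_mono' measurableSet_Ioo fun τ hτ => ?_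
      have hmem : x + τ • z ∈ Ω := by
        refine hball ?_
        have h4 := mem_ball_iff_norm.1 hx
        have h5 := mem_ball_zero_iff.1 hz
        rw [mem_ball_iff_norm]
        calc ‖x + τ • z - x₀‖ = ‖(x - x₀) + τ • z‖ := by congr 1; abel
          _ ≤ ‖x - x₀‖ + τ * ‖z‖ := by
              refine (norm_add_le _ _).trans ?_
              rw [norm_smul, Real.norm_of_nonneg hτ.1.le]
          _ ≤ ‖x - x₀‖ + 1 * ‖z‖ := by
              gcongr
              exact hτ.2.le
          _ < 3 * r := by linarith
      simp only [g, indicator_of_mem hmem, le_refl]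
  have hcm : Measurable fun q : E[N] × E[N] => ‖φ (q.1 + q.2) - φ q.1‖ₑ ^ p :=
    ((hφ.continuous.comp (continuous_fst.add continuous_snd)).sub
      (hφ.continuous.comp continuous_fst)).enorm.measurable.pow_const p
  calc ∫⁻ x in B, ∫⁻ y in B, ‖φ y - φ x‖ₑ ^ p
      ≤ ∫⁻ x in B, ∫⁻ z in D, ‖φ (x + z) - φ x‖ₑ ^ p := by
        refine setLIntegral_mono' hBm fun x hx => ?_
        rw [← lintegral_indicator hBm, ← lintegral_indicator hDm,
          ← lintegral_add_left_eq_self _ x]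
        refine lintegral_mono fun z => ?_
        by_cases hz : x + z ∈ B
        · have hzD : z ∈ D := by
            have h4 := mem_ball_iff_norm.1 hx
            have h5 := mem_ball_iff_norm.1 hz
            rw [mem_ball_zero_iff]
            calc ‖z‖ = ‖(x + z - x₀) - (x - x₀)‖ := by congr 1; abel
              _ ≤ _ := norm_sub_le _ _
              _ < 2 * r := by linarith
          rw [indicator_of_mem hz, indicator_of_mem hzD]
        · rw [indicator_of_notMem hz]
          exact zero_le
    _ = ∫⁻ z in D, ∫⁻ x in B, ‖φ (x + z) - φ x‖ₑ ^ p := lintegral_lintegral_swap hcm.aemeasurable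
    _ ≤ ∫⁻ z in D, ENNReal.ofReal (2 * r) ^ p * ∫⁻ x in Ω, ‖gradient φ x‖ₑ ^ p := by
        refine setLIntegral_mono' hDm fun z hz => ?_
        calc ∫⁻ x in B, ‖φ (x + z) - φ x‖ₑ ^ p
            ≤ ∫⁻ x in B, ENNReal.ofReal (2 * r) ^ p * ∫⁻ τ in Ioo (0 : ℝ) 1, g (x + τ • z) :=
              setLIntegral_mono' hBm fun x hx => hpt x hx z hz
          _ ≤ ∫⁻ x, ENNReal.ofReal (2 * r) ^ p * ∫⁻ τ in Ioo (0 : ℝ) 1, g (x + τ • z) :=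
              setLIntegral_le_lintegral _ _
          _ = ENNReal.ofReal (2 * r) ^ p * ∫⁻ x, ∫⁻ τ in Ioo (0 : ℝ) 1, g (x + τ • z) :=
              lintegral_const_mul' _ _
                (ENNReal.rpow_ne_top_of_nonneg hp0.le ENNReal.ofReal_ne_top)
          _ = ENNReal.ofReal (2 * r) ^ p * ∫⁻ τ in Ioo (0 : ℝ) 1, ∫⁻ x, g (x + τ • z) := by
              congr 1
              refine lintegral_lintegral_swap (Measurable.aemeasurable ?_)
              exact hgm.comp (by fun_prop : Measurable fun q : E[N] × ℝ => q.1 + q.2 • z)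
          _ = _ := by
              simp only [lintegral_add_right_eq_self g]
              rw [lintegral_const, Measure.restrict_apply_univ, Real.volume_Ioo, sub_zero,
                ENNReal.ofReal_one, mul_one, lintegral_indicator hΩm]
    _ = _ := by
        rw [setLIntegral_const]
        ring

/-- If smooth functions converge almost everywhere and their gradients tend to `0` in `L^p`, then
the limit is almost everywhere constant on a connected open set. Locally, this is Fatou's lemma,
applied to both integrals over a ball of the differences of values. -/
theorem exists_ae_eq_const (hΩo : IsOpen Ω) (hΩc : IsConnected Ω) {p : ℝ} (hp : 1 ≤ p)
    {φ : ℕ → E[N] → ℝ} (hφ : ∀ n, ContDiff ℝ ∞ (φ n)) {v : E[N] → ℝ}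
    (hv : ∀ᵐ x ∂(volume.restrict Ω), Tendsto (fun n => φ n x) atTop (𝓝 (v x)))
    (hg : Tendsto (fun n => ∫⁻ x in Ω, ‖gradient (φ n) x‖ₑ ^ p) atTop (𝓝 0)) :
    ∃ c : ℝ, ∀ᵐ x ∂(volume.restrict Ω), v x = c := by
  have hp0 : 0 < p := by linarith
  have hloc : ∀ x₀ : Ω, ∃ r > 0, ∃ c : ℝ, ∀ᵐ y ∂(volume.restrict (Metric.ball (x₀ : E[N]) r)),
      v y = c := by
    rintro ⟨x₀, hx₀⟩
    obtain ⟨R, hR, hRΩ⟩ := Metric.isOpen_iff.1 hΩo x₀ hx₀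
    let r := R / 3
    have hr : 0 < r := by positivity
    have hball : Metric.ball x₀ (3 * r) ⊆ Ω := by
      rwa [show 3 * r = R by simp only [r]; ring]
    let B := Metric.ball x₀ r
    have hBΩ : B ⊆ Ω := (Metric.ball_subset_ball (by linarith)).trans hball
    have hvB : ∀ᵐ x ∂(volume.restrict B), Tendsto (fun n => φ n x) atTop (𝓝 (v x)) :=
      ae_restrict_of_ae_restrict_of_subset hBΩ hv
    have hm1 : ∀ n x, Measurable fun y => ‖φ n y - φ n x‖ₑ ^ p := fun n x =>
      ((hφ n).continuous.sub continuous_const).enorm.measurable.pow_const p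
    have hm2 : ∀ n, Measurable fun x => ∫⁻ y in B, ‖φ n y - φ n x‖ₑ ^ p := fun n =>
      Measurable.lintegral_prod_right' (f := fun q : E[N] × E[N] => ‖φ n q.2 - φ n q.1‖ₑ ^ p)
        ((((hφ n).continuous.comp continuous_snd).sub
          ((hφ n).continuous.comp continuous_fst)).enorm.measurable.pow_const p)
    have hzero : ∫⁻ x in B, liminf (fun n => ∫⁻ y in B, ‖φ n y - φ n x‖ₑ ^ p) atTop = 0 := by
      refine le_antisymm ((lintegral_liminf_le hm2).trans ?_) zero_le
      have hC : volume (Metric.ball (0 : E[N]) (2 * r)) * ENNReal.ofReal (2 * r) ^ p ≠ ⊤ :=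
        ENNReal.mul_ne_top measure_ball_lt_top.ne
          (ENNReal.rpow_ne_top_of_nonneg hp0.le ENNReal.ofReal_ne_top)
      have h1 := ENNReal.Tendsto.const_mul hg (Or.inr hC)
      rw [mul_zero] at h1
      rw [← h1.liminf_eq]
      exact liminf_le_liminf (Eventually.of_forall fun n =>
        lintegral_lintegral_sub_le hΩo (hφ n) hp hball)
    rw [lintegral_eq_zero_iff (Measurable.liminf hm2)] at hzero
    have hB0 : volume.restrict B ≠ 0 := by
      rw [Ne, Measure.restrict_eq_zero]
      exact (Metric.isOpen_ball.measure_pos volume ⟨x₀, Metric.mem_ball_self hr⟩).ne'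
    have : (ae (volume.restrict B)).NeBot := ae_neBot.2 hB0
    obtain ⟨x, hx1, hx2⟩ := (hzero.and hvB).exists
    refine ⟨r, hr, v x, ?_⟩
    have h1 : ∫⁻ y in B, liminf (fun n => ‖φ n y - φ n x‖ₑ ^ p) atTop = 0 :=
      le_antisymm ((lintegral_liminf_le fun n => hm1 n x).trans hx1.le) zero_le
    rw [lintegral_eq_zero_iff (Measurable.liminf fun n => hm1 n x)] at h1
    filter_upwards [h1, hvB] with y hy1 hy2
    have h2 : Tendsto (fun n => ‖φ n y - φ n x‖ₑ ^ p) atTop (𝓝 (‖v y - v x‖ₑ ^ p)) :=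
      ((ENNReal.continuous_rpow_const.comp continuous_enorm).tendsto _).comp (hy2.sub hx2)
    rw [h2.liminf_eq] at hy1
    have h3 := (ENNReal.rpow_eq_zero_iff_of_pos hp0).1 hy1
    rw [enorm_eq_zero, sub_eq_zero] at h3
    exact h3
  choose r hr c hc using hloc
  have : PreconnectedSpace Ω := isPreconnected_iff_preconnectedSpace.1 hΩc.isPreconnected
  have hlc : IsLocallyConstant c := by
    refine (IsLocallyConstant.iff_eventually_eq c).2 fun x => ?_
    have hnhds : ∀ᶠ y : Ω in 𝓝 x, (y : E[N]) ∈ Metric.ball (x : E[N]) (r x) :=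
      continuous_subtype_val.continuousAt.eventually (Metric.ball_mem_nhds _ (hr x))
    filter_upwards [hnhds] with y hy
    let O : Set E[N] := Metric.ball (x : E[N]) (r x) ∩ Metric.ball (y : E[N]) (r y)
    have hO : volume.restrict O ≠ 0 := by
      rw [Ne, Measure.restrict_eq_zero]
      have hOo : IsOpen O := Metric.isOpen_ball.inter Metric.isOpen_ball
      exact (hOo.measure_pos volume ⟨(y : E[N]), hy, Metric.mem_ball_self (hr y)⟩).ne'
    have : (ae (volume.restrict O)).NeBot := ae_neBot.2 hO
    obtain ⟨z, hz1, hz2⟩ :=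
      ((ae_restrict_of_ae_restrict_of_subset (inter_subset_left : O ⊆ _) (hc x)).and
        (ae_restrict_of_ae_restrict_of_subset (inter_subset_right : O ⊆ _) (hc y))).exists
    rw [← hz1, ← hz2]
  obtain ⟨x₁, hx₁⟩ := hΩc.nonempty
  refine ⟨c ⟨x₁, hx₁⟩, ?_⟩
  rw [ae_restrict_iff' hΩo.measurableSet, ae_iff]
  refine measure_null_of_locally_null _ fun x hx => ?_
  have hxΩ : x ∈ Ω := by
    by_contra h
    exact hx fun h' => absurd h' h
  refine ⟨_, inter_mem_nhdsWithin _ (Metric.ball_mem_nhds x (hr ⟨x, hxΩ⟩)), ?_⟩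
  have h1 := hc ⟨x, hxΩ⟩
  rw [ae_restrict_iff' Metric.isOpen_ball.measurableSet, ae_iff] at h1
  refine measure_mono_null ?_ h1
  rintro y ⟨hy1, hy2⟩ hy3
  refine hy1 fun _ => ?_
  rw [hy3 hy2]
  exact hlc.apply_eq_of_preconnectedSpace _ _

variable {ι : Type} [Fintype ι]

/-- The trace inequality for the constant function `1`. -/
lemma InwardPartition.isFiniteMeasure_surfaceMeasure (P : InwardPartition Ω ι)
    (hb : Bornology.IsBounded Ω) : IsFiniteMeasure (surfaceMeasure Ω) := by
  obtain ⟨K, hK⟩ := P.exists_trace_le one_lt_two (ε := 1) one_pos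
  have h := hK (fun _ => 1) contDiff_const
  have hg : ∀ x : E[N], gradient (fun _ : E[N] => (1 : ℝ)) x = 0 := fun x => by
    simp [gradient]
  simp only [hg, enorm_zero, enorm_one, ENNReal.one_rpow, lintegral_one,
    ENNReal.zero_rpow_of_pos (two_pos : (0 : ℝ) < 2), lintegral_zero, mul_zero, zero_add,
    Measure.restrict_apply_univ] at h
  exact ⟨h.trans_lt (ENNReal.mul_lt_top ENNReal.coe_lt_top hb.measure_lt_top)⟩

lemma gradient_const_mul {f : E[N] → ℝ} (hf : ContDiff ℝ ∞ f) (a : ℝ) (x : E[N]) :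
    gradient (fun y => a * f y) x = a • gradient f x := by
  rw [gradient, fderiv_const_mul (hf.differentiable (by simp) x)]
  simp [gradient]

/-- The trace inequality, in terms of norms and along sequences. -/
lemma InwardPartition.tendsto_trace (P : InwardPartition Ω ι) {p : ℝ} (hp : 1 < p)
    {φ : ℕ → E[N] → ℝ} (hφ : ∀ n, ContDiff ℝ ∞ (φ n))
    (h0 : Tendsto (fun n => eLpNorm (φ n) (ENNReal.ofReal p) (volume.restrict Ω)) atTop (𝓝 0))
    (h1 : Tendsto (fun n => eLpNorm (gradient (φ n)) (ENNReal.ofReal p) (volume.restrict Ω))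
      atTop (𝓝 0)) :
    Tendsto (fun n => eLpNorm (φ n) (ENNReal.ofReal p) (surfaceMeasure Ω)) atTop (𝓝 0) := by
  have hp0 : 0 < p := by linarith
  obtain ⟨K, hK⟩ := P.exists_trace_le hp (ε := 1) one_pos
  have hpow : Tendsto (fun n => eLpNorm (φ n) (ENNReal.ofReal p) (surfaceMeasure Ω) ^ p) atTop
      (𝓝 0) := by
    have e0 := (ENNReal.continuous_rpow_const (y := p)).tendsto 0
    rw [ENNReal.zero_rpow_of_pos hp0] at e0
    have e1 := ENNReal.Tendsto.const_mul (a := (1 : ℝ≥0)) (e0.comp h1) (Or.inr ENNReal.coe_ne_top)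
    have e2 := ENNReal.Tendsto.const_mul (a := K) (e0.comp h0) (Or.inr ENNReal.coe_ne_top)
    have e3 := e1.add e2
    rw [mul_zero, mul_zero, add_zero] at e3
    refine tendsto_of_tendsto_of_tendsto_of_le_of_le tendsto_const_nhds e3 (fun _ => zero_le)
      fun n => ?_
    simp only [Function.comp_apply, eLpNorm_rpow hp]
    exact hK (φ n) (hφ n)
  have e4 := ((ENNReal.continuous_rpow_const (y := p⁻¹)).tendsto 0).comp hpow
  rw [ENNReal.zero_rpow_of_pos (by positivity)] at e4
  refine e4.congr fun n => ?_
  simp only [Function.comp_apply]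
  rw [← ENNReal.rpow_mul, mul_inv_cancel₀ hp0.ne', ENNReal.rpow_one]

/-- The Poincaré inequality for smooth functions, with an integral over a boundary piece of
positive measure. It is proved by contradiction: a normalized sequence that violates it converges to
a nonzero constant, by compactness, whose trace on `S` vanishes. -/
theorem InwardPartition.exists_poincare_le (P : InwardPartition Ω ι) (hΩo : IsOpen Ω)
    (hΩc : IsConnected Ω) (hb : Bornology.IsBounded Ω) {p : ℝ} (hp : 1 < p) {S : Set E[N]}
    (hS : surfaceMeasure Ω S ≠ 0) : ∃ K : ℝ≥0, ∀ φ : E[N] → ℝ, ContDiff ℝ ∞ φ →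
      eLpNorm φ (ENNReal.ofReal p) (volume.restrict Ω) ≤
        K * (eLpNorm (gradient φ) (ENNReal.ofReal p) (volume.restrict Ω) +
          ∫⁻ x in S, ‖φ x‖ₑ ∂(surfaceMeasure Ω)) := by
  have hp0 : 0 < p := by linarith
  have hp1 : 1 ≤ ENNReal.ofReal p := by simpa using hp.le
  have hfin : IsFiniteMeasure (volume.restrict Ω) := isFiniteMeasure_restrict.2 hb.measure_lt_top.ne
  have hsfin := P.isFiniteMeasure_surfaceMeasure hb
  by_contra hcon
  push Not at hcon
  choose φ₀ hφ₀ hlt using fun n : ℕ => hcon (n : ℝ≥0)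
  let A : (E[N] → ℝ) → ℝ≥0∞ := fun φ => eLpNorm φ (ENNReal.ofReal p) (volume.restrict Ω)
  let R : (E[N] → ℝ) → ℝ≥0∞ := fun φ =>
    eLpNorm (gradient φ) (ENNReal.ofReal p) (volume.restrict Ω) +
      ∫⁻ x in S, ‖φ x‖ₑ ∂(surfaceMeasure Ω)
  have hAt : ∀ n, A (φ₀ n) ≠ ⊤ := fun n =>
    (memLp_of_continuous hb (ae_mem_closure_volume hΩo) (hφ₀ n).continuous _).eLpNorm_ne_top
  have hA0 : ∀ n, A (φ₀ n) ≠ 0 := fun n => (zero_le.trans_lt (hlt n)).ne'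
  let a : ℕ → ℝ := fun n => (A (φ₀ n)).toReal⁻¹
  have ha : ∀ n, 0 < a n := fun n => inv_pos.2 (ENNReal.toReal_pos (hA0 n) (hAt n))
  have hae : ∀ n, ‖a n‖ₑ = (A (φ₀ n))⁻¹ := by
    intro n
    rw [Real.enorm_of_nonneg (ha n).le, ENNReal.ofReal_inv_of_pos
      (ENNReal.toReal_pos (hA0 n) (hAt n)), ENNReal.ofReal_toReal (hAt n)]
  let φ : ℕ → E[N] → ℝ := fun n x => a n * φ₀ n x
  have hφ : ∀ n, ContDiff ℝ ∞ (φ n) := fun n => contDiff_const.mul (hφ₀ n)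
  have hgφ : ∀ n, gradient (φ n) = a n • gradient (φ₀ n) := fun n => by
    ext1 x
    exact gradient_const_mul (hφ₀ n) (a n) x
  have hAφ : ∀ n, A (φ n) = 1 := by
    intro n
    have h1 : φ n = a n • φ₀ n := rfl
    simp only [A]
    rw [h1, eLpNorm_const_smul, hae]
    exact ENNReal.inv_mul_cancel (hA0 n) (hAt n)
  have hRφ : ∀ n, R (φ n) = (A (φ₀ n))⁻¹ * R (φ₀ n) := by
    intro n
    simp only [R, φ]
    rw [show gradient (fun x => a n * φ₀ n x) = a n • gradient (φ₀ n) from hgφ n,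
      eLpNorm_const_smul, mul_add, hae]
    congr 1
    rw [← lintegral_const_mul' _ _ (ENNReal.inv_ne_top.2 (hA0 n))]
    simp only [enorm_mul, hae]
  have hR : ∀ n : ℕ, R (φ n) ≤ (n : ℝ≥0∞)⁻¹ := by
    intro n
    rw [hRφ, ENNReal.le_inv_iff_mul_le]
    have h1 : (n : ℝ≥0∞) * R (φ₀ n) < A (φ₀ n) := by simpa using hlt n
    calc (A (φ₀ n))⁻¹ * R (φ₀ n) * n = (A (φ₀ n))⁻¹ * (n * R (φ₀ n)) := by ring
      _ ≤ (A (φ₀ n))⁻¹ * A (φ₀ n) := by gcongr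
      _ = 1 := ENNReal.inv_mul_cancel (hA0 n) (hAt n)
  have hR0 : Tendsto (fun n => R (φ n)) atTop (𝓝 0) :=
    tendsto_of_tendsto_of_tendsto_of_le_of_le tendsto_const_nhds ENNReal.tendsto_inv_nat_nhds_zero
      (fun _ => zero_le) hR
  have hG0 : Tendsto (fun n => eLpNorm (gradient (φ n)) (ENNReal.ofReal p) (volume.restrict Ω))
      atTop (𝓝 0) :=
    tendsto_of_tendsto_of_tendsto_of_le_of_le tendsto_const_nhds hR0 (fun _ => zero_le)
      fun _ => le_self_add
  have hS0 : Tendsto (fun n => ∫⁻ x in S, ‖φ n x‖ₑ ∂(surfaceMeasure Ω)) atTop (𝓝 0) :=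
    tendsto_of_tendsto_of_tendsto_of_le_of_le tendsto_const_nhds hR0 (fun _ => zero_le)
      fun _ => le_add_self
  -- the index shift makes the bound on the gradients uniform
  have hM : ∀ n, sobolevEnergy Ω p (φ (n + 1)) ≤ (2 : ℝ≥0) := by
    intro n
    unfold sobolevEnergy
    rw [← eLpNorm_rpow hp, ← eLpNorm_rpow hp]
    have h1 : eLpNorm (φ (n + 1)) (ENNReal.ofReal p) (volume.restrict Ω) = 1 := hAφ _
    have h2 : eLpNorm (gradient (φ (n + 1))) (ENNReal.ofReal p) (volume.restrict Ω) ≤ 1 := by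
      refine (le_self_add.trans (hR (n + 1))).trans ?_
      rw [ENNReal.inv_le_one]
      exact_mod_cast Nat.le_add_left 1 n
    rw [h1, ENNReal.one_rpow]
    calc (1 : ℝ≥0∞) + _ ≤ 1 + 1 := by
          gcongr
          exact (ENNReal.rpow_le_rpow h2 hp0.le).trans (by rw [ENNReal.one_rpow])
      _ = (2 : ℝ≥0) := by norm_num
  obtain ⟨v, σ, hv, hσ, hlim⟩ := P.exists_subseq_tendsto hΩo hb hp (fun n => hφ (n + 1)) hM
  have hmeas : TendstoInMeasure (volume.restrict Ω) (fun n => φ (σ n + 1)) atTop v :=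
    tendstoInMeasure_of_tendsto_eLpNorm (by simpa using hp0)
      (fun n => (hφ _).continuous.aestronglyMeasurable) hv.1 hlim
  obtain ⟨τ, hτ, hae'⟩ := hmeas.exists_seq_tendsto_ae
  let m : ℕ → ℕ := fun n => σ (τ n) + 1
  have hm : Tendsto m atTop atTop :=
    (tendsto_add_atTop_nat 1).comp (hσ.tendsto_atTop.comp hτ.tendsto_atTop)
  have hlim' : Tendsto (fun n => eLpNorm (fun x => φ (m n) x - v x) (ENNReal.ofReal p)
      (volume.restrict Ω)) atTop (𝓝 0) := hlim.comp hτ.tendsto_atTop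
  have hgp : Tendsto (fun n => ∫⁻ x in Ω, ‖gradient (φ (m n)) x‖ₑ ^ p) atTop (𝓝 0) := by
    have e0 := (ENNReal.continuous_rpow_const (y := p)).tendsto 0
    rw [ENNReal.zero_rpow_of_pos hp0] at e0
    refine (e0.comp (hG0.comp hm)).congr fun n => ?_
    simp only [Function.comp_apply, eLpNorm_rpow hp]
  obtain ⟨c, hc⟩ := exists_ae_eq_const hΩo hΩc hp.le (fun n => hφ (m n)) hae' hgp
  have hlimc : Tendsto (fun n => eLpNorm (fun x => φ (m n) x - c) (ENNReal.ofReal p)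
      (volume.restrict Ω)) atTop (𝓝 0) := by
    refine hlim'.congr fun n => eLpNorm_congr_ae ?_
    filter_upwards [hc] with x hx
    rw [hx]
  have hgc : ∀ n, gradient (fun x => φ (m n) x - c) = gradient (φ (m n)) := fun n => by
    ext1 x
    rw [gradient, fderiv_sub_const]
    rfl
  have htr := P.tendsto_trace hp (fun n => (hφ (m n)).sub contDiff_const) hlimc (by
    simp only [hgc]
    exact hG0.comp hm)
  have htr1 : Tendsto (fun n => ∫⁻ x, ‖φ (m n) x - c‖ₑ ∂(surfaceMeasure Ω)) atTop (𝓝 0) := by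
    have h1 : ∀ n, ∫⁻ x, ‖φ (m n) x - c‖ₑ ∂(surfaceMeasure Ω) ≤
        eLpNorm (fun x => φ (m n) x - c) (ENNReal.ofReal p) (surfaceMeasure Ω) *
          surfaceMeasure Ω univ ^ (1 / (1 : ℝ≥0∞).toReal - 1 / (ENNReal.ofReal p).toReal) := by
      intro n
      rw [← eLpNorm_one_eq_lintegral_enorm]
      exact eLpNorm_le_eLpNorm_mul_rpow_measure_univ hp1
        ((hφ (m n)).continuous.sub continuous_const).aestronglyMeasurable
    have hexp : 0 ≤ 1 / (1 : ℝ≥0∞).toReal - 1 / (ENNReal.ofReal p).toReal := by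
      rw [ENNReal.toReal_ofReal hp0.le, ENNReal.toReal_one, div_one, sub_nonneg, div_le_one hp0]
      exact hp.le
    have h2 := ENNReal.Tendsto.mul_const htr (Or.inr
      (ENNReal.rpow_ne_top_of_nonneg hexp (measure_ne_top (surfaceMeasure Ω) univ)))
    rw [zero_mul] at h2
    exact tendsto_of_tendsto_of_tendsto_of_le_of_le tendsto_const_nhds h2 (fun _ => zero_le) h1
  have hcS : ‖c‖ₑ * surfaceMeasure Ω S = 0 := by
    have h1 : ∀ n, ‖c‖ₑ * surfaceMeasure Ω S ≤ (∫⁻ x in S, ‖φ (m n) x‖ₑ ∂(surfaceMeasure Ω)) +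
        ∫⁻ x, ‖φ (m n) x - c‖ₑ ∂(surfaceMeasure Ω) := by
      intro n
      calc ‖c‖ₑ * surfaceMeasure Ω S = ∫⁻ _ in S, ‖c‖ₑ ∂(surfaceMeasure Ω) :=
            (setLIntegral_const _ _).symm
        _ ≤ ∫⁻ x in S, (‖φ (m n) x‖ₑ + ‖φ (m n) x - c‖ₑ) ∂(surfaceMeasure Ω) := by
            refine lintegral_mono fun x => ?_
            calc ‖c‖ₑ = ‖φ (m n) x - (φ (m n) x - c)‖ₑ := by rw [sub_sub_cancel]
              _ ≤ _ := enorm_sub_le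
        _ = (∫⁻ x in S, ‖φ (m n) x‖ₑ ∂(surfaceMeasure Ω)) +
              ∫⁻ x in S, ‖φ (m n) x - c‖ₑ ∂(surfaceMeasure Ω) :=
            lintegral_add_left (hφ (m n)).continuous.enorm.measurable _
        _ ≤ _ := by
            gcongr
            exact Measure.restrict_le_self
    have h2 := (hS0.comp hm).add htr1
    rw [add_zero] at h2
    exact le_antisymm (ge_of_tendsto' h2 h1) zero_le
  have hc0 : c = 0 := by
    rcases mul_eq_zero.1 hcS with h | h
    · exact enorm_eq_zero.1 h
    · exact absurd h hS
  have h3 : ∀ n, eLpNorm (fun x => φ (m n) x - c) (ENNReal.ofReal p) (volume.restrict Ω) = 1 := by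
    intro n
    simp only [hc0, sub_zero]
    exact hAφ (m n)
  simp only [h3] at hlimc
  exact one_ne_zero (tendsto_nhds_unique tendsto_const_nhds hlimc)

end Poincare

/-! ### Weak gradients -/

section WeakGradient

local notation "E[" n "]" => EuclideanSpace ℝ (Fin n)

variable {N : ℕ} {Ω : Set (EuclideanSpace ℝ (Fin N))}

lemma locallyIntegrableOn_coord {G : E[N] → E[N]} (hG : LocallyIntegrableOn G Ω volume)
    (i : Fin N) :
    LocallyIntegrableOn (fun x => G x i) Ω volume := fun x hx => by
  obtain ⟨s, hs, h⟩ := hG x hx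
  exact ⟨s, hs, (EuclideanSpace.proj i : E[N] →L[ℝ] ℝ).integrable_comp h⟩

/-- Tested against functions with compact support in `Ω`, locally integrable functions give
integrable products. -/
lemma integrableOn_mul_of_hasCompactSupport {v φ : E[N] → ℝ}
    (hv : LocallyIntegrableOn v Ω volume) (hφ : Continuous φ) (hc : HasCompactSupport φ)
    (hs : tsupport φ ⊆ Ω) : IntegrableOn (fun x => v x * φ x) Ω := by
  have h1 : IntegrableOn (fun x => v x * φ x) (tsupport φ) :=
    (hv.integrableOn_compact_subset hs hc).mul_continuousOn hφ.continuousOn hc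
  refine IntegrableOn.mono_set ?_ (subset_univ Ω)
  rw [integrableOn_univ]
  refine (integrableOn_iff_integrable_of_support_subset fun x hx => ?_).1 h1
  refine subset_tsupport φ ?_
  intro h
  exact hx (by simp [h])

/-- The fundamental lemma of the calculus of variations, applied coordinatewise. -/
lemma HasWeakGradient.ae_eq (hΩo : IsOpen Ω) {u : E[N] → ℝ} {G H : E[N] → E[N]}
    (h1 : HasWeakGradient Ω u G) (h2 : HasWeakGradient Ω u H) :
    G =ᵐ[volume.restrict Ω] H := by
  have hi : ∀ i : Fin N, ∀ᵐ x ∂(volume : Measure E[N]), x ∈ Ω → G x i - H x i = 0 := by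
    intro i
    have hGi := locallyIntegrableOn_coord h1.2.1 i
    have hHi := locallyIntegrableOn_coord h2.2.1 i
    refine hΩo.ae_eq_zero_of_integral_contDiff_smul_eq_zero (hGi.sub hHi) fun g hg hgc hgs => ?_
    have e1 : ∫ x, g x • (G x i - H x i) = ∫ x in Ω, (G x i * g x - H x i * g x) := by
      rw [← setIntegral_eq_integral_of_forall_compl_eq_zero (s := Ω)]
      · refine integral_congr_ae (Eventually.of_forall fun x => ?_)
        simp only [smul_eq_mul]
        ring
      · intro x hx
        rw [image_eq_zero_of_notMem_tsupport fun h => hx (hgs h), zero_smul]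
    rw [e1, integral_sub (integrableOn_mul_of_hasCompactSupport hGi hg.continuous hgc hgs)
      (integrableOn_mul_of_hasCompactSupport hHi hg.continuous hgc hgs)]
    have e2 := h1.2.2 g hg hgc hgs i
    have e3 := h2.2.2 g hg hgc hgs i
    linarith
  rw [Filter.EventuallyEq, ae_restrict_iff' hΩo.measurableSet]
  filter_upwards [ae_all_iff.2 hi] with x hx hxΩ
  ext i
  exact sub_eq_zero.1 (hx i hxΩ)

lemma HasWeakGradient.weakGradient {u : E[N] → ℝ} {G : E[N] → E[N]} (h : HasWeakGradient Ω u G) :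
    HasWeakGradient Ω u (weakGradient Ω u) := by
  have hex : ∃ G, HasWeakGradient Ω u G := ⟨G, h⟩
  rw [PrimalProblem.weakGradient, dif_pos hex]
  exact hex.choose_spec

lemma MemW1p.hasWeakGradient {u : E[N] → ℝ} {q : ℝ≥0∞} (hu : MemW1p Ω q u) :
    HasWeakGradient Ω u (weakGradient Ω u) := hu.2.choose_spec.1.weakGradient

lemma MemW1p.memLp_weakGradient (hΩo : IsOpen Ω) {u : E[N] → ℝ} {q : ℝ≥0∞}
    (hu : MemW1p Ω q u) : MemLp (weakGradient Ω u) q (volume.restrict Ω) :=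
  hu.2.choose_spec.2.ae_eq (hu.2.choose_spec.1.ae_eq hΩo hu.hasWeakGradient)

/-- Integrals against a fixed continuous function pass to limits in `L^p(Ω)`. -/
lemma tendsto_setIntegral_mul (hΩo : IsOpen Ω) (hb : Bornology.IsBounded Ω) {p : ℝ} (hp : 1 < p)
    {v : ℕ → E[N] → ℝ} {w k : E[N] → ℝ} (hk : Continuous k)
    (hv : ∀ n, MemLp (v n) (ENNReal.ofReal p) (volume.restrict Ω))
    (hw : MemLp w (ENNReal.ofReal p) (volume.restrict Ω))
    (h : Tendsto (fun n => eLpNorm (fun x => v n x - w x) (ENNReal.ofReal p) (volume.restrict Ω))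
      atTop (𝓝 0)) :
    Tendsto (fun n => ∫ x in Ω, v n x * k x) atTop (𝓝 (∫ x in Ω, w x * k x)) := by
  have hp1 : 1 ≤ ENNReal.ofReal p := by simpa using hp.le
  have hfin : IsFiniteMeasure (volume.restrict Ω) := isFiniteMeasure_restrict.2 hb.measure_lt_top.ne
  have := ENNReal.HolderConjugate.conjExponent hp1
  have hkq : MemLp k (ENNReal.conjExponent (ENNReal.ofReal p)) (volume.restrict Ω) :=
    memLp_of_continuous hb (ae_mem_closure_volume hΩo) hk _
  refine tendsto_integral_of_L1' _ (hkq.mul' hw (r := 1)).1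
    (Eventually.of_forall fun n => memLp_one_iff_integrable.1 (hkq.mul' (hv n))) ?_
  have h2 := ENNReal.Tendsto.mul_const h (Or.inr hkq.eLpNorm_ne_top)
  rw [zero_mul] at h2
  refine tendsto_of_tendsto_of_tendsto_of_le_of_le tendsto_const_nhds h2 (fun _ => zero_le)
    fun n => ?_
  have h3 : ((fun x => v n x * k x) - fun x => w x * k x) =
      (fun x => v n x - w x) • k := by
    ext x
    simp [sub_mul]
  simp only [h3]
  exact eLpNorm_smul_le_mul_eLpNorm hkq.1 ((hv n).sub hw).1

/-- The weak gradient is closed: strong limits of smooth functions and of their gradients are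
related by it. -/
lemma hasWeakGradient_of_tendsto (hΩo : IsOpen Ω) (hb : Bornology.IsBounded Ω) {p : ℝ}
    (hp : 1 < p) {φ : ℕ → E[N] → ℝ} (hφ : ∀ n, ContDiff ℝ ∞ (φ n)) {u : E[N] → ℝ}
    {G : E[N] → E[N]} (hu : MemLp u (ENNReal.ofReal p) (volume.restrict Ω))
    (hG : MemLp G (ENNReal.ofReal p) (volume.restrict Ω))
    (h0 : Tendsto (fun n => eLpNorm (fun x => φ n x - u x) (ENNReal.ofReal p)
      (volume.restrict Ω)) atTop (𝓝 0))
    (h1 : Tendsto (fun n => eLpNorm (fun x => gradient (φ n) x - G x) (ENNReal.ofReal p)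
      (volume.restrict Ω)) atTop (𝓝 0)) :
    HasWeakGradient Ω u G := by
  have hp1 : 1 ≤ ENNReal.ofReal p := by simpa using hp.le
  have hfin : IsFiniteMeasure (volume.restrict Ω) := isFiniteMeasure_restrict.2 hb.measure_lt_top.ne
  refine ⟨(show IntegrableOn u Ω volume from hu.integrable hp1).locallyIntegrableOn,
    (show IntegrableOn G Ω volume from hG.integrable hp1).locallyIntegrableOn,
    fun ψ hψ hψc hψs i => ?_⟩
  have hmem : ∀ {f : E[N] → ℝ}, Continuous f →
      MemLp f (ENNReal.ofReal p) (volume.restrict Ω) := fun hf =>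
    memLp_of_continuous hb (ae_mem_closure_volume hΩo) hf _
  have hgi : ∀ n, Continuous fun x => gradient (φ n) x i := fun n =>
    (EuclideanSpace.proj i : E[N] →L[ℝ] ℝ).continuous.comp (continuous_gradient (hφ n))
  have hdψ : Continuous fun x => fderiv ℝ ψ x (EuclideanSpace.single i 1) :=
    (hψ.continuous_fderiv (by simp)).clm_apply continuous_const
  have hGi : MemLp (fun x => G x i) (ENNReal.ofReal p) (volume.restrict Ω) :=
    (EuclideanSpace.proj i : E[N] →L[ℝ] ℝ).comp_memLp' hG
  have l0 := tendsto_setIntegral_mul hΩo hb hp hdψ (fun n => hmem (hφ n).continuous) hu h0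
  have l1 := tendsto_setIntegral_mul hΩo hb hp hψ.continuous (fun n => hmem (hgi n)) hGi
    (tendsto_of_tendsto_of_tendsto_of_le_of_le tendsto_const_nhds h1 (fun _ => zero_le) fun n =>
      eLpNorm_mono fun x => by
        rw [← PiLp.sub_apply]
        exact PiLp.norm_apply_le _ i)
  refine tendsto_nhds_unique l0 (l1.neg.congr fun n => ?_)
  have hsupp : ∀ {g : E[N] → ℝ}, (∀ x, x ∉ tsupport ψ → g x = 0) →
      ∫ x in Ω, g x = ∫ x, g x := fun hg =>
    setIntegral_eq_integral_of_forall_compl_eq_zero fun x hx => hg x fun h => hx (hψs h)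
  have hz : ∀ x, x ∉ tsupport ψ → ψ x = 0 := fun x hx => image_eq_zero_of_notMem_tsupport hx
  have hz' : ∀ x, x ∉ tsupport ψ → fderiv ℝ ψ x (EuclideanSpace.single i 1) = 0 := fun x hx => by
    rw [image_eq_zero_of_notMem_tsupport fun h => hx (tsupport_fderiv_subset ℝ h)]
    rfl
  rw [hsupp fun x hx => by rw [hz x hx, mul_zero], hsupp fun x hx => by rw [hz' x hx, mul_zero]]
  simp only [gradient_apply]
  have hint : ∀ {g : E[N] → ℝ}, Continuous g → (∀ x, x ∉ tsupport ψ → g x = 0) →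
      Integrable g := fun hg h0 =>
    hg.integrable_of_hasCompactSupport (HasCompactSupport.intro hψc h0)
  have hdφ : Continuous fun x => fderiv ℝ (φ n) x (EuclideanSpace.single i 1) :=
    ((hφ n).continuous_fderiv (by simp)).clm_apply continuous_const
  exact (integral_mul_fderiv_eq_neg_fderiv_mul_of_integrable
    (hint (hdφ.mul hψ.continuous) fun x hx => by simp [hz x hx])
    (hint ((hφ n).continuous.mul hdψ) fun x hx => by simp [hz' x hx])
    (hint ((hφ n).continuous.mul hψ.continuous) fun x hx => by simp [hz x hx])
    (fun x _ => (hφ n).differentiable (by simp) x) fun x _ => hψ.differentiable (by simp) x).symm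

end WeakGradient

/-! ### Traces -/

section Trace

local notation "E[" n "]" => EuclideanSpace ℝ (Fin n)

variable {N : ℕ} {Ω : Set (EuclideanSpace ℝ (Fin N))} {ι : Type} [Fintype ι]

lemma gradient_sub {φ ψ : E[N] → ℝ} (hφ : ContDiff ℝ ∞ φ) (hψ : ContDiff ℝ ∞ ψ) (x : E[N]) :
    gradient (fun y => φ y - ψ y) x = gradient φ x - gradient ψ x := by
  rw [gradient, fderiv_fun_sub (hφ.differentiable (by simp) x) (hψ.differentiable (by simp) x),
    map_sub]
  rfl

/-- For smooth functions with bounded gradients, smallness in `L^p(Ω)` passes to the boundary. -/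
lemma InwardPartition.tendsto_trace_of_bounded (P : InwardPartition Ω ι) {p : ℝ} (hp : 1 < p)
    {κ : Type*} {l : Filter κ} {φ : κ → E[N] → ℝ} (hφ : ∀ n, ContDiff ℝ ∞ (φ n))
    (h0 : Tendsto (fun n => eLpNorm (φ n) (ENNReal.ofReal p) (volume.restrict Ω)) l (𝓝 0))
    {M : ℝ≥0} (hM : ∀ n, eLpNorm (gradient (φ n)) (ENNReal.ofReal p) (volume.restrict Ω) ≤ M) :
    Tendsto (fun n => eLpNorm (φ n) (ENNReal.ofReal p) (surfaceMeasure Ω)) l (𝓝 0) := by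
  have hp0 : 0 < p := by linarith
  have hpow : Tendsto (fun n => eLpNorm (φ n) (ENNReal.ofReal p) (surfaceMeasure Ω) ^ p) l
      (𝓝 0) := by
    rw [ENNReal.tendsto_nhds_zero]
    intro δ hδ
    obtain ⟨ε, hε, hεδ⟩ := ENNReal.lt_iff_exists_nnreal_btwn.1 hδ
    have hε0 : 0 < ε := by exact_mod_cast hε
    obtain ⟨K, hK⟩ := P.exists_trace_le hp (ε := ε / 2 / (M ^ p + 1)) (by positivity)
    have e0 := (ENNReal.continuous_rpow_const (y := p)).tendsto 0
    rw [ENNReal.zero_rpow_of_pos hp0] at e0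
    have e1 := ENNReal.Tendsto.const_mul (a := (K : ℝ≥0∞)) (e0.comp h0)
      (Or.inr ENNReal.coe_ne_top)
    rw [mul_zero, ENNReal.tendsto_nhds_zero] at e1
    filter_upwards [e1 (ε / 2 : ℝ≥0) (by exact_mod_cast half_pos hε0)] with n hn
    rw [eLpNorm_rpow hp]
    refine ((hK _ (hφ n)).trans ?_).trans hεδ.le
    rw [← eLpNorm_rpow hp, ← eLpNorm_rpow hp]
    calc _ ≤ ((ε / 2 / (M ^ p + 1) : ℝ≥0) : ℝ≥0∞) * (M : ℝ≥0∞) ^ p + (ε / 2 : ℝ≥0) := by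
          gcongr
          · exact hM n
          · exact hn
      _ ≤ ε := by
          rw [← ENNReal.coe_rpow_of_nonneg _ hp0.le]
          norm_cast
          calc ε / 2 / (M ^ p + 1) * M ^ p + ε / 2 ≤ ε / 2 / (M ^ p + 1) * (M ^ p + 1) + ε / 2 := by
                gcongr
                exact le_self_add
            _ = ε := by rw [div_mul_cancel₀ _ (by positivity), add_halves]
  have e2 := (ENNReal.continuous_rpow_const (y := p⁻¹)).tendsto 0
  rw [ENNReal.zero_rpow_of_pos (inv_pos.2 hp0)] at e2
  refine (e2.comp hpow).congr fun n => ?_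
  rw [Function.comp_apply, ENNReal.rpow_rpow_inv hp0.ne']

lemma tendsto_eLpNorm_sub_prod {X : Type*} [MeasurableSpace X] {μ : Measure X} {q : ℝ≥0∞}
    (hq : 1 ≤ q) {v : ℕ → X → ℝ} {w : X → ℝ} (hv : ∀ n, AEStronglyMeasurable (v n) μ)
    (hw : AEStronglyMeasurable w μ)
    (h : Tendsto (fun n => eLpNorm (fun x => v n x - w x) q μ) atTop (𝓝 0)) :
    Tendsto (fun m : ℕ × ℕ => eLpNorm (fun x => v m.1 x - v m.2 x) q μ) atTop (𝓝 0) := by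
  rw [← prod_atTop_atTop_eq]
  have h1 := (h.comp tendsto_fst).add (h.comp (tendsto_snd (f := (atTop : Filter ℕ))))
  rw [add_zero] at h1
  refine tendsto_of_tendsto_of_tendsto_of_le_of_le tendsto_const_nhds h1 (fun _ => zero_le)
    fun m => ?_
  have h2 : (fun x => v m.1 x - v m.2 x) =
      (fun x => v m.1 x - w x) - fun x => v m.2 x - w x := by
    ext x
    simp
  rw [h2]
  exact eLpNorm_sub_le ((hv _).sub hw) ((hv _).sub hw) hq

/-- The boundary values of smooth functions with bounded gradients that converge in `L^p(Ω)`
converge in `L^p(∂Ω)`. -/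
lemma InwardPartition.exists_tendsto_trace (P : InwardPartition Ω ι) (hb : Bornology.IsBounded Ω)
    {p : ℝ} (hp : 1 < p)
    {φ : ℕ → E[N] → ℝ} (hφ : ∀ n, ContDiff ℝ ∞ (φ n)) {u : E[N] → ℝ}
    (hu : MemLp u (ENNReal.ofReal p) (volume.restrict Ω))
    (h0 : Tendsto (fun n => eLpNorm (fun x => φ n x - u x) (ENNReal.ofReal p)
      (volume.restrict Ω)) atTop (𝓝 0))
    {M : ℝ≥0} (hM : ∀ n, eLpNorm (gradient (φ n)) (ENNReal.ofReal p) (volume.restrict Ω) ≤ M) :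
    ∃ g, MemLp g (ENNReal.ofReal p) (surfaceMeasure Ω) ∧
      Tendsto (fun n => eLpNorm (fun x => φ n x - g x) (ENNReal.ofReal p) (surfaceMeasure Ω))
        atTop (𝓝 0) := by
  have hp1 : 1 ≤ ENNReal.ofReal p := by simpa using hp.le
  have : Fact (1 ≤ ENNReal.ofReal p) := ⟨hp1⟩
  have hsfin := P.isFiniteMeasure_surfaceMeasure hb
  have hmem : ∀ n, MemLp (φ n) (ENNReal.ofReal p) (surfaceMeasure Ω) := fun n =>
    memLp_of_continuous hb ae_mem_closure_surfaceMeasure (hφ n).continuous _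
  have h1 := tendsto_eLpNorm_sub_prod hp1 (fun n => (hφ n).continuous.aestronglyMeasurable) hu.1 h0
  have h2 := P.tendsto_trace_of_bounded hp (M := M + M)
    (φ := fun (m : ℕ × ℕ) x => φ m.1 x - φ m.2 x) (fun m => (hφ _).sub (hφ _)) h1 (fun m => by
      rw [show gradient (fun x => φ m.1 x - φ m.2 x) = gradient (φ m.1) - gradient (φ m.2) from
        funext fun x => gradient_sub (hφ _) (hφ _) x, ENNReal.coe_add]
      exact (eLpNorm_sub_le (continuous_gradient (hφ _)).aestronglyMeasurable
        (continuous_gradient (hφ _)).aestronglyMeasurable hp1).trans (add_le_add (hM _) (hM _)))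
  have hC : CauchySeq fun n => (hmem n).toLp (φ n) := by
    rw [cauchySeq_iff_tendsto_dist_atTop_0]
    have h3 := (ENNReal.tendsto_toReal ENNReal.zero_ne_top).comp h2
    rw [ENNReal.toReal_zero] at h3
    refine h3.congr fun m => ?_
    rw [dist_edist, Lp.edist_toLp_toLp]
    rfl
  obtain ⟨l, hl⟩ := cauchySeq_tendsto_of_complete hC
  refine ⟨l, Lp.memLp l, ?_⟩
  rw [← Lp.toLp_coeFn l (Lp.memLp l)] at hl
  exact (Lp.tendsto_Lp_iff_tendsto_eLpNorm'' _ hmem _ (Lp.memLp l)).1 hl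

lemma isTrace_of_tendsto (hΩo : IsOpen Ω) {q : ℝ≥0∞} {φ : ℕ → E[N] → ℝ}
    (hφ : ∀ n, ContDiff ℝ ∞ (φ n)) {u g : E[N] → ℝ} {G : E[N] → E[N]}
    (hw : HasWeakGradient Ω u G) (hg : MemLp g q (surfaceMeasure Ω))
    (h0 : Tendsto (fun n => eLpNorm (fun x => φ n x - u x) q (volume.restrict Ω)) atTop (𝓝 0))
    (h1 : Tendsto (fun n => eLpNorm (fun x => gradient (φ n) x - G x) q (volume.restrict Ω))
      atTop (𝓝 0))
    (h2 : Tendsto (fun n => eLpNorm (fun x => φ n x - g x) q (surfaceMeasure Ω)) atTop (𝓝 0)) :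
    IsTrace Ω q u g := by
  refine ⟨hg, φ, hφ, h0, h1.congr fun n => eLpNorm_congr_ae ?_, h2⟩
  filter_upwards [hw.ae_eq hΩo hw.weakGradient] with x hx
  rw [hx]

lemma tendsto_eLpNorm_sub_of_tendsto {X F : Type*} [MeasurableSpace X] {μ : Measure X}
    [NormedAddCommGroup F] {q : ℝ≥0∞} (hq : 1 ≤ q) {v v' : ℕ → X → F} {w : X → F}
    (hv : ∀ n, AEStronglyMeasurable (v n) μ) (hv' : ∀ n, AEStronglyMeasurable (v' n) μ)
    (hw : AEStronglyMeasurable w μ)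
    (h : Tendsto (fun n => eLpNorm (fun x => v n x - w x) q μ) atTop (𝓝 0))
    (h' : Tendsto (fun n => eLpNorm (fun x => v' n x - w x) q μ) atTop (𝓝 0)) :
    Tendsto (fun n => eLpNorm (fun x => v n x - v' n x) q μ) atTop (𝓝 0) := by
  have h1 := h.add h'
  rw [add_zero] at h1
  refine tendsto_of_tendsto_of_tendsto_of_le_of_le tendsto_const_nhds h1 (fun _ => zero_le)
    fun n => ?_
  have h2 : (fun x => v n x - v' n x) = (fun x => v n x - w x) - fun x => v' n x - w x := by
    ext1 x
    simp
  rw [h2]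
  exact eLpNorm_sub_le ((hv n).sub hw) ((hv' n).sub hw) hq

lemma ae_eq_of_tendsto_eLpNorm {X F : Type*} [MeasurableSpace X] {μ : Measure X}
    [NormedAddCommGroup F] {q : ℝ≥0∞} (hq : 1 ≤ q) {v : ℕ → X → F} {w w' : X → F}
    (hv : ∀ n, AEStronglyMeasurable (v n) μ) (hw : AEStronglyMeasurable w μ)
    (hw' : AEStronglyMeasurable w' μ)
    (h : Tendsto (fun n => eLpNorm (fun x => v n x - w x) q μ) atTop (𝓝 0))
    (h' : Tendsto (fun n => eLpNorm (fun x => v n x - w' x) q μ) atTop (𝓝 0)) : w =ᵐ[μ] w' := by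
  have h1 := h.add h'
  rw [add_zero] at h1
  have h2 : eLpNorm (w - w') q μ ≤ 0 := ge_of_tendsto' h1 fun n => by
    have h3 : w - w' = (fun x => v n x - w' x) - fun x => v n x - w x := by
      ext1 x
      simp
    rw [h3, add_comm]
    exact eLpNorm_sub_le ((hv n).sub hw') ((hv n).sub hw) hq
  have h4 := (eLpNorm_eq_zero_iff (hw.sub hw') (by positivity)).1 (le_antisymm h2 zero_le)
  filter_upwards [h4] with x hx
  exact sub_eq_zero.1 hx

/-- Traces are unique: the boundary values of two approximating sequences have the same limit. -/
lemma IsTrace.ae_eq (P : InwardPartition Ω ι) (hΩo : IsOpen Ω) {p : ℝ} (hp : 1 < p)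
    {u g g' : E[N] → ℝ} (hu : MemW1p Ω (ENNReal.ofReal p) u)
    (h : IsTrace Ω (ENNReal.ofReal p) u g) (h' : IsTrace Ω (ENNReal.ofReal p) u g') :
    g =ᵐ[surfaceMeasure Ω] g' := by
  have hp1 : 1 ≤ ENNReal.ofReal p := by simpa using hp.le
  obtain ⟨hg, φ, hφ, h0, h1, h2⟩ := h
  obtain ⟨hg', φ', hφ', h0', h1', h2'⟩ := h'
  have hm : ∀ {f : E[N] → ℝ} {μ : Measure E[N]}, ContDiff ℝ ∞ f → AEStronglyMeasurable f μ :=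
    fun hf => hf.continuous.aestronglyMeasurable
  have hmg : ∀ {f : E[N] → ℝ} {μ : Measure E[N]}, ContDiff ℝ ∞ f →
    AEStronglyMeasurable (gradient f) μ :=
    fun hf => (continuous_gradient hf).aestronglyMeasurable
  have h3 := P.tendsto_trace hp (fun n => (hφ n).sub (hφ' n))
    (tendsto_eLpNorm_sub_of_tendsto hp1 (fun n => hm (hφ n)) (fun n => hm (hφ' n)) hu.1.1 h0 h0')
    ((tendsto_eLpNorm_sub_of_tendsto hp1 (fun n => hmg (hφ n)) (fun n => hmg (hφ' n))
      (hu.memLp_weakGradient hΩo).1 h1 h1').congr fun n => by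
        congr 1
        ext1 x
        exact (gradient_sub (hφ n) (hφ' n) x).symm)
  refine ae_eq_of_tendsto_eLpNorm hp1 (fun n => hm (hφ n)) hg.1 hg'.1 h2 ?_
  have h4 := h3.add h2'
  rw [add_zero] at h4
  refine tendsto_of_tendsto_of_tendsto_of_le_of_le tendsto_const_nhds h4 (fun _ => zero_le)
    fun n => ?_
  have h5 : (fun x => φ n x - g' x) = (fun x => φ n x - φ' n x) + fun x => φ' n x - g' x := by
    ext1 x
    simp
  rw [h5]
  exact eLpNorm_add_le ((hm (hφ n)).sub (hm (hφ' n))) ((hm (hφ' n)).sub hg'.1) hp1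

/-- Every function in `W^{1,p}(Ω)` has a trace, so that `trace` does not take its default value. -/
lemma isTrace_trace (P : InwardPartition Ω ι) (hΩo : IsOpen Ω) (hb : Bornology.IsBounded Ω)
    {p : ℝ} (hp : 1 < p) {u : E[N] → ℝ} (hu : MemW1p Ω (ENNReal.ofReal p) u) :
    IsTrace Ω (ENNReal.ofReal p) u (trace Ω (ENNReal.ofReal p) u) := by
  have hp1 : 1 ≤ ENNReal.ofReal p := by simpa using hp.le
  have hex : ∃ g, IsTrace Ω (ENNReal.ofReal p) u g := by
    have hG := hu.memLp_weakGradient hΩo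
    choose φ hφ h0 h1 using fun n : ℕ => exists_contDiff_approx P hΩo hb hp hu.1 hG
      hu.hasWeakGradient (ε := ((n + 1 : ℕ) : ℝ≥0∞)⁻¹) (by simp)
    have hinv : Tendsto (fun n : ℕ => ((n + 1 : ℕ) : ℝ≥0∞)⁻¹) atTop (𝓝 0) :=
      ENNReal.tendsto_inv_nat_nhds_zero.comp (tendsto_add_atTop_nat 1)
    have l0 := tendsto_of_tendsto_of_tendsto_of_le_of_le tendsto_const_nhds hinv
      (fun _ => zero_le) h0
    have l1 := tendsto_of_tendsto_of_tendsto_of_le_of_le tendsto_const_nhds hinv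
      (fun _ => zero_le) h1
    obtain ⟨g, hg, l2⟩ := P.exists_tendsto_trace hb hp hφ hu.1 l0
      (M := 1 + (eLpNorm (weakGradient Ω u) (ENNReal.ofReal p) (volume.restrict Ω)).toNNReal)
      fun n => by
        rw [ENNReal.coe_add, ENNReal.coe_toNNReal hG.eLpNorm_ne_top]
        have h5 : gradient (φ n) =
            (fun x => gradient (φ n) x - weakGradient Ω u x) + weakGradient Ω u := by
          ext1 x
          simp
        rw [h5]
        refine (eLpNorm_add_le ((continuous_gradient (hφ n)).aestronglyMeasurable.sub hG.1) hG.1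
          hp1).trans (add_le_add_left ((h1 n).trans ?_) _)
        simp
    exact ⟨g, isTrace_of_tendsto hΩo hφ hu.hasWeakGradient hg l0 l1 l2⟩
  rw [trace, dif_pos hex]
  exact hex.choose_spec

end Trace

/-! ### Compactness in the Sobolev space -/

section Compactness

lemma coeFn_sum_smul_toLp {X F : Type*} [MeasurableSpace X] {μ : Measure X}
    [NormedAddCommGroup F] [NormedSpace ℝ F] {q : ℝ≥0∞} {v : ℕ → X → F}
    (hv : ∀ n, MemLp (v n) q μ) (t : Finset ℕ) (a : ℕ → ℝ) :
    ⇑(∑ n ∈ t, a n • (hv n).toLp (v n)) =ᵐ[μ] fun x => ∑ n ∈ t, a n • v n x := by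
  induction t using Finset.induction_on with
  | empty =>
    simp only [Finset.sum_empty]
    exact Lp.coeFn_zero F q μ
  | insert i t hi ih =>
    rw [Finset.sum_insert hi]
    filter_upwards [ih, Lp.coeFn_add (a i • (hv i).toLp (v i)) (∑ n ∈ t, a n • (hv n).toLp (v n)),
      Lp.coeFn_smul (a i) ((hv i).toLp (v i)), (hv i).coeFn_toLp] with x h1 h2 h3 h4
    rw [h2, Pi.add_apply, h3, Pi.smul_apply, h4, h1, Finset.sum_insert hi]

lemma tendsto_eLpNorm_sum_smul {X F : Type*} [MeasurableSpace X] {μ : Measure X}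
    [NormedAddCommGroup F] [NormedSpace ℝ F] {q : ℝ≥0∞} [Fact (1 ≤ q)] {v : ℕ → X → F}
    (hv : ∀ n, MemLp (v n) q μ) {s : ℕ → Finset ℕ} {c : ℕ → ℕ → ℝ} {l : Lp F q μ}
    (h : Tendsto (fun k => ∑ n ∈ s k, c k n • (hv n).toLp (v n)) atTop (𝓝 l)) :
    Tendsto (fun k => eLpNorm (fun x => ∑ n ∈ s k, c k n • v n x - l x) q μ) atTop (𝓝 0) := by
  rw [Lp.tendsto_Lp_iff_tendsto_eLpNorm'] at h
  refine h.congr fun k => eLpNorm_congr_ae ?_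
  filter_upwards [coeFn_sum_smul_toLp hv (s k) (c k)] with x hx
  rw [Pi.sub_apply, hx]

lemma IsTailWeights.tendsto_eLpNorm {s c} (hsc : IsTailWeights s c) {X F : Type*}
    [MeasurableSpace X] {μ : Measure X} [NormedAddCommGroup F] [NormedSpace ℝ F] {q : ℝ≥0∞}
    (hq : 1 ≤ q) {v : ℕ → X → F} {w : X → F} (hv : ∀ n, MemLp (v n) q μ) (hw : MemLp w q μ)
    (h : Tendsto (fun n => eLpNorm (fun x => v n x - w x) q μ) atTop (𝓝 0)) :
    Tendsto (fun k => eLpNorm (fun x => ∑ n ∈ s k, c k n • v n x - w x) q μ) atTop (𝓝 0) := by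
  have : Fact (1 ≤ q) := ⟨hq⟩
  have h1 := (Lp.tendsto_Lp_iff_tendsto_eLpNorm'' v hv w hw).2 h
  refine (tendsto_eLpNorm_sum_smul hv (hsc.tendsto h1)).congr fun k => eLpNorm_congr_ae ?_
  filter_upwards [hw.coeFn_toLp] with x hx
  rw [hx]

lemma IsTailWeights.comp {s c} (hsc : IsTailWeights s c) {τ : ℕ → ℕ} (hτ : StrictMono τ) :
    IsTailWeights (fun k => s (τ k)) fun k => c (τ k) where
  le k n hn := (hτ.id_le k).trans (hsc.le _ n hn)
  nonneg _ := hsc.nonneg _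
  sum_eq_one _ := hsc.sum_eq_one _

lemma tendsto_eLpNorm_sub_trans {X F : Type*} [MeasurableSpace X] {μ : Measure X}
    [NormedAddCommGroup F] {q : ℝ≥0∞} (hq : 1 ≤ q) {v v' : ℕ → X → F} {w : X → F}
    (hv : ∀ n, AEStronglyMeasurable (v n) μ) (hv' : ∀ n, AEStronglyMeasurable (v' n) μ)
    (hw : AEStronglyMeasurable w μ)
    (h : Tendsto (fun n => eLpNorm (fun x => v n x - v' n x) q μ) atTop (𝓝 0))
    (h' : Tendsto (fun n => eLpNorm (fun x => v n x - w x) q μ) atTop (𝓝 0)) :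
    Tendsto (fun n => eLpNorm (fun x => v' n x - w x) q μ) atTop (𝓝 0) := by
  have h1 := h'.add h
  rw [add_zero] at h1
  refine tendsto_of_tendsto_of_tendsto_of_le_of_le tendsto_const_nhds h1 (fun _ => zero_le)
    fun n => ?_
  have h2 : (fun x => v' n x - w x) = (fun x => v n x - w x) - fun x => v n x - v' n x := by
    ext1 x
    simp
  rw [h2]
  exact eLpNorm_sub_le ((hv n).sub hw) ((hv n).sub (hv' n)) hq

lemma exists_subseq_tendsto_ae {X F : Type*} [MeasurableSpace X] {μ : Measure X}
    [NormedAddCommGroup F] {q : ℝ≥0∞} (hq : 1 ≤ q) {v : ℕ → X → F} {w : X → F}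
    (hv : ∀ n, AEStronglyMeasurable (v n) μ) (hw : AEStronglyMeasurable w μ)
    (h : Tendsto (fun n => eLpNorm (fun x => v n x - w x) q μ) atTop (𝓝 0)) :
    ∃ τ : ℕ → ℕ, StrictMono τ ∧ ∀ᵐ x ∂μ, Tendsto (fun n => v (τ n) x) atTop (𝓝 (w x)) :=
  (tendstoInMeasure_of_tendsto_eLpNorm (by positivity) hv hw h).exists_seq_tendsto_ae

local notation "E[" n "]" => EuclideanSpace ℝ (Fin n)

variable {N : ℕ} {Ω : Set (EuclideanSpace ℝ (Fin N))} {ι : Type} [Fintype ι]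

lemma gradient_sum_smul {φ : ℕ → E[N] → ℝ} (hφ : ∀ n, ContDiff ℝ ∞ (φ n)) (t : Finset ℕ)
    (a : ℕ → ℝ) (x : E[N]) :
    gradient (fun y => ∑ n ∈ t, a n • φ n y) x = ∑ n ∈ t, a n • gradient (φ n) x := by
  have hd : ∀ n, DifferentiableAt ℝ (φ n) x := fun n => (hφ n).differentiable (by simp) x
  rw [gradient, fderiv_fun_sum (A := fun n y => a n • φ n y) fun n _ => (hd n).fun_const_smul (a n),
    map_sum]
  refine Finset.sum_congr rfl fun n _ => ?_
  rw [fderiv_fun_const_smul (hd n), map_smulₛₗ]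
  rfl

/-- A sequence with bounded gradients and bounded traces on a piece of the boundary of positive
measure has a subsequence that converges almost everywhere in `Ω`, whose traces converge in
`L^p(∂Ω)`, and whose gradients converge almost everywhere after passing to convex combinations of
tails. -/
theorem InwardPartition.exists_weak_limit (P : InwardPartition Ω ι) (hΩo : IsOpen Ω)
    (hΩc : IsConnected Ω) (hb : Bornology.IsBounded Ω) {p : ℝ} (hp : 1 < p) {S : Set E[N]}
    (hS : surfaceMeasure Ω S ≠ 0) {u : ℕ → E[N] → ℝ}
    (hu : ∀ n, MemW1p Ω (ENNReal.ofReal p) (u n)) {R : ℝ≥0}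
    (hR : ∀ n, eLpNorm (weakGradient Ω (u n)) (ENNReal.ofReal p) (volume.restrict Ω) ≤ R)
    (hT : ∀ n, ∫⁻ x in S, ‖trace Ω (ENNReal.ofReal p) (u n) x‖ₑ ∂(surfaceMeasure Ω) ≤ R) :
    ∃ (σ : ℕ → ℕ) (v : E[N] → ℝ) (s : ℕ → Finset ℕ) (c : ℕ → ℕ → ℝ),
      StrictMono σ ∧ MemW1p Ω (ENNReal.ofReal p) v ∧ IsTailWeights s c ∧
      (∀ᵐ x ∂(volume.restrict Ω), Tendsto (fun n => u (σ n) x) atTop (𝓝 (v x))) ∧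
      (∀ᵐ x ∂(volume.restrict Ω), Tendsto (fun k => ∑ n ∈ s k, c k n • weakGradient Ω (u (σ n)) x)
        atTop (𝓝 (weakGradient Ω v x))) ∧
      Tendsto (fun n => eLpNorm (fun x => trace Ω (ENNReal.ofReal p) (u (σ n)) x -
        trace Ω (ENNReal.ofReal p) v x) (ENNReal.ofReal p) (surfaceMeasure Ω)) atTop (𝓝 0) := by
  have hp0 : 0 < p := by linarith
  have hp1 : 1 ≤ ENNReal.ofReal p := by simpa using hp.le
  have hfact : Fact (1 ≤ ENNReal.ofReal p) := ⟨hp1⟩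
  have hsfin := P.isFiniteMeasure_surfaceMeasure hb
  have hfin : IsFiniteMeasure (volume.restrict Ω) := isFiniteMeasure_restrict.2 hb.measure_lt_top.ne
  have htr := fun n => isTrace_trace P hΩo hb hp (hu n)
  have hGm := fun n => (hu n).memLp_weakGradient hΩo
  -- smooth approximations, with errors tending to zero
  have hex : ∀ n : ℕ, ∃ φ : E[N] → ℝ, ContDiff ℝ ∞ φ ∧
      eLpNorm (fun x => φ x - u n x) (ENNReal.ofReal p) (volume.restrict Ω) ≤
        ((n + 1 : ℕ) : ℝ≥0∞)⁻¹ ∧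
      eLpNorm (fun x => gradient φ x - weakGradient Ω (u n) x) (ENNReal.ofReal p)
        (volume.restrict Ω) ≤ ((n + 1 : ℕ) : ℝ≥0∞)⁻¹ ∧
      eLpNorm (fun x => φ x - trace Ω (ENNReal.ofReal p) (u n) x) (ENNReal.ofReal p)
        (surfaceMeasure Ω) ≤ ((n + 1 : ℕ) : ℝ≥0∞)⁻¹ := by
    intro n
    obtain ⟨-, φ, hφ, h0, h1, h2⟩ := htr n
    have hε : (0 : ℝ≥0∞) < ((n + 1 : ℕ) : ℝ≥0∞)⁻¹ := by simp
    obtain ⟨k, a, b, c⟩ := ((ENNReal.tendsto_nhds_zero.1 h0 _ hε).and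
      ((ENNReal.tendsto_nhds_zero.1 h1 _ hε).and (ENNReal.tendsto_nhds_zero.1 h2 _ hε))).exists
    exact ⟨φ k, hφ k, a, b, c⟩
  choose φ hφ h0 h1 h2 using hex
  have hinv : Tendsto (fun n : ℕ => ((n + 1 : ℕ) : ℝ≥0∞)⁻¹) atTop (𝓝 0) :=
    ENNReal.tendsto_inv_nat_nhds_zero.comp (tendsto_add_atTop_nat 1)
  have hinv1 : ∀ n : ℕ, ((n + 1 : ℕ) : ℝ≥0∞)⁻¹ ≤ 1 := fun n => by simp
  have l0 := tendsto_of_tendsto_of_tendsto_of_le_of_le tendsto_const_nhds hinv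
    (fun _ => zero_le) h0
  have l1 := tendsto_of_tendsto_of_tendsto_of_le_of_le tendsto_const_nhds hinv
    (fun _ => zero_le) h1
  have l2 := tendsto_of_tendsto_of_tendsto_of_le_of_le tendsto_const_nhds hinv
    (fun _ => zero_le) h2
  have hφm : ∀ n, AEStronglyMeasurable (φ n) (volume.restrict Ω) := fun n =>
    (hφ n).continuous.aestronglyMeasurable
  have hφs : ∀ n, AEStronglyMeasurable (φ n) (surfaceMeasure Ω) := fun n =>
    (hφ n).continuous.aestronglyMeasurable
  have hgm : ∀ n, AEStronglyMeasurable (gradient (φ n)) (volume.restrict Ω) := fun n =>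
    (continuous_gradient (hφ n)).aestronglyMeasurable
  -- the approximations are bounded in the Sobolev space
  have hgrad : ∀ n, eLpNorm (gradient (φ n)) (ENNReal.ofReal p) (volume.restrict Ω) ≤
      (1 + R : ℝ≥0) := by
    intro n
    have e : gradient (φ n) =
        (fun x => gradient (φ n) x - weakGradient Ω (u n) x) + weakGradient Ω (u n) := by
      ext1 x
      simp
    rw [e, ENNReal.coe_add, ENNReal.coe_one]
    exact (eLpNorm_add_le ((hgm n).sub (hGm n).1) (hGm n).1 hp1).trans
      (add_le_add ((h1 n).trans (hinv1 n)) (hR n))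
  obtain ⟨A, hA⟩ : ∃ A : ℝ≥0, ∀ n, ∫⁻ x in S, ‖φ n x‖ₑ ∂(surfaceMeasure Ω) ≤ A := by
    have hexp : 0 ≤ 1 / (1 : ℝ≥0∞).toReal - 1 / (ENNReal.ofReal p).toReal := by
      rw [ENNReal.toReal_ofReal hp0.le, ENNReal.toReal_one, div_one, sub_nonneg, div_le_one hp0]
      exact hp.le
    obtain ⟨B, hB⟩ : ∃ B : ℝ≥0, (B : ℝ≥0∞) = surfaceMeasure Ω univ ^
        (1 / (1 : ℝ≥0∞).toReal - 1 / (ENNReal.ofReal p).toReal) :=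
      ⟨_, ENNReal.coe_toNNReal
        (ENNReal.rpow_ne_top_of_nonneg hexp (measure_ne_top (surfaceMeasure Ω) univ))⟩
    refine ⟨B + R, fun n => ?_⟩
    calc ∫⁻ x in S, ‖φ n x‖ₑ ∂(surfaceMeasure Ω)
        ≤ ∫⁻ x in S, (‖φ n x - trace Ω (ENNReal.ofReal p) (u n) x‖ₑ +
            ‖trace Ω (ENNReal.ofReal p) (u n) x‖ₑ) ∂(surfaceMeasure Ω) := by
          refine lintegral_mono fun x => ?_
          calc ‖φ n x‖ₑ = ‖(φ n x - trace Ω (ENNReal.ofReal p) (u n) x) +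
                trace Ω (ENNReal.ofReal p) (u n) x‖ₑ := by rw [sub_add_cancel]
            _ ≤ _ := enorm_add_le _ _
      _ = (∫⁻ x in S, ‖φ n x - trace Ω (ENNReal.ofReal p) (u n) x‖ₑ ∂(surfaceMeasure Ω)) +
            ∫⁻ x in S, ‖trace Ω (ENNReal.ofReal p) (u n) x‖ₑ ∂(surfaceMeasure Ω) :=
          lintegral_add_left' (((hφs n).sub (htr n).1.1).enorm.mono_measure
            Measure.restrict_le_self) _
      _ ≤ (∫⁻ x, ‖φ n x - trace Ω (ENNReal.ofReal p) (u n) x‖ₑ ∂(surfaceMeasure Ω)) + R := by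
          gcongr
          · exact Measure.restrict_le_self
          · exact hT n
      _ ≤ 1 * B + R := by
          gcongr
          rw [← eLpNorm_one_eq_lintegral_enorm]
          refine (eLpNorm_le_eLpNorm_mul_rpow_measure_univ hp1
            ((hφs n).sub (htr n).1.1)).trans ?_
          rw [← hB]
          gcongr
          exact (h2 n).trans (hinv1 n)
      _ = _ := by rw [one_mul, ENNReal.coe_add]
  obtain ⟨K, hK⟩ := P.exists_poincare_le hΩo hΩc hb hp hS
  have hnorm : ∀ n, eLpNorm (φ n) (ENNReal.ofReal p) (volume.restrict Ω) ≤
      (K * (1 + R + A) : ℝ≥0) := by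
    intro n
    rw [ENNReal.coe_mul, ENNReal.coe_add]
    exact (hK _ (hφ n)).trans (mul_le_mul_right (add_le_add (hgrad n) (hA n)) _)
  obtain ⟨v, σ₁, hv, hσ₁, hlim⟩ := P.exists_subseq_tendsto hΩo hb hp hφ
    (M := (K * (1 + R + A)) ^ p + (1 + R) ^ p) fun n => by
      rw [sobolevEnergy, ← eLpNorm_rpow hp, ← eLpNorm_rpow hp, ENNReal.coe_add,
        ENNReal.coe_rpow_of_nonneg _ hp0.le, ENNReal.coe_rpow_of_nonneg _ hp0.le]
      gcongr
      · exact hnorm n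
      · exact hgrad n
  have hulim := tendsto_eLpNorm_sub_trans hp1 (fun n => hφm (σ₁ n)) (fun n => (hu (σ₁ n)).1.1) hv.1
    (l0.comp hσ₁.tendsto_atTop) hlim
  obtain ⟨σ₂, hσ₂, hae⟩ := exists_subseq_tendsto_ae hp1 (fun n => (hu (σ₁ n)).1.1) hv.1 hulim
  let σ : ℕ → ℕ := fun n => σ₁ (σ₂ n)
  have hσ : StrictMono σ := hσ₁.comp hσ₂
  have hlimσ : Tendsto (fun n => eLpNorm (fun x => φ (σ n) x - v x) (ENNReal.ofReal p)
      (volume.restrict Ω)) atTop (𝓝 0) := hlim.comp hσ₂.tendsto_atTop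
  obtain ⟨g, hg, hglim⟩ := P.exists_tendsto_trace hb hp (fun n => hφ (σ n)) hv hlimσ
    fun n => hgrad (σ n)
  obtain ⟨s, c, hsc, l, hl⟩ := exists_tailWeights_tendsto_Lp hp
    (fun n => (hGm (σ n)).toLp (weakGradient Ω (u (σ n)))) (R := R) fun n => by
      rw [Lp.norm_toLp]
      exact ENNReal.toReal_le_coe_of_le_coe (hR (σ n))
  have hGlim := tendsto_eLpNorm_sum_smul (fun n => hGm (σ n)) hl
  have hsum : ∀ {F : Type} [NormedAddCommGroup F] [NormedSpace ℝ F] {μ : Measure E[N]}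
      {w : ℕ → E[N] → F}, (∀ n, AEStronglyMeasurable (w n) μ) → ∀ k,
      AEStronglyMeasurable (fun x => ∑ n ∈ s k, c k n • w n x) μ := fun hw k =>
    Finset.aestronglyMeasurable_fun_sum _ fun n _ => (hw n).const_smul _
  obtain ⟨τ, hτ, hGae⟩ := exists_subseq_tendsto_ae hp1 (hsum fun n => (hGm (σ n)).1)
    (Lp.memLp l).1 hGlim
  -- the same convex combinations of the smooth approximations identify the limits
  have hmem : ∀ {f : E[N] → ℝ} , ContDiff ℝ ∞ f →
      MemLp f (ENNReal.ofReal p) (volume.restrict Ω) := fun hf =>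
    memLp_of_continuous hb (ae_mem_closure_volume hΩo) hf.continuous _
  have hψ : ∀ k, ContDiff ℝ ∞ fun x => ∑ n ∈ s k, c k n • φ (σ n) x := fun k =>
    ContDiff.sum fun n _ => (hφ (σ n)).const_smul _
  have m0 := hsc.tendsto_eLpNorm hp1 (fun n => hmem (hφ (σ n))) hv hlimσ
  have m2 := hsc.tendsto_eLpNorm hp1 (fun n => memLp_of_continuous hb
    ae_mem_closure_surfaceMeasure (hφ (σ n)).continuous _) hg hglim
  have hgradm : ∀ n, MemLp (gradient (φ n)) (ENNReal.ofReal p) (volume.restrict Ω) := fun n =>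
    memLp_of_continuous hb (ae_mem_closure_volume hΩo) (continuous_gradient (hφ n)) _
  have m1 : Tendsto (fun k => eLpNorm (fun x => gradient (fun y => ∑ n ∈ s k, c k n • φ (σ n) y) x
      - l x) (ENNReal.ofReal p) (volume.restrict Ω)) atTop (𝓝 0) := by
    have hd := hsc.tendsto_eLpNorm hp1 (w := 0)
      (fun n => (hGm (σ n)).sub (hgradm (σ n))) MemLp.zero' (by
        refine (l1.comp hσ.tendsto_atTop).congr fun n => ?_
        rw [Function.comp_apply, ← eLpNorm_neg]
        congr 1
        ext1 x
        simp)
    refine tendsto_eLpNorm_sub_trans hp1 (hsum fun n => (hGm (σ n)).1) (fun k =>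
      (continuous_gradient (hψ k)).aestronglyMeasurable) (Lp.memLp l).1 (hd.congr fun k => ?_) hGlim
    congr 1
    ext1 x
    rw [gradient_sum_smul fun n => hφ (σ n)]
    simp [smul_sub]
  have hw : HasWeakGradient Ω v l := hasWeakGradient_of_tendsto hΩo hb hp hψ hv (Lp.memLp l) m0 m1
  have hvW : MemW1p Ω (ENNReal.ofReal p) v := ⟨hv, l, hw, Lp.memLp l⟩
  have hvg := (isTrace_of_tendsto hΩo hψ hw hg m0 m1 m2).ae_eq P hΩo hp hvW
    (isTrace_trace P hΩo hb hp hvW)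
  refine ⟨σ, v, fun k => s (τ k), fun k => c (τ k), hσ, hvW, hsc.comp hτ, hae, ?_, ?_⟩
  · filter_upwards [hGae, hw.ae_eq hΩo hw.weakGradient] with x hx1 hx2
    rw [← hx2]
    exact hx1
  · refine (tendsto_eLpNorm_sub_trans hp1 (fun n => hφs (σ n)) (fun n => (htr (σ n)).1.1) hg.1
      (l2.comp hσ.tendsto_atTop) hglim).congr fun n => eLpNorm_congr_ae ?_
    filter_upwards [hvg] with x hx
    rw [hx]

end Compactness

/-! ### The energy -/

section Energy

variable {N : ℕ} {Ω Γ₀ Γ₁ : Set (EuclideanSpace ℝ (Fin N))}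
  {f : ℝ → EuclideanSpace ℝ (Fin N) → EReal} {γ : ℝ → ℝ} {α p C : ℝ}

/-- `lintegral_shifted_le` when the bound holds for large indices only. -/
lemma lintegral_shifted_le_of_eventually {X : Type*} [MeasurableSpace X] {μ : Measure X}
    (hα : 0 < α) (hp : 1 < p) (hf_conv : ∀ t, EConvex (f t))
    (hf_lsc : LowerSemicontinuous (fun q : ℝ × EuclideanSpace ℝ (Fin N) => f q.1 q.2))
    (hgrowth : ∀ t z, ((α * ‖z‖ ^ p - C : ℝ) : EReal) ≤ f t z)
    {s : ℕ → Finset ℕ} {c : ℕ → ℕ → ℝ} (hsc : IsTailWeights s c)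
    {u : ℕ → X → ℝ} {u₀ : X → ℝ} {G : ℕ → X → EuclideanSpace ℝ (Fin N)}
    {G₀ : X → EuclideanSpace ℝ (Fin N)}
    (hu_meas : ∀ n, AEMeasurable (u n) μ) (hG_meas : ∀ n, AEMeasurable (G n) μ)
    (hu : ∀ᵐ x ∂μ, Tendsto (fun n => u n x) atTop (𝓝 (u₀ x)))
    (hG : ∀ᵐ x ∂μ, Tendsto (fun k => ∑ n ∈ s k, c k n • G n x) atTop (𝓝 (G₀ x)))
    {B : ℝ≥0∞} (hB : ∀ᶠ n in atTop, ∫⁻ x, shifted f C (u n x) (G n x) ∂μ ≤ B) :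
    ∫⁻ x, shifted f C (u₀ x) (G₀ x) ∂μ ≤ B := by
  obtain ⟨m, hm⟩ := eventually_atTop.1 hB
  refine lintegral_shifted_le hα hp hf_conv hf_lsc hgrowth hsc (u := fun n => u (max n m))
    (G := fun n => G (max n m)) (fun _ => hu_meas _) (fun _ => hG_meas _) ?_ ?_
    fun n => hm _ (le_max_right _ _)
  · filter_upwards [hu] with x hx
    exact hx.comp (tendsto_atTop_mono (fun n => le_max_left n m) tendsto_id)
  · filter_upwards [hG] with x hx
    refine hx.congr' ?_
    filter_upwards [eventually_ge_atTop m] with k hk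
    refine Finset.sum_congr rfl fun n hn => ?_
    rw [max_eq_left (hk.trans (hsc.le k n hn))]

/-- The two alternative hypotheses on `γ` in the form in which they are used: a lower bound by
`c |t| - c₁`, with `c > 0` when no boundary values are prescribed. -/
lemma exists_boundary_growth {K : ℝ≥0} (hγ : LipschitzWith K γ) (hγ_zero : γ 0 = 0) {P : Prop}
    (hdir : P → BddBelow (range γ))
    (hneu : ¬P → 0 < liminf (fun t : ℝ => ((γ t / |t| : ℝ) : EReal))
      (comap (fun t : ℝ => |t|) atTop)) :
    ∃ c c₁ : ℝ, 0 ≤ c ∧ (¬P → 0 < c) ∧ ∀ t, c * |t| - c₁ ≤ γ t := by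
  by_cases h : P
  · obtain ⟨m, hm⟩ := hdir h
    refine ⟨0, -m, le_rfl, fun h' => absurd h h', fun t => ?_⟩
    have := hm (mem_range_self t)
    linarith
  · obtain ⟨c, hc0, hc⟩ := EReal.lt_iff_exists_real_btwn.1 (hneu h)
    have hc0' : 0 < c := by exact_mod_cast hc0
    have hev := eventually_lt_of_lt_liminf hc
    rw [eventually_comap, eventually_atTop] at hev
    obtain ⟨T, hT⟩ := hev
    refine ⟨c, (c + K) * max T 1, hc0'.le, fun _ => hc0', fun t => ?_⟩
    rcases le_or_gt (max T 1) |t| with ht | ht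
    · have h1 : c < γ t / |t| := by exact_mod_cast hT |t| ((le_max_left _ _).trans ht) t rfl
      have ht0 : 0 < |t| := lt_of_lt_of_le one_pos ((le_max_right _ _).trans ht)
      rw [lt_div_iff₀ ht0] at h1
      have h2 : 0 ≤ (c + K) * max T 1 := by positivity
      linarith
    · have h1 := hγ.dist_le_mul t 0
      rw [hγ_zero, dist_zero_right, dist_zero_right, Real.norm_eq_abs, Real.norm_eq_abs] at h1
      have h2 := neg_abs_le (γ t)
      have h3 : (c + K) * |t| ≤ (c + K) * max T 1 := by gcongr
      linarith

variable {ι : Type} [Fintype ι]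

lemma integrable_comp_trace (P : InwardPartition Ω ι) (hΩo : IsOpen Ω)
    (hb : Bornology.IsBounded Ω) (hp : 1 < p) {K : ℝ≥0} (hγ : LipschitzWith K γ)
    (hγ_zero : γ 0 = 0) {v : EuclideanSpace ℝ (Fin N) → ℝ}
    (hv : MemW1p Ω (ENNReal.ofReal p) v) :
    Integrable (fun x => γ (trace Ω (ENNReal.ofReal p) v x)) (surfaceMeasure Ω) := by
  have hp1 : 1 ≤ ENNReal.ofReal p := by simpa using hp.le
  have hsfin := P.isFiniteMeasure_surfaceMeasure hb
  exact (hγ.comp_memLp hγ_zero (isTrace_trace P hΩo hb hp hv).1).integrable hp1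

/-- The energy as the sum of a nonnegative integral and a real number. -/
lemma energy_eq (P : InwardPartition Ω ι) (hΩo : IsOpen Ω) (hb : Bornology.IsBounded Ω)
    (hα : 0 < α) (hp : 1 < p)
    (hf_lsc : LowerSemicontinuous (fun q : ℝ × EuclideanSpace ℝ (Fin N) => f q.1 q.2))
    (hC : 0 ≤ C) (hgrowth : ∀ t z, ((α * ‖z‖ ^ p - C : ℝ) : EReal) ≤ f t z)
    {K : ℝ≥0} (hγ : LipschitzWith K γ) (hγ_zero : γ 0 = 0) {v : EuclideanSpace ℝ (Fin N) → ℝ}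
    (hv : MemW1p Ω (ENNReal.ofReal p) v) :
    energy Ω Γ₁ (ENNReal.ofReal p) f γ v =
      ((∫⁻ x in Ω, shifted f C (v x) (weakGradient Ω v x) : ℝ≥0∞) : EReal) +
      (((∫ x in Γ₁, γ (trace Ω (ENNReal.ofReal p) v x) ∂(surfaceMeasure Ω)) -
        C * volume.real Ω : ℝ) : EReal) := by
  have hfin : IsFiniteMeasure (volume.restrict Ω) := isFiniteMeasure_restrict.2 hb.measure_lt_top.ne
  have hm : AEMeasurable (fun x => f (v x) (weakGradient Ω v x)) (volume.restrict Ω) :=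
    hf_lsc.measurable.comp_aemeasurable
      (hv.1.1.aemeasurable.prodMk (hv.memLp_weakGradient hΩo).1.aemeasurable)
  rw [energy, eintegral_eq_sub hm hC, eintegral_coe
    (integrable_comp_trace P hΩo hb hp hγ hγ_zero hv).restrict, measureReal_restrict_apply_univ,
    sub_eq_add_neg, add_assoc, ← EReal.coe_neg, ← EReal.coe_add, neg_add_eq_sub]
  · rfl
  · intro x
    refine le_trans ?_ (hgrowth _ _)
    have : 0 ≤ α * ‖weakGradient Ω v x‖ ^ p := by positivity
    exact_mod_cast (by linarith : -C ≤ α * ‖weakGradient Ω v x‖ ^ p - C)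

/-- Coercivity of the bulk energy. -/
lemma eLpNorm_rpow_le_lintegral_shifted (hα : 0 < α) (hp : 1 < p)
    (hgrowth : ∀ t z, ((α * ‖z‖ ^ p - C : ℝ) : EReal) ≤ f t z)
    (v : EuclideanSpace ℝ (Fin N) → ℝ) (G : EuclideanSpace ℝ (Fin N) → EuclideanSpace ℝ (Fin N)) :
    ENNReal.ofReal α * eLpNorm G (ENNReal.ofReal p) (volume.restrict Ω) ^ p ≤
      ∫⁻ x in Ω, shifted f C (v x) (G x) := by
  have hp0 : 0 < p := by linarith
  rw [eLpNorm_rpow hp, ← lintegral_const_mul' _ _ ENNReal.ofReal_ne_top]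
  refine lintegral_mono fun x => ?_
  have h1 : ((α * ‖G x‖ ^ p : ℝ) : EReal) ≤ f (v x) (G x) + C := by
    calc ((α * ‖G x‖ ^ p : ℝ) : EReal) = ((α * ‖G x‖ ^ p - C : ℝ) : EReal) + C := by
          rw [← EReal.coe_add, sub_add_cancel]
      _ ≤ _ := by gcongr; exact hgrowth _ _
  calc ENNReal.ofReal α * ‖G x‖ₑ ^ p = ENNReal.ofReal (α * ‖G x‖ ^ p) := by
        rw [ENNReal.ofReal_mul hα.le, ← ofReal_norm, ENNReal.ofReal_rpow_of_nonneg (norm_nonneg _)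
          hp0.le]
    _ = ((α * ‖G x‖ ^ p : ℝ) : EReal).toENNReal := by
          rw [EReal.toENNReal_of_ne_top (EReal.coe_ne_top _), EReal.toReal_coe]
    _ ≤ _ := EReal.toENNReal_le_toENNReal h1

/-- Coercivity of the boundary energy. -/
lemma le_setIntegral_comp_trace (P : InwardPartition Ω ι) (hΩo : IsOpen Ω)
    (hb : Bornology.IsBounded Ω) (hp : 1 < p) {K : ℝ≥0} (hγ : LipschitzWith K γ)
    (hγ_zero : γ 0 = 0) {c c₁ : ℝ} (hc : ∀ t, c * |t| - c₁ ≤ γ t)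
    {v : EuclideanSpace ℝ (Fin N) → ℝ} (hv : MemW1p Ω (ENNReal.ofReal p) v) :
    c * (∫ x in Γ₁, |trace Ω (ENNReal.ofReal p) v x| ∂(surfaceMeasure Ω)) -
        c₁ * (surfaceMeasure Ω).real Γ₁ ≤
      ∫ x in Γ₁, γ (trace Ω (ENNReal.ofReal p) v x) ∂(surfaceMeasure Ω) := by
  have hp1 : 1 ≤ ENNReal.ofReal p := by simpa using hp.le
  have hsfin := P.isFiniteMeasure_surfaceMeasure hb
  have hint : Integrable (fun x => |trace Ω (ENNReal.ofReal p) v x|)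
      ((surfaceMeasure Ω).restrict Γ₁) :=
    (((isTrace_trace P hΩo hb hp hv).1.integrable hp1).restrict).abs
  calc _ = ∫ x in Γ₁, (c * |trace Ω (ENNReal.ofReal p) v x| - c₁) ∂(surfaceMeasure Ω) := by
        rw [integral_sub (hint.const_mul c) (integrable_const _), integral_const_mul,
          integral_const, measureReal_restrict_apply_univ, smul_eq_mul, mul_comm c₁]
    _ ≤ _ := integral_mono ((hint.const_mul c).sub (integrable_const _))
        (integrable_comp_trace P hΩo hb hp hγ hγ_zero hv).restrict fun x => hc _

/-- The boundary energy is continuous with respect to convergence of traces in `L^p(∂Ω)`. -/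
lemma tendsto_setIntegral_comp_trace (P : InwardPartition Ω ι) (hΩo : IsOpen Ω)
    (hb : Bornology.IsBounded Ω) (hp : 1 < p) {K : ℝ≥0} (hγ : LipschitzWith K γ)
    (hγ_zero : γ 0 = 0) {u : ℕ → EuclideanSpace ℝ (Fin N) → ℝ} {v : EuclideanSpace ℝ (Fin N) → ℝ}
    (hu : ∀ n, MemW1p Ω (ENNReal.ofReal p) (u n)) (hv : MemW1p Ω (ENNReal.ofReal p) v)
    (h : Tendsto (fun n => eLpNorm (fun x => trace Ω (ENNReal.ofReal p) (u n) x -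
        trace Ω (ENNReal.ofReal p) v x) (ENNReal.ofReal p) (surfaceMeasure Ω)) atTop (𝓝 0)) :
    Tendsto (fun n => ∫ x in Γ₁, γ (trace Ω (ENNReal.ofReal p) (u n) x) ∂(surfaceMeasure Ω)) atTop
      (𝓝 (∫ x in Γ₁, γ (trace Ω (ENNReal.ofReal p) v x) ∂(surfaceMeasure Ω))) := by
  have hp1 : 1 ≤ ENNReal.ofReal p := by simpa using hp.le
  have hp0 : 0 < p := by linarith
  have hsfin := P.isFiniteMeasure_surfaceMeasure hb
  have hexp : 0 ≤ 1 / (1 : ℝ≥0∞).toReal - 1 / (ENNReal.ofReal p).toReal := by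
    rw [ENNReal.toReal_ofReal hp0.le, ENNReal.toReal_one, div_one, sub_nonneg, div_le_one hp0]
    exact hp.le
  have h1 := ENNReal.Tendsto.const_mul (a := (K : ℝ≥0∞)) (ENNReal.Tendsto.mul_const h (Or.inr
    (ENNReal.rpow_ne_top_of_nonneg hexp (measure_ne_top (surfaceMeasure Ω) univ))))
    (Or.inr ENNReal.coe_ne_top)
  rw [zero_mul, mul_zero] at h1
  refine tendsto_integral_of_L1' _ (integrable_comp_trace P hΩo hb hp hγ hγ_zero hv).restrict.1
    (Eventually.of_forall fun n =>
      (integrable_comp_trace P hΩo hb hp hγ hγ_zero (hu n)).restrict) ?_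
  refine tendsto_of_tendsto_of_tendsto_of_le_of_le tendsto_const_nhds h1 (fun _ => zero_le)
    fun n => ?_
  refine (eLpNorm_mono_measure _ Measure.restrict_le_self).trans ?_
  refine le_trans ?_ (mul_le_mul_right (eLpNorm_le_eLpNorm_mul_rpow_measure_univ hp1
    ((isTrace_trace P hΩo hb hp (hu n)).1.sub (isTrace_trace P hΩo hb hp hv).1).1) _)
  rw [eLpNorm_one_eq_lintegral_enorm, eLpNorm_one_eq_lintegral_enorm,
    ← lintegral_const_mul' _ _ ENNReal.coe_ne_top]
  refine lintegral_mono fun x => ?_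
  have h2 := hγ (trace Ω (ENNReal.ofReal p) (u n) x) (trace Ω (ENNReal.ofReal p) v x)
  rwa [edist_eq_enorm_sub, edist_eq_enorm_sub] at h2

end Energy

end PrimalProblem

open PrimalProblem in
theorem proposition2p2 (N : ℕ) (hN : 1 ≤ N)
    -- the domain and the partition of its boundary
    (Ω Γ₀ Γ₁ : Set (EuclideanSpace ℝ (Fin N)))
    (hΩ_open : IsOpen Ω) (hΩ_conn : IsConnected Ω) (hΩ_bdd : Bornology.IsBounded Ω)
    (hΩ_lip : PrimalProblem.HasLipschitzBoundary Ω)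
    (hΓ_union : Γ₀ ∪ Γ₁ = frontier Ω) (hΓ_disj : Disjoint Γ₀ Γ₁)
    (hΓ₀_meas : NullMeasurableSet Γ₀ (PrimalProblem.surfaceMeasure Ω))
    (hΓ₁_meas : NullMeasurableSet Γ₁ (PrimalProblem.surfaceMeasure Ω))
    -- the exponent and the bulk integrand
    (p : ℝ) (hp : 1 < p)
    (f : ℝ → EuclideanSpace ℝ (Fin N) → EReal) (hf_bot : ∀ t z, ⊥ < f t z)
    (hf_conv : ∀ t, PrimalProblem.EConvex (f t))
    (hf_lsc : LowerSemicontinuous (fun q : ℝ × EuclideanSpace ℝ (Fin N) => f q.1 q.2))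
    (α : ℝ) (hα : 0 < α) (r : ℝ → ℝ) (hr_meas : Measurable r)
    (hr : ∃ C : ℝ, 0 < C ∧ ∀ t, 0 ≤ r t ∧ r t ≤ C)
    (hf_growth : ∀ t z, ((α * ‖z‖ ^ p - r t : ℝ) : EReal) ≤ f t z)
    (hf_usc : ∃ D : Set ℝ, volume D = 0 ∧
      ∀ z, ∀ t ∉ D, UpperSemicontinuousAt (fun s => f s z) t)
    -- the boundary integrand
    (γ : ℝ → ℝ) (hγ_lip : ∃ K : ℝ≥0, LipschitzWith K γ) (hγ_zero : γ 0 = 0)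
    (hγ_dir : PrimalProblem.surfaceMeasure Ω Γ₀ ≠ 0 → BddBelow (range γ))
    (hγ_neu : PrimalProblem.surfaceMeasure Ω Γ₀ = 0 →
      0 < liminf (fun t : ℝ => ((γ t / |t| : ℝ) : EReal)) (comap (fun t : ℝ => |t|) atTop))
    -- the boundary datum, and the existence of a competitor of finite energy
    (u₀ : EuclideanSpace ℝ (Fin N) → ℝ) (hu₀ : PrimalProblem.MemW1p Ω (ENNReal.ofReal p) u₀)
    (h_finite : ∃ u ∈ PrimalProblem.admissible Ω Γ₀ (ENNReal.ofReal p) u₀,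
      PrimalProblem.energy Ω Γ₁ (ENNReal.ofReal p) f γ u < ⊤) :
    PrimalProblem.primalInf Ω Γ₀ Γ₁ (ENNReal.ofReal p) f γ u₀ ≠ ⊥ ∧
    PrimalProblem.primalInf Ω Γ₀ Γ₁ (ENNReal.ofReal p) f γ u₀ ≠ ⊤ ∧
    ∃ u ∈ PrimalProblem.admissible Ω Γ₀ (ENNReal.ofReal p) u₀,
      PrimalProblem.energy Ω Γ₁ (ENNReal.ofReal p) f γ u =
        PrimalProblem.primalInf Ω Γ₀ Γ₁ (ENNReal.ofReal p) f γ u₀ := by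
  have hp0 : 0 < p := by linarith
  have hp1 : 1 ≤ ENNReal.ofReal p := by simpa using hp.le
  obtain ⟨ι, _, ⟨P⟩⟩ := exists_inwardPartition hN hΩ_open hΩ_bdd hΩ_lip
  have hsfin := P.isFiniteMeasure_surfaceMeasure hΩ_bdd
  obtain ⟨C, hC, hrC⟩ := hr
  have hgrowth : ∀ t z, ((α * ‖z‖ ^ p - C : ℝ) : EReal) ≤ f t z := fun t z =>
    le_trans (by exact_mod_cast sub_le_sub_left (hrC t).2 _) (hf_growth t z)
  obtain ⟨K, hγ⟩ := hγ_lip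
  obtain ⟨c, c₁, hc0, hc_pos, hc⟩ := exists_boundary_growth hγ hγ_zero
    (P := surfaceMeasure Ω Γ₀ ≠ 0) hγ_dir fun h => hγ_neu (not_not.1 h)
  let I : (EuclideanSpace ℝ (Fin N) → ℝ) → ℝ≥0∞ := fun v =>
    ∫⁻ x in Ω, shifted f C (v x) (weakGradient Ω v x)
  let b : (EuclideanSpace ℝ (Fin N) → ℝ) → ℝ := fun v =>
    ∫ x in Γ₁, γ (trace Ω (ENNReal.ofReal p) v x) ∂(surfaceMeasure Ω)
  let κ : ℝ := C * volume.real Ω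
  have hE : ∀ v, MemW1p Ω (ENNReal.ofReal p) v → energy Ω Γ₁ (ENNReal.ofReal p) f γ v =
      (I v : EReal) + ((b v - κ : ℝ) : EReal) := fun v hv =>
    energy_eq P hΩ_open hΩ_bdd hα hp hf_lsc hC.le hgrowth hγ hγ_zero hv
  -- the energy is bounded below
  let d : ℝ := c₁ * (surfaceMeasure Ω).real Γ₁
  have hb : ∀ v, MemW1p Ω (ENNReal.ofReal p) v →
      c * (∫ x in Γ₁, |trace Ω (ENNReal.ofReal p) v x| ∂(surfaceMeasure Ω)) - d ≤ b v :=
    fun v hv => le_setIntegral_comp_trace P hΩ_open hΩ_bdd hp hγ hγ_zero hc hv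
  have hb' : ∀ v, MemW1p Ω (ENNReal.ofReal p) v → -d ≤ b v := fun v hv => by
    have h1 := hb v hv
    have h2 : 0 ≤ c * (∫ x in Γ₁, |trace Ω (ENNReal.ofReal p) v x| ∂(surfaceMeasure Ω)) :=
      mul_nonneg hc0 (integral_nonneg fun x => abs_nonneg _)
    linarith
  have hbot : primalInf Ω Γ₀ Γ₁ (ENNReal.ofReal p) f γ u₀ ≠ ⊥ := by
    have h1 : ((-d - κ : ℝ) : EReal) ≤ primalInf Ω Γ₀ Γ₁ (ENNReal.ofReal p) f γ u₀ := by
      refine le_sInf ?_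
      rintro _ ⟨v, hv, rfl⟩
      rw [hE v hv.1]
      calc ((-d - κ : ℝ) : EReal) ≤ ((b v - κ : ℝ) : EReal) := by
            exact_mod_cast sub_le_sub_right (hb' v hv.1) κ
        _ ≤ _ := le_add_of_nonneg_left (EReal.coe_ennreal_nonneg _)
    exact fun h => EReal.coe_ne_bot _ (le_bot_iff.1 (h ▸ h1))
  have htop : primalInf Ω Γ₀ Γ₁ (ENNReal.ofReal p) f γ u₀ ≠ ⊤ := by
    obtain ⟨u, hu, hu'⟩ := h_finite
    exact ((sInf_le (mem_image_of_mem _ hu)).trans_lt hu').ne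
  refine ⟨hbot, htop, ?_⟩
  obtain ⟨i, hi⟩ : ∃ i : ℝ, (i : EReal) = primalInf Ω Γ₀ Γ₁ (ENNReal.ofReal p) f γ u₀ :=
    ⟨_, EReal.coe_toReal htop hbot⟩
  -- a minimizing sequence
  have hmin : ∀ n : ℕ, ∃ v ∈ admissible Ω Γ₀ (ENNReal.ofReal p) u₀,
      I v ≠ ⊤ ∧ (I v).toReal + b v - κ < i + 1 / (n + 1 : ℝ) := by
    intro n
    have h1 : primalInf Ω Γ₀ Γ₁ (ENNReal.ofReal p) f γ u₀ <
        ((i + 1 / (n + 1 : ℝ) : ℝ) : EReal) := by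
      rw [← hi]
      have : i < i + 1 / (n + 1 : ℝ) := lt_add_of_pos_right _ (by positivity)
      exact_mod_cast this
    obtain ⟨_, ⟨v, hv, rfl⟩, hlt⟩ := sInf_lt_iff.1 h1
    rw [hE v hv.1] at hlt
    have hIv : I v ≠ ⊤ := by
      intro h
      rw [h, EReal.coe_ennreal_top, EReal.top_add_coe] at hlt
      exact not_top_lt hlt
    refine ⟨v, hv, hIv, ?_⟩
    rw [← EReal.coe_ennreal_toReal hIv, ← EReal.coe_add, EReal.coe_lt_coe_iff] at hlt
    linarith
  choose u hu hIu hlt using hmin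
  have hle1 : ∀ n : ℕ, 1 / (n + 1 : ℝ) ≤ 1 := fun n => by
    rw [div_le_one (by positivity)]
    have : (0 : ℝ) ≤ n := n.cast_nonneg
    linarith
  -- its gradients and the traces on a suitable part of the boundary are bounded
  obtain ⟨R₁, hR₁⟩ : ∃ R : ℝ≥0, ∀ n, eLpNorm (weakGradient Ω (u n)) (ENNReal.ofReal p)
      (volume.restrict Ω) ≤ R := by
    let A : ℝ≥0∞ := (ENNReal.ofReal (i + 1 + κ + d) / ENNReal.ofReal α) ^ p⁻¹
    have hA : A ≠ ⊤ := ENNReal.rpow_ne_top_of_nonneg (inv_pos.2 hp0).le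
      (ENNReal.div_ne_top ENNReal.ofReal_ne_top (by simpa using hα))
    refine ⟨A.toNNReal, fun n => ?_⟩
    rw [ENNReal.coe_toNNReal hA, ENNReal.le_rpow_inv_iff hp0, ENNReal.le_div_iff_mul_le
      (Or.inl (by simpa using hα)) (Or.inl ENNReal.ofReal_ne_top), mul_comm]
    refine (eLpNorm_rpow_le_lintegral_shifted hα hp hgrowth (u n) _).trans ?_
    refine (ENNReal.le_ofReal_iff_toReal_le (hIu n) ?_).2 ?_
    · have h1 := hlt n
      have h2 := hle1 n
      have h3 := hb' _ (hu n).1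
      have h4 : 0 ≤ (I (u n)).toReal := ENNReal.toReal_nonneg
      linarith
    · have h1 := hlt n
      have h2 := hle1 n
      have h3 := hb' _ (hu n).1
      change (I (u n)).toReal ≤ _
      linarith
  have hint : ∀ v, MemW1p Ω (ENNReal.ofReal p) v →
      Integrable (trace Ω (ENNReal.ofReal p) v) (surfaceMeasure Ω) := fun v hv =>
    (isTrace_trace P hΩ_open hΩ_bdd hp hv).1.integrable hp1
  obtain ⟨S, R₂, hS, hR₂⟩ : ∃ (S : Set (EuclideanSpace ℝ (Fin N))) (R : ℝ≥0),
      surfaceMeasure Ω S ≠ 0 ∧ ∀ n, ∫⁻ x in S, ‖trace Ω (ENNReal.ofReal p) (u n) x‖ₑ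
        ∂(surfaceMeasure Ω) ≤ R := by
    by_cases h0 : surfaceMeasure Ω Γ₀ = 0
    · have hcp : 0 < c := hc_pos (not_not.2 h0)
      refine ⟨Γ₁, ((i + 1 + κ + d) / c).toNNReal, fun h1 => ?_, fun n => ?_⟩
      · refine surfaceMeasure_ne_zero hN hΩ_open hΩ_conn.nonempty hΩ_bdd hΩ_lip ?_
        have h2 : surfaceMeasure Ω (frontier Ω) = 0 := by
          rw [← hΓ_union]
          exact measure_union_null h0 h1
        rw [surfaceMeasure, Measure.restrict_apply_self] at h2
        rw [surfaceMeasure, Measure.restrict_eq_zero, h2]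
      · change _ ≤ ENNReal.ofReal _
        rw [← ofReal_integral_norm_eq_lintegral_enorm (hint _ (hu n).1).restrict]
        refine ENNReal.ofReal_le_ofReal ?_
        rw [le_div_iff₀ hcp, mul_comm]
        have h1 := hlt n
        have h2 := hle1 n
        have h3 := hb _ (hu n).1
        have h4 : 0 ≤ (I (u n)).toReal := ENNReal.toReal_nonneg
        simp only [Real.norm_eq_abs]
        linarith
    · refine ⟨Γ₀, (∫⁻ x in Γ₀, ‖trace Ω (ENNReal.ofReal p) u₀ x‖ₑ
        ∂(surfaceMeasure Ω)).toNNReal, h0, fun n => ?_⟩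
      rw [ENNReal.coe_toNNReal (hint _ hu₀).restrict.2.ne]
      refine (lintegral_congr_ae ?_).le
      filter_upwards [(hu n).2] with x hx
      rw [hx]
  obtain ⟨σ, v, s, w, hσ, hv, hsw, hae, hGae, htr⟩ := P.exists_weak_limit hΩ_open hΩ_conn hΩ_bdd hp
    hS (fun n => (hu n).1) (R := max R₁ R₂)
    (fun n => (hR₁ n).trans (by exact_mod_cast le_max_left _ _))
    (fun n => (hR₂ n).trans (by exact_mod_cast le_max_right _ _))
  have hv_adm : v ∈ admissible Ω Γ₀ (ENNReal.ofReal p) u₀ := by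
    refine ⟨hv, ?_⟩
    refine ae_eq_of_tendsto_eLpNorm hp1 (fun n =>
      (hint _ (hu (σ n)).1).1.mono_measure Measure.restrict_le_self)
      ((hint _ hv).1.mono_measure Measure.restrict_le_self)
      ((hint _ hu₀).1.mono_measure Measure.restrict_le_self)
      (tendsto_of_tendsto_of_tendsto_of_le_of_le tendsto_const_nhds htr (fun _ => zero_le)
        fun n => eLpNorm_mono_measure _ Measure.restrict_le_self) ?_
    refine tendsto_const_nhds.congr fun n => Eq.symm ?_
    refine (eLpNorm_congr_ae ?_).trans eLpNorm_zero
    filter_upwards [(hu (σ n)).2] with x hx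
    rw [hx, sub_self]
    rfl
  -- the limit of the bulk energies along the subsequence
  let t : ℝ := i + κ - b v
  have hlim : Tendsto (fun n => i + 1 / ((σ n : ℝ) + 1) + κ - b (u (σ n))) atTop (𝓝 t) := by
    have h1 := tendsto_setIntegral_comp_trace (Γ₁ := Γ₁) P hΩ_open hΩ_bdd hp hγ hγ_zero
      (fun n => (hu (σ n)).1) hv htr
    have h2 := tendsto_one_div_add_atTop_nhds_zero_nat (𝕜 := ℝ).comp hσ.tendsto_atTop
    simpa [t] using (((h2.const_add i).add_const κ).sub h1)
  have ht0 : 0 ≤ t := ge_of_tendsto' hlim fun n => by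
    have h1 := hlt (σ n)
    have h4 : 0 ≤ (I (u (σ n))).toReal := ENNReal.toReal_nonneg
    linarith
  have hIv : I v ≤ ENNReal.ofReal t := by
    have h1 : ∀ B, t < B → I v ≤ ENNReal.ofReal B := by
      intro B hB
      refine lintegral_shifted_le_of_eventually hα hp hf_conv hf_lsc hgrowth hsw
        (fun n => (hu (σ n)).1.1.1.aemeasurable)
        (fun n => ((hu (σ n)).1.memLp_weakGradient hΩ_open).1.aemeasurable) hae hGae ?_
      filter_upwards [hlim.eventually (gt_mem_nhds hB)] with n hn
      refine (ENNReal.le_ofReal_iff_toReal_le (hIu (σ n)) (ht0.trans hB.le)).2 ?_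
      have h2 := hlt (σ n)
      change (I (u (σ n))).toReal ≤ _
      linarith
    have h2 : Tendsto (fun B => ENNReal.ofReal B) (𝓝[>] t) (𝓝 (ENNReal.ofReal t)) :=
      (ENNReal.continuous_ofReal.tendsto t).mono_left nhdsWithin_le_nhds
    exact ge_of_tendsto h2 (eventually_nhdsWithin_of_forall h1)
  refine ⟨v, hv_adm, le_antisymm ?_ (sInf_le (mem_image_of_mem _ hv_adm))⟩
  rw [hE v hv, ← hi]
  calc (I v : EReal) + ((b v - κ : ℝ) : EReal)
      ≤ ((ENNReal.ofReal t : ℝ≥0∞) : EReal) + ((b v - κ : ℝ) : EReal) := by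
        exact add_le_add_left (EReal.coe_ennreal_le_coe_ennreal_iff.2 hIv) _
    _ = (i : EReal) := by
        rw [EReal.coe_ennreal_ofReal, max_eq_left ht0, ← EReal.coe_add]
        congr 1
        simp only [t]
        ring
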